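/- Write $\bm w_k(x)=(1+|x|)^k$ for $k,x\in\mathbb R$, $\|f\|_{L^p(\bm w_k)}^p=\int_{\mathbb R}|f|^p\bm w_k^p\,dx$, $\|f\|_{H^1(\bm w_k)}^2=\|f\|_{L^2(\bm w_k)}^2+\|f'\|_{L^2(\bm w_k)}^2$, $\|f\|_{W^{1,1}}=\|f\|_{L^1}+\|f'\|_{L^1}$ ($f'$ the weak derivative) and $\hat f(\xi)=\int_{\mathbb R} f(x)e^{-ix\xi}\,dx$. For $\gamma\in[0,1)$ let $\mathscr E_\gamma$ be the set of all nonnegative $G\in\bigcap_{s<3}L^1(\bm w_s)$ with $\int_{\mathbb R} G\,dx=1$ and $\int_{\mathbb R} xG\,dx=0$ that solve the steady one-dimensional sticky-particle inelastic Boltzmann equation $\frac14\partial_x(xG)=\mathcal Q_\gamma(G,G)$ weakly, i.e. for every continuously differentiable $\varphi:\mathbb R\to\mathbb R$ with $\varphi$ and $\varphi'$ bounded, $$-\frac14\int_{\mathbb R}x\varphi'(x)G(x)\,dx=\frac12\int_{\mathbb R^2}G(x)G(y)\Big[2\varphi\Big(\frac{x+y}2\Big)-\varphi(x)-\varphi(y)\Big]|x-y|^\gamma\,dx\,dy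 .$$ **Theorem 3.6.** Let $\delta\in(0,\frac12)$. There exist $\gamma_\star\in(0,1)$ and $C>0$ (depending only on $\delta$) such that, for every $\gamma\in(0,\gamma_\star)$ and every $G_\gamma\in\mathscr E_\gamma$, the function $G_\gamma$ has a weak derivative and $$\|G_\gamma\|_{H^1(\bm w_k)}+\|G_\gamma\|_{W^{1,1}}\le C\qquad\text{for all } k \text{ with } 0\le k<3-\tfrac{5\gamma}2-\delta .$$ In particular, with the same constant $C$, $|\widehat{G_\gamma}(\xi)|\le \dfrac{C}{\sqrt{1+\xi^2}}$ for all $\xi\in\mathbb R$. -/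

import Mathlib

open MeasureTheory
open scoped ContDiff ENNReal

noncomputable section

/-- The polynomial weight `w_k(x) = (1 + |x|)^k`. -/
def polyWeight (k x : ℝ) : ℝ := (1 + |x|) ^ k

/-- `Δφ(x, y) = 2 φ((x + y) / 2) - φ(x) - φ(y)`, the jump of `φ` under a sticky collision. -/
def stickyJump (φ : ℝ → ℝ) (x y : ℝ) : ℝ := 2 * φ ((x + y) / 2) - φ x - φ y

/-- The collision operator `Q_γ(f, g)` in weak form, tested against `φ`:
`(1/2) ∬ f(x) g(y) Δφ(x, y) |x - y|^γ dx dy`. -/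
def collisionWeak (γ : ℝ) (f g φ : ℝ → ℝ) : ℝ :=
  (1 / 2) * ∫ p : ℝ × ℝ, f p.1 * g p.2 * stickyJump φ p.1 p.2 * |p.1 - p.2| ^ γ

/-- The test functions of class `C_b^1`: continuously differentiable, bounded, with bounded
derivative. -/
def IsCb1 (φ : ℝ → ℝ) : Prop :=
  ContDiff ℝ 1 φ ∧ (∃ B : ℝ, ∀ x, |φ x| ≤ B) ∧ (∃ B : ℝ, ∀ x, |deriv φ x| ≤ B)

/-- `G` is a weak solution of the steady equation `(1/4) (x G)' = Q_γ(G, G)`. For the functions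
to which this is applied (`G` integrable against every `w_s`, `s < 3`, and `0 ≤ γ ≤ 1`), both
integrals converge absolutely. -/
def IsSteadyState (γ : ℝ) (G : ℝ → ℝ) : Prop :=
  ∀ φ : ℝ → ℝ, IsCb1 φ →
    -(1 / 4) * ∫ x : ℝ, x * deriv φ x * G x = collisionWeak γ G G φ

/-- The set of steady self-similar profiles: nonnegative functions in every `L^1(w_s)`, `s < 3`,
with unit mass and zero momentum, that solve the steady equation. -/
structure IsProfile (γ : ℝ) (G : ℝ → ℝ) : Prop where
  nonneg : ∀ᵐ x : ℝ, 0 ≤ G x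
  integrable_weight : ∀ s : ℝ, s < 3 → Integrable (fun x : ℝ => polyWeight s x * G x)
  mass : ∫ x : ℝ, G x = 1
  momentum : ∫ x : ℝ, G x * x = 0
  steady : IsSteadyState γ G

/-- `f'` is the weak (distributional) derivative of `f` on the real line. -/
def HasWeakDeriv (f f' : ℝ → ℝ) : Prop :=
  LocallyIntegrable f ∧ LocallyIntegrable f' ∧
    ∀ φ : ℝ → ℝ, ContDiff ℝ ∞ φ → HasCompactSupport φ →
      ∫ x : ℝ, f x * deriv φ x = -∫ x : ℝ, f' x * φ x

/-- The norm of `L^p(w_k)`, i.e. `(∫ |f|^p w_k^p dx)^(1/p)`, with values in `[0, ∞]`. -/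
def weightedLpNorm (p : ℝ≥0∞) (k : ℝ) (f : ℝ → ℝ) : ℝ≥0∞ :=
  eLpNorm (fun x : ℝ => polyWeight k x * f x) p volume

/-- The norm of `H^1(w_k)` of a function `f` with weak derivative `f'`, i.e.
`(‖f‖_{L^2(w_k)}^2 + ‖f'‖_{L^2(w_k)}^2)^(1/2)`, with values in `[0, ∞]`. -/
def weightedH1Norm (k : ℝ) (f f' : ℝ → ℝ) : ℝ≥0∞ :=
  (weightedLpNorm 2 k f ^ 2 + weightedLpNorm 2 k f' ^ 2) ^ (1 / 2 : ℝ)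

/-- The norm of `W^{1,1}` of a function `f` with weak derivative `f'`, with values in `[0, ∞]`. -/
def w11Norm (f f' : ℝ → ℝ) : ℝ≥0∞ :=
  eLpNorm f 1 volume + eLpNorm f' 1 volume

/-- The Fourier transform `∫ f(x) e^{-i x ξ} dx`. -/
def fourierHat (f : ℝ → ℝ) (ξ : ℝ) : ℂ :=
  ∫ x : ℝ, (f x : ℂ) * Complex.exp (-(Complex.I * (x : ℂ) * (ξ : ℂ)))

end

noncomputable section

/-! Integrated once, the equation says that the drift flux x G(x) / 4 equals the collisional flux
through x, an absolutely convergent pair integral (`ae_eq_flux`). Multiplied by the derivative of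
|x|^p it gives moment identities, estimated directly it gives pointwise bounds, and differentiated
it gives G'. It degenerates only at x = 0, and the work lies in controlling that point uniformly in
γ.

Moments. At order 2 the identity says that the pair moments of orders 2 and 2 + γ coincide;
convexity then bounds the energy above and compares it with higher moments. At order s in (2, 3) the
dissipation coefficient 1 - 2^(1-s) strictly exceeds the drift coefficient s/4, so the moment of
order s + γ is at most a constant times E^(s+γ), with E the square root of the energy. Since it also
dominates a multiple of E^2, the energy is bounded below (`exists_moment_bounds`).

No concentration. Against a bump of width r the drift has a sign, and a midpoint near 0 requires
either that both particles are near 0 or that one of them lies where the density is already bounded.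
The mass near 0 is thus controlled by its own square at a larger scale, up to terms r/ρ and γ/r
(`massNear_step`). The energy bound keeps this mass below 1 at some scale, and iteration drives it
below any threshold for small γ (`exists_massNear_le`).

Boundedness. With little mass near 0, the gain across a dyadic window is a small multiple of the
supremum while the loss rate is at least 1/2. Hence g(z) ≤ (3/8) A + const whenever g ≤ A on |x| ≥
|z|/2. As 3/8 < 1/2, iterating from the crude bound 8/|x| removes the singularity (`bounded`);
moments supply the decay at infinity (`exists_decay`).

Regularity. Off the origin g' = (4 Q - (4 ν + 1) g) / x, with Q the gain density and ν the collision
rate, so g' = O(1/|x|). This makes Q and ν Hölder of order 3/4 at 0. If c cancels the numerator at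
0, then x (g - c) solves a damped linear equation with forcing O(|x|^(3/4)), so g - c = O(|x|^(3/4))
and g' = O(|x|^(-1/4)), which is square integrable at 0 (`abs_deriv_le_weight`). The origin is then
removable: the classical derivative is the weak one, and integration by parts gives the Fourier
bound. -/

theorem MeasureTheory.Integrable.fun_sub {α : Type*} {m : MeasurableSpace α} {μ : Measure α}
    {f g : α → ℝ} (hf : Integrable f μ) (hg : Integrable g μ) :
    Integrable (fun x => f x - g x) μ :=
  hf.sub hg

/-! ### Profiles as probability measures; invariance under reflection -/

/-- The measure with density `G`. -/
def profileMeasure (G : ℝ → ℝ) : Measure ℝ :=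
  volume.withDensity fun x => ENNReal.ofReal (G x)

/-- The pair measure `G(x) G(y) dx dy`. -/
def pairMeasure (G : ℝ → ℝ) : Measure (ℝ × ℝ) :=
  (profileMeasure G).prod (profileMeasure G)

instance (G : ℝ → ℝ) : SFinite (profileMeasure G) := by
  unfold profileMeasure; infer_instance

instance (G : ℝ → ℝ) : NullSingletonClass (profileMeasure G) := by
  unfold profileMeasure; infer_instance

instance (G : ℝ → ℝ) : SFinite (pairMeasure G) := by
  unfold pairMeasure; infer_instance

namespace IsProfile

variable {γ : ℝ} {G : ℝ → ℝ}

theorem integrable (h : IsProfile γ G) : Integrable G := by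
  have := h.integrable_weight 0 (by norm_num)
  simpa [polyWeight] using this

theorem aemeasurable (h : IsProfile γ G) : AEMeasurable G :=
  h.integrable.aestronglyMeasurable.aemeasurable

theorem integral_measure (h : IsProfile γ G) (f : ℝ → ℝ) :
    ∫ x, f x ∂(profileMeasure G) = ∫ x, G x * f x := by
  unfold profileMeasure
  rw [integral_withDensity_eq_integral_toReal_smul₀ h.aemeasurable.ennreal_ofReal
    (Filter.Eventually.of_forall fun x => ENNReal.ofReal_lt_top)]
  refine integral_congr_ae ?_
  filter_upwards [h.nonneg] with x hx
  simp [ENNReal.toReal_ofReal hx]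

theorem integrable_measure_iff (h : IsProfile γ G) (f : ℝ → ℝ) :
    Integrable f (profileMeasure G) ↔ Integrable fun x => G x * f x := by
  unfold profileMeasure
  rw [integrable_withDensity_iff_integrable_smul₀' h.aemeasurable.ennreal_ofReal
    (Filter.Eventually.of_forall fun x => ENNReal.ofReal_lt_top)]
  refine integrable_congr ?_
  filter_upwards [h.nonneg] with x hx
  simp [ENNReal.toReal_ofReal hx]

theorem isProbabilityMeasure (h : IsProfile γ G) :
    IsProbabilityMeasure (profileMeasure G) := by
  constructor
  unfold profileMeasure
  rw [withDensity_apply _ MeasurableSet.univ, Measure.restrict_univ,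
    ← ofReal_integral_eq_lintegral_ofReal h.integrable h.nonneg, h.mass, ENNReal.ofReal_one]

theorem isProbabilityMeasure_pair (h : IsProfile γ G) :
    IsProbabilityMeasure (pairMeasure G) := by
  have := h.isProbabilityMeasure
  unfold pairMeasure; infer_instance

theorem integrable_weight_measure (h : IsProfile γ G) {s : ℝ} (hs : s < 3) :
    Integrable (fun x : ℝ => (1 + |x|) ^ s) (profileMeasure G) := by
  rw [h.integrable_measure_iff]
  simpa [polyWeight, mul_comm] using h.integrable_weight s hs

theorem integral_pair (h : IsProfile γ G) (f : ℝ × ℝ → ℝ) :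
    ∫ p, f p ∂(pairMeasure G) = ∫ p : ℝ × ℝ, G p.1 * G p.2 * f p := by
  have hm := h.aemeasurable.ennreal_ofReal
  unfold pairMeasure profileMeasure
  rw [prod_withDensity₀ hm hm,
    integral_withDensity_eq_integral_toReal_smul₀ ?_
      (Filter.Eventually.of_forall fun x => ENNReal.mul_lt_top ENNReal.ofReal_lt_top
        ENNReal.ofReal_lt_top)]
  · rw [← Measure.volume_eq_prod]
    refine integral_congr_ae ?_
    have h1 : ∀ᵐ p : ℝ × ℝ, 0 ≤ G p.1 := Measure.quasiMeasurePreserving_fst.ae h.nonneg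
    have h2 : ∀ᵐ p : ℝ × ℝ, 0 ≤ G p.2 := Measure.quasiMeasurePreserving_snd.ae h.nonneg
    filter_upwards [h1, h2] with p hp1 hp2
    simp [ENNReal.toReal_ofReal hp1, ENNReal.toReal_ofReal hp2]
  · exact (hm.comp_quasiMeasurePreserving Measure.quasiMeasurePreserving_fst).mul
      (hm.comp_quasiMeasurePreserving Measure.quasiMeasurePreserving_snd)

theorem integrable_of_le (h : IsProfile γ G) {f : ℝ → ℝ} {C s : ℝ} (hs : s < 3)
    (hf : Measurable f) (hle : ∀ x, |f x| ≤ C * (1 + |x|) ^ s) :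
    Integrable f (profileMeasure G) :=
  ((h.integrable_weight_measure hs).const_mul C).mono' hf.aestronglyMeasurable
    (Filter.Eventually.of_forall hle)

theorem integrable_pair_weight (h : IsProfile γ G) {s : ℝ} (hs : s < 3) :
    Integrable (fun p : ℝ × ℝ => (1 + |p.1|) ^ s * (1 + |p.2|) ^ s) (pairMeasure G) :=
  (h.integrable_weight_measure hs).mul_prod (h.integrable_weight_measure hs)

theorem integrable_pair_of_le (h : IsProfile γ G) {f : ℝ × ℝ → ℝ} {C s : ℝ} (hs : s < 3)
    (hf : Measurable f) (hle : ∀ x y, |f (x, y)| ≤ C * ((1 + |x|) ^ s * (1 + |y|) ^ s)) :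
    Integrable f (pairMeasure G) :=
  ((h.integrable_pair_weight hs).const_mul C).mono' hf.aestronglyMeasurable
    (Filter.Eventually.of_forall fun p => hle p.1 p.2)

theorem collisionWeak_eq (h : IsProfile γ G) (φ : ℝ → ℝ) :
    collisionWeak γ G G φ =
      (1 / 2) * ∫ p, stickyJump φ p.1 p.2 * |p.1 - p.2| ^ γ ∂(pairMeasure G) := by
  rw [h.integral_pair, collisionWeak]
  simp only [mul_assoc]

theorem congr (h : IsProfile γ G) {H : ℝ → ℝ} (hGH : G =ᵐ[volume] H) : IsProfile γ H where
  nonneg := by filter_upwards [h.nonneg, hGH] with x hx he; rwa [← he]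
  integrable_weight s hs := (h.integrable_weight s hs).congr <| by
    filter_upwards [hGH] with x he; rw [he]
  mass := by rw [← h.mass]; exact integral_congr_ae hGH.symm
  momentum := by
    rw [← h.momentum]; refine integral_congr_ae ?_
    filter_upwards [hGH] with x he; rw [he]
  steady φ hφ := by
    have h1 : ∀ᵐ p : ℝ × ℝ, G p.1 = H p.1 := Measure.quasiMeasurePreserving_fst.ae hGH
    have h2 : ∀ᵐ p : ℝ × ℝ, G p.2 = H p.2 := Measure.quasiMeasurePreserving_snd.ae hGH
    have e1 : collisionWeak γ H H φ = collisionWeak γ G G φ := by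
      unfold collisionWeak
      congr 1
      refine integral_congr_ae ?_
      filter_upwards [h1, h2] with p a b
      rw [a, b]
    have e2 : ∫ x : ℝ, x * deriv φ x * H x = ∫ x : ℝ, x * deriv φ x * G x := by
      refine integral_congr_ae ?_
      filter_upwards [hGH] with x he; rw [he]
    rw [e1, e2]; exact h.steady φ hφ

/-- Profiles are invariant under reflection. -/
theorem reflect (h : IsProfile γ G) : IsProfile γ fun x => G (-x) where
  nonneg := (Measure.measurePreserving_neg (volume : Measure ℝ)).quasiMeasurePreserving.ae h.nonneg
  integrable_weight s hs := by
    simpa [polyWeight] using (h.integrable_weight s hs).comp_neg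
  mass := by rw [integral_neg_eq_self G volume]; exact h.mass
  momentum := by
    have := integral_neg_eq_self (fun x : ℝ => G x * x) volume
    rw [h.momentum] at this
    simpa [integral_neg] using this
  steady φ hφ := by
    have hψ : IsCb1 fun x => φ (-x) := by
      obtain ⟨h1, ⟨B, hB⟩, ⟨D, hD⟩⟩ := hφ
      refine ⟨h1.comp contDiff_neg, ⟨B, fun x => hB _⟩, ⟨D, fun x => ?_⟩⟩
      rw [deriv_comp_neg]; simpa using hD (-x)
    have := h.steady _ hψ
    have e1 : ∫ x : ℝ, x * deriv φ x * G (-x) = ∫ x : ℝ, x * deriv (fun x => φ (-x)) x * G x := by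
      rw [← integral_neg_eq_self (fun x : ℝ => x * deriv (fun x => φ (-x)) x * G x) volume]
      simp [deriv_comp_neg]
    have e2 : collisionWeak γ (fun x => G (-x)) (fun x => G (-x)) φ =
        collisionWeak γ G G fun x => φ (-x) := by
      unfold collisionWeak
      rw [← integral_neg_eq_self (fun p : ℝ × ℝ => G p.1 * G p.2 *
        stickyJump (fun x => φ (-x)) p.1 p.2 * |p.1 - p.2| ^ γ) volume]
      congr 2
      funext p
      have a1 : |-p.1 - -p.2| = |p.1 - p.2| := by rw [← abs_neg]; congr 1; ring
      have a2 : -((-p.1 + -p.2) / 2) = (p.1 + p.2) / 2 := by ring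
      simp only [Prod.fst_neg, Prod.snd_neg, stickyJump, neg_neg, a1, a2]
    rw [e1, e2, this]

end IsProfile

/-! ### The collisional flux and the integrated equation -/

/-- The indicator of `z < x`. -/
def step (z x : ℝ) : ℝ := if z < x then 1 else 0

/-- The jump of `step z` under a sticky collision, up to sign. -/
def stepJump (z x y : ℝ) : ℝ := step z x + step z y - 2 * step z ((x + y) / 2)

/-- The flux of the collision operator through the point `z`. -/
def profileFlux (γ : ℝ) (G : ℝ → ℝ) (z : ℝ) : ℝ :=
  (1 / 2) * ∫ p, stepJump z p.1 p.2 * |p.1 - p.2| ^ γ ∂(pairMeasure G)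

theorem measurable_step : Measurable fun q : ℝ × ℝ => step q.1 q.2 :=
  Measurable.ite (measurableSet_lt measurable_fst measurable_snd) measurable_const
    measurable_const

theorem measurable_stepJump : Measurable fun q : ℝ × ℝ × ℝ => stepJump q.1 q.2.1 q.2.2 := by
  unfold stepJump
  refine ((measurable_step.comp (measurable_fst.prodMk (measurable_fst.comp measurable_snd))).add
    (measurable_step.comp (measurable_fst.prodMk (measurable_snd.comp measurable_snd)))).sub
    ((measurable_step.comp (measurable_fst.prodMk
      (g := fun q : ℝ × ℝ × ℝ => (q.2.1 + q.2.2) / 2) (by fun_prop))).const_mul 2)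

theorem measurable_stepJump_right (z : ℝ) :
    Measurable fun p : ℝ × ℝ => stepJump z p.1 p.2 :=
  measurable_stepJump.comp (measurable_const.prodMk measurable_id)

theorem step_nonneg (z x : ℝ) : 0 ≤ step z x := by unfold step; split_ifs <;> norm_num

theorem step_le_one (z x : ℝ) : step z x ≤ 1 := by unfold step; split_ifs <;> norm_num

/-- The midpoint lies between x and y, so for z outside their span the three steps agree and cancel.
This bounded support in z is what lets the flux be tested against growing functions. -/
theorem abs_stepJump_le (z x y : ℝ) :
    |stepJump z x y| ≤ (Set.Icc (min x y) (max x y)).indicator 1 z := by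
  unfold stepJump step
  by_cases hz : z ∈ Set.Icc (min x y) (max x y)
  · rw [Set.indicator_of_mem hz]
    rw [abs_le]
    rcases le_total x y with hxy | hxy <;> split_ifs <;> norm_num <;> linarith
  · rw [Set.indicator_of_notMem hz]
    rw [Set.mem_Icc, not_and_or, not_le, not_le, lt_min_iff, max_lt_iff] at hz
    rcases hz with hz | hz
    · rw [if_pos hz.1, if_pos hz.2, if_pos (by linarith)]; norm_num
    · rw [if_neg (by linarith), if_neg (by linarith), if_neg (by linarith)]; norm_num

theorem abs_stepJump_le_one (z x y : ℝ) : |stepJump z x y| ≤ 1 :=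
  (abs_stepJump_le z x y).trans (Set.indicator_le_self' (fun _ _ => zero_le_one) z)

theorem integral_mul_step_sub_of_le {ψ Ψ : ℝ → ℝ} (hψ : Continuous ψ)
    (hΨ : ∀ x, HasDerivAt Ψ (ψ x) x) {a b : ℝ} (hab : a ≤ b) :
    Integrable (fun z => ψ z * (step z b - step z a)) ∧
      ∫ z, ψ z * (step z b - step z a) = Ψ b - Ψ a := by
  have e : (fun z => ψ z * (step z b - step z a)) = (Set.Ico a b).indicator ψ := by
    funext z
    unfold step
    by_cases hz : z ∈ Set.Ico a b
    · rw [Set.indicator_of_mem hz, if_pos hz.2, if_neg (not_lt.2 hz.1)]; ring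
    · rw [Set.indicator_of_notMem hz]
      rw [Set.mem_Ico, not_and_or, not_le, not_lt] at hz
      rcases hz with hz | hz
      · rw [if_pos hz, if_pos (hz.trans_le hab)]; ring
      · rw [if_neg (not_lt.2 hz), if_neg (not_lt.2 (hab.trans hz))]; ring
  rw [e, integrable_indicator_iff measurableSet_Ico, integral_indicator measurableSet_Ico]
  refine ⟨(hψ.integrableOn_Icc (a := a) (b := b)).mono_set Set.Ico_subset_Icc_self, ?_⟩
  rw [integral_Ico_eq_integral_Ioc, ← intervalIntegral.integral_of_le hab]
  exact intervalIntegral.integral_eq_sub_of_hasDerivAt (fun x _ => hΨ x)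
    (hψ.intervalIntegrable a b)

theorem integral_mul_step_sub {ψ Ψ : ℝ → ℝ} (hψ : Continuous ψ)
    (hΨ : ∀ x, HasDerivAt Ψ (ψ x) x) (a b : ℝ) :
    Integrable (fun z => ψ z * (step z b - step z a)) ∧
      ∫ z, ψ z * (step z b - step z a) = Ψ b - Ψ a := by
  rcases le_total a b with hab | hab
  · exact integral_mul_step_sub_of_le hψ hΨ hab
  · obtain ⟨h1, h2⟩ := integral_mul_step_sub_of_le hψ hΨ hab
    have e : (fun z => ψ z * (step z b - step z a)) =
        fun z => -(ψ z * (step z a - step z b)) := by funext z; ring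
    rw [e, integral_neg, h2]
    exact ⟨h1.neg, by ring⟩

/-- The jump is the sum of the step differences from the midpoint to each endpoint, and the
fundamental theorem of calculus applies to each. Through Fubini this turns the weak collision form
into the flux. -/
theorem integral_mul_stepJump {ψ Ψ : ℝ → ℝ} (hψ : Continuous ψ)
    (hΨ : ∀ x, HasDerivAt Ψ (ψ x) x) (x y : ℝ) :
    Integrable (fun z => ψ z * stepJump z x y) ∧
      ∫ z, ψ z * stepJump z x y = -stickyJump Ψ x y := by
  obtain ⟨h1, h2⟩ := integral_mul_step_sub hψ hΨ ((x + y) / 2) x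
  obtain ⟨h3, h4⟩ := integral_mul_step_sub hψ hΨ ((x + y) / 2) y
  have e : (fun z => ψ z * stepJump z x y) = fun z =>
      ψ z * (step z x - step z ((x + y) / 2)) + ψ z * (step z y - step z ((x + y) / 2)) := by
    funext z; unfold stepJump; ring
  rw [e, integral_add h1 h3, h2, h4]
  exact ⟨h1.add h3, by unfold stickyJump; ring⟩

theorem one_add_abs_le_mul (x y : ℝ) : 1 + |x| + |y| ≤ (1 + |x|) * (1 + |y|) := by
  nlinarith [abs_nonneg x, abs_nonneg y, mul_nonneg (abs_nonneg x) (abs_nonneg y)]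

theorem abs_sub_le_mul (x y : ℝ) : |x - y| ≤ (1 + |x|) * (1 + |y|) :=
  (abs_sub x y).trans (by linarith [one_add_abs_le_mul x y])

theorem abs_sub_rpow_le {γ : ℝ} (hγ : 0 ≤ γ) (x y : ℝ) :
    |x - y| ^ γ ≤ (1 + |x|) ^ γ * (1 + |y|) ^ γ := by
  rw [← Real.mul_rpow (by positivity) (by positivity)]
  exact Real.rpow_le_rpow (abs_nonneg _) (abs_sub_le_mul x y) hγ

theorem measurable_abs_sub_rpow (γ : ℝ) : Measurable fun p : ℝ × ℝ => |p.1 - p.2| ^ γ := by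
  fun_prop

/-- With T = (1 + |x|)(1 + |y|), the support in z has length at most T and ψ is at most C T^(q-1) on
it. The bound is a product in x and y, so pair integrability reduces to a single weighted moment. -/
theorem integral_norm_mul_stepJump_le {ψ : ℝ → ℝ} {C q : ℝ} (hq : 1 ≤ q)
    (hle : ∀ z, |ψ z| ≤ C * (1 + |z|) ^ (q - 1)) (x y : ℝ) :
    ∫ z, ‖ψ z * stepJump z x y‖ ≤ C * ((1 + |x|) ^ q * (1 + |y|) ^ q) := by
  have hC : 0 ≤ C := by simpa using (abs_nonneg _).trans (hle 0)
  set T := (1 + |x|) * (1 + |y|) with hT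
  have hT1 : 1 ≤ T := by linarith [one_add_abs_le_mul x y, abs_nonneg x, abs_nonneg y]
  set I := Set.Icc (min x y) (max x y)
  have hpt : ∀ z, ‖ψ z * stepJump z x y‖ ≤ I.indicator (fun _ => C * T ^ (q - 1)) z := by
    intro z
    rw [norm_mul, Real.norm_eq_abs, Real.norm_eq_abs]
    by_cases hz : z ∈ I
    · rw [Set.indicator_of_mem hz]
      have hz' : 1 + |z| ≤ T := by
        have h1 : |z| ≤ max |x| |y| := by
          rw [abs_le]
          obtain ⟨a, b⟩ := hz
          refine ⟨?_, b.trans (max_le_max (le_abs_self _) (le_abs_self _))⟩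
          rcases min_le_iff.1 a with a | a
          · linarith [neg_abs_le x, le_max_left |x| |y|]
          · linarith [neg_abs_le y, le_max_right |x| |y|]
        have : max |x| |y| ≤ |x| + |y| :=
          max_le (by linarith [abs_nonneg y]) (by linarith [abs_nonneg x])
        linarith [one_add_abs_le_mul x y]
      calc |ψ z| * |stepJump z x y| ≤ |ψ z| * 1 := by gcongr; exact abs_stepJump_le_one _ _ _
        _ ≤ C * (1 + |z|) ^ (q - 1) := by rw [mul_one]; exact hle z
        _ ≤ C * T ^ (q - 1) := by
          gcongr
    · rw [Set.indicator_of_notMem hz]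
      have := abs_stepJump_le z x y
      rw [Set.indicator_of_notMem hz] at this
      rw [le_antisymm this (abs_nonneg _), mul_zero]
  have hint : Integrable (I.indicator fun _ : ℝ => C * T ^ (q - 1)) :=
    (integrable_indicator_iff measurableSet_Icc).2 (integrableOn_const (by simp))
  calc ∫ z, ‖ψ z * stepJump z x y‖ ≤ ∫ z, I.indicator (fun _ => C * T ^ (q - 1)) z :=
        integral_mono_of_nonneg (Filter.Eventually.of_forall fun _ => norm_nonneg _) hint
          (Filter.Eventually.of_forall hpt)
    _ = (max x y - min x y) * (C * T ^ (q - 1)) := by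
        rw [integral_indicator measurableSet_Icc, setIntegral_const, measureReal_def,
          Real.volume_Icc, ENNReal.toReal_ofReal (by simp), smul_eq_mul]
    _ ≤ T * (C * T ^ (q - 1)) := by
        gcongr
        rw [max_sub_min_eq_abs]
        rw [abs_sub_comm]
        exact abs_sub_le_mul x y
    _ = C * T ^ q := by
        have : T ^ q = T ^ (q - 1) * T := by
          rw [← Real.rpow_add_one (by linarith)]; congr 1; ring
        rw [this]; ring
    _ = _ := by rw [hT, Real.mul_rpow (by positivity) (by positivity)]

namespace IsProfile

variable {γ : ℝ} {G : ℝ → ℝ}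

theorem integrable_abs_sub_rpow (h : IsProfile γ G) (h0 : 0 ≤ γ) (h1 : γ < 3) :
    Integrable (fun p : ℝ × ℝ => |p.1 - p.2| ^ γ) (pairMeasure G) :=
  h.integrable_pair_of_le (C := 1) h1 (measurable_abs_sub_rpow γ) fun x y => by
    rw [abs_of_nonneg (by positivity), one_mul]
    exact abs_sub_rpow_le h0 x y

theorem integrable_stepJump (h : IsProfile γ G) (h0 : 0 ≤ γ) (h1 : γ < 3) (z : ℝ) :
    Integrable (fun p : ℝ × ℝ => stepJump z p.1 p.2 * |p.1 - p.2| ^ γ) (pairMeasure G) :=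
  (h.integrable_abs_sub_rpow h0 h1).bdd_mul
    (c := 1) (measurable_stepJump_right z).aestronglyMeasurable
    (Filter.Eventually.of_forall fun _ => abs_stepJump_le_one _ _ _)

/-- Fubini's theorem for the flux against a test function `ψ` with primitive `Ψ`. -/
theorem integral_mul_flux (h : IsProfile γ G) (h0 : 0 ≤ γ) {ψ Ψ : ℝ → ℝ} (hψ : Continuous ψ)
    (hΨ : ∀ x, HasDerivAt Ψ (ψ x) x) {C q : ℝ} (hq : 1 ≤ q) (hqγ : q + γ < 3)
    (hle : ∀ z, |ψ z| ≤ C * (1 + |z|) ^ (q - 1)) :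
    Integrable (fun z => ψ z * profileFlux γ G z) ∧
      ∫ z, ψ z * profileFlux γ G z =
        -((1 / 2) * ∫ p, stickyJump Ψ p.1 p.2 * |p.1 - p.2| ^ γ ∂(pairMeasure G)) := by
  set F : (ℝ × ℝ) × ℝ → ℝ := fun r => ψ r.2 * (stepJump r.2 r.1.1 r.1.2 * |r.1.1 - r.1.2| ^ γ)
    with hF
  have hmeas : Measurable F := by
    refine (hψ.measurable.comp measurable_snd).mul ((measurable_stepJump.comp
      (measurable_snd.prodMk measurable_fst)).mul
        ((measurable_abs_sub_rpow γ).comp measurable_fst))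
  have hint : Integrable F ((pairMeasure G).prod volume) := by
    rw [integrable_prod_iff hmeas.aestronglyMeasurable]
    constructor
    · refine Filter.Eventually.of_forall fun p => ?_
      have := (integral_mul_stepJump hψ hΨ p.1 p.2).1.mul_const (|p.1 - p.2| ^ γ)
      simpa only [hF, mul_assoc] using this
    · refine Integrable.mono' ((h.integrable_pair_weight hqγ).const_mul C)
        hmeas.aestronglyMeasurable.norm.integral_prod_right'
        (Filter.Eventually.of_forall fun p => ?_)
      have e : ∫ z, ‖F (p, z)‖ = (∫ z, ‖ψ z * stepJump z p.1 p.2‖) * |p.1 - p.2| ^ γ := by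
        rw [← integral_mul_const]
        congr 1; funext z
        rw [hF]
        simp only [norm_mul, mul_assoc, Real.norm_eq_abs, abs_of_nonneg
          (Real.rpow_nonneg (abs_nonneg (p.1 - p.2)) γ)]
      rw [Real.norm_eq_abs, abs_of_nonneg (integral_nonneg fun _ => norm_nonneg _), e]
      have i1 := integral_norm_mul_stepJump_le hq hle p.1 p.2
      have i2 := abs_sub_rpow_le h0 p.1 p.2
      have p1 : 0 < 1 + |p.1| := by positivity
      have p2 : 0 < 1 + |p.2| := by positivity
      calc _ ≤ C * ((1 + |p.1|) ^ q * (1 + |p.2|) ^ q) *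
              ((1 + |p.1|) ^ γ * (1 + |p.2|) ^ γ) := by
            gcongr
            exact (integral_nonneg fun _ => norm_nonneg _).trans i1
        _ = _ := by rw [Real.rpow_add p1, Real.rpow_add p2]; ring
  have e1 : ∀ z, ∫ p, F (p, z) ∂(pairMeasure G) = 2 * (ψ z * profileFlux γ G z) := by
    intro z
    simp only [hF, integral_const_mul, profileFlux]
    ring
  have e2 : ∀ p : ℝ × ℝ, ∫ z, F (p, z) = -(stickyJump Ψ p.1 p.2 * |p.1 - p.2| ^ γ) := by
    intro p
    have := (integral_mul_stepJump hψ hΨ p.1 p.2).2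
    rw [← neg_mul, ← this, ← integral_mul_const]
    simp only [hF, mul_assoc]
  constructor
  · have := hint.integral_prod_right
    simp only [e1] at this
    simpa using this.const_mul (1 / 2 : ℝ)
  · have := integral_integral_swap (f := fun p z => F (p, z)) hint
    simp only [e1, e2, integral_neg, integral_const_mul] at this
    linarith

/-- The equation in integrated form: the drift flux balances the collisional flux. -/
theorem ae_eq_flux (h : IsProfile γ G) (h0 : 0 ≤ γ) (h1 : γ < 1) :
    ∀ᵐ z : ℝ, z * G z / 4 = profileFlux γ G z := by
  have hxG : Integrable fun x : ℝ => x * G x := by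
    have := (h.integrable_measure_iff fun x => x).1
      (h.integrable_of_le (C := 1) (s := 1) (by norm_num) measurable_id fun x => by
        simp)
    simpa [mul_comm] using this
  have hflux : LocallyIntegrable (profileFlux γ G) := by
    have := (h.integral_mul_flux h0 (ψ := fun _ => 1) (Ψ := fun x => x) continuous_const
      (fun x => hasDerivAt_id x) (C := 1) (q := 1) le_rfl (by linarith) (by simp)).1
    simpa using this.locallyIntegrable
  have key : ∀ᵐ z : ℝ, z * G z / 4 - profileFlux γ G z = 0 := by
    refine ae_eq_zero_of_integral_contDiff_smul_eq_zero
      (LocallyIntegrable.sub (hxG.div_const 4).locallyIntegrable hflux) fun ψ hψ hc => ?_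
    have hψc : Continuous ψ := hψ.continuous
    obtain ⟨D, hD⟩ := hψc.bounded_above_of_compact_support hc
    set φ : ℝ → ℝ := fun x => ∫ t in (0 : ℝ)..x, ψ t with hφ
    have hd : ∀ x, HasDerivAt φ (ψ x) x := fun x => hψc.integral_hasStrictDerivAt 0 x |>.hasDerivAt
    have hdφ : deriv φ = ψ := funext fun x => (hd x).deriv
    have hint : Integrable ψ := hψc.integrable_of_hasCompactSupport hc
    -- A primitive of a compactly supported ψ is an admissible test function: it is bounded because
    -- ψ is integrable, though it need not have compact support.
    have hCb : IsCb1 φ := by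
      refine ⟨?_, ⟨∫ t, ‖ψ t‖, fun x => ?_⟩, ⟨D, fun x => ?_⟩⟩
      · rw [contDiff_one_iff_deriv, hdφ]
        exact ⟨fun x => (hd x).differentiableAt, hψc⟩
      · exact intervalIntegral.norm_integral_le_integral_norm_uIoc.trans
          (setIntegral_le_integral hint.norm (Filter.Eventually.of_forall fun _ => norm_nonneg _))
      · rw [hdφ]; exact hD x
    have hs := h.steady φ hCb
    rw [h.collisionWeak_eq, hdφ] at hs
    obtain ⟨i1, i2⟩ := h.integral_mul_flux h0 hψc hd (C := D) (q := 1) le_rfl (by linarith)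
      (by simpa using hD)
    have i3 : Integrable fun z => ψ z * (z * G z / 4) :=
      (hxG.div_const 4).bdd_mul hψc.aestronglyMeasurable (Filter.Eventually.of_forall hD)
    simp only [smul_eq_mul, mul_sub]
    rw [integral_sub i3 i1, i2, ← hs]
    have : ∫ z, ψ z * (z * G z / 4) = (1 / 4) * ∫ x, x * ψ x * G x := by
      rw [← integral_const_mul]; congr 1; funext z; ring
    rw [this]; ring
  filter_upwards [key] with z hz
  linarith

/-- The moment identity obtained by testing the equation against `|x| ^ p`. -/
theorem moment_identity (h : IsProfile γ G) (h0 : 0 ≤ γ) (h1 : γ < 1) {p : ℝ} (hp : 2 ≤ p)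
    (hpγ : p + γ < 3) :
    (p / 4) * ∫ x, |x| ^ p ∂(profileMeasure G) =
      (1 / 2) * ∫ q, (|q.1| ^ p + |q.2| ^ p - 2 * |(q.1 + q.2) / 2| ^ p) * |q.1 - q.2| ^ γ
        ∂(pairMeasure G) := by
  have hd : ∀ x : ℝ, HasDerivAt (fun x : ℝ => |x| ^ p) (p * |x| ^ (p - 2) * x) x := fun x =>
    hasDerivAt_abs_rpow x (by linarith)
  have hc : Continuous fun x : ℝ => p * |x| ^ (p - 2) * x :=
    ((continuous_const.mul (continuous_abs.rpow_const fun x => Or.inr (by linarith)))).mul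
      continuous_id
  -- The integrated equation holds almost everywhere, so it can be multiplied by the derivative of
  -- the unbounded |x|^p directly; no truncation of the test function is needed.
  obtain ⟨-, i2⟩ := h.integral_mul_flux h0 hc hd (C := p) (q := p) (by linarith) hpγ fun z => by
    rw [abs_mul, abs_mul, abs_of_nonneg (by linarith : 0 ≤ p),
      abs_of_nonneg (Real.rpow_nonneg (abs_nonneg z) _), mul_assoc]
    have : (1 + |z|) ^ (p - 1) = (1 + |z|) ^ (p - 2) * (1 + |z|) := by
      rw [← Real.rpow_add_one (by positivity)]; congr 1; ring
    rw [this]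
    gcongr <;> linarith [abs_nonneg z]
  have e1 : ∫ z, p * |z| ^ (p - 2) * z * profileFlux γ G z =
      (p / 4) * ∫ x, |x| ^ p ∂(profileMeasure G) := by
    rw [h.integral_measure, ← integral_const_mul]
    refine integral_congr_ae ?_
    filter_upwards [h.ae_eq_flux h0 h1] with z hz
    rw [← hz]
    have : |z| ^ p = |z| ^ (p - 2) * z ^ 2 := by
      rcases eq_or_ne z 0 with rfl | hz0
      · simp [Real.zero_rpow (by linarith : p ≠ 0)]
      · rw [← sq_abs, ← Real.rpow_natCast, ← Real.rpow_add (abs_pos.2 hz0)]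
        congr 1; push_cast; ring
    rw [this]; ring
  rw [← e1, i2, ← mul_neg, ← integral_neg]
  congr 2
  funext q
  unfold stickyJump
  ring

end IsProfile

/-! ### Moments: dissipation, energy balance, uniform bounds -/

/-- The absolute moment `∫ |x| ^ p G(x) dx`. -/
def absMoment (G : ℝ → ℝ) (p : ℝ) : ℝ := ∫ x, |x| ^ p ∂(profileMeasure G)

/-- The pair moment `∬ |x - y| ^ p G(x) G(y) dx dy`. -/
def pairMoment (G : ℝ → ℝ) (p : ℝ) : ℝ := ∫ q, |q.1 - q.2| ^ p ∂(pairMeasure G)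

theorem add_rpow_le_four_mul {a b p : ℝ} (ha : 0 ≤ a) (hb : 0 ≤ b) (h1 : 1 ≤ p) (h3 : p ≤ 3) :
    (a + b) ^ p ≤ 4 * (a ^ p + b ^ p) := by
  lift a to NNReal using ha
  lift b to NNReal using hb
  have h := NNReal.rpow_add_le_mul_rpow_add_rpow a b h1
  have h' : ((a : ℝ) + b) ^ p ≤ 2 ^ (p - 1) * ((a : ℝ) ^ p + (b : ℝ) ^ p) := by exact_mod_cast h
  refine h'.trans ?_
  gcongr
  calc (2 : ℝ) ^ (p - 1) ≤ 2 ^ (2 : ℝ) := Real.rpow_le_rpow_of_exponent_le (by norm_num) (by linarith)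
    _ = 4 := by norm_num

/-- The binomial remainder of the `s`-th power is of mixed order. -/
theorem add_rpow_sub_le {a b s : ℝ} (ha : 0 ≤ a) (hb : 0 ≤ b) (h1 : 1 ≤ s) (h3 : s ≤ 3) :
    (a + b) ^ s ≤ a ^ s + b ^ s + 12 * (a ^ (s - 1) * b + a * b ^ (s - 1)) := by
  wlog hab : b ≤ a generalizing a b
  · have := this hb ha (le_of_not_ge hab)
    rw [add_comm b a] at this
    linarith
  rcases ha.eq_or_lt with rfl | ha0
  · have : b = 0 := le_antisymm hab hb
    subst this
    simp only [add_zero, mul_zero, zero_mul]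
    linarith [Real.rpow_nonneg (le_refl (0 : ℝ)) s]
  have hab0 : 0 < a + b := by positivity
  have e : a = (a + b) * (1 + -(b / (a + b))) := by field_simp; ring
  have hb1 : b / (a + b) ≤ 1 := (div_le_one hab0).2 (by linarith)
  -- Bernoulli at a/(a+b) = 1 - b/(a+b) yields (a+b)^s ≤ a^s + s (a+b)^(s-1) b. With b ≤ a and s ≤ 3
  -- the last term is at most 3 · 4 · a^(s-1) b, whence 12.
  have hB := one_add_mul_self_le_rpow_one_add (s := -(b / (a + b))) (by linarith) h1
  have k1 : a ^ s = (a + b) ^ s * (1 + -(b / (a + b))) ^ s := by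
    rw [← Real.mul_rpow hab0.le (by linarith), ← e]
  have k2 : (a + b) ^ s = (a + b) ^ (s - 1) * (a + b) := by
    rw [← Real.rpow_add_one hab0.ne']; congr 1; ring
  have k3 : (a + b) ^ s - s * (a + b) ^ (s - 1) * b ≤ a ^ s := by
    rw [k1]
    calc _ = (a + b) ^ s * (1 + s * -(b / (a + b))) := by rw [k2]; field_simp; ring
      _ ≤ _ := by gcongr
  have k4 : (a + b) ^ (s - 1) ≤ 4 * a ^ (s - 1) := by
    calc (a + b) ^ (s - 1) ≤ (2 * a) ^ (s - 1) :=
          Real.rpow_le_rpow hab0.le (by linarith) (by linarith)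
      _ = 2 ^ (s - 1) * a ^ (s - 1) := Real.mul_rpow (by norm_num) ha
      _ ≤ 2 ^ (2 : ℝ) * a ^ (s - 1) := by
          gcongr
          · norm_num
          · linarith
      _ = 4 * a ^ (s - 1) := by norm_num
  have k5 : s * (a + b) ^ (s - 1) * b ≤ 3 * (4 * a ^ (s - 1)) * b := by gcongr
  have k6 : 0 ≤ a * b ^ (s - 1) := by positivity
  have k7 : 0 ≤ b ^ s := by positivity
  linarith

/-- For |y| ≤ |x|, |x - y|^γ ≥ |x|^γ (1 - |y|/|x|)^γ ≥ |x|^γ (1 - |y|/|x|), because t ≤ t^γ on [0,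
1]; otherwise the left side is nonpositive. Replacing the kernel by |x|^γ therefore costs only a
mixed moment. -/
theorem rpow_mul_rpow_abs_sub_ge {γ s : ℝ} (h0 : 0 < γ) (h1 : γ < 1) (hs : 1 < s) (x y : ℝ) :
    |x| ^ (s + γ) - |y| * |x| ^ (s - 1 + γ) ≤ |x| ^ s * |x - y| ^ γ := by
  rcases eq_or_ne x 0 with rfl | hx
  · rw [abs_zero, Real.zero_rpow (by linarith), Real.zero_rpow (by linarith),
      Real.zero_rpow (by linarith)]
    simp
  have hx0 : 0 < |x| := abs_pos.2 hx
  have key : |x| ^ γ - |y| * |x| ^ (γ - 1) ≤ |x - y| ^ γ := by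
    have e : |x| ^ γ - |y| * |x| ^ (γ - 1) = |x| ^ γ * (1 - |y| / |x|) := by
      rw [Real.rpow_sub_one hx0.ne']; field_simp
    rw [e]
    rcases le_total |y| |x| with hyx | hyx
    · have ht0 : 0 ≤ 1 - |y| / |x| := by
        have : |y| / |x| ≤ 1 := (div_le_one hx0).2 hyx
        linarith
      have ht1 : 1 - |y| / |x| ≤ 1 := by
        have : 0 ≤ |y| / |x| := by positivity
        linarith
      calc _ ≤ |x| ^ γ * (1 - |y| / |x|) ^ γ := by
            gcongr
            exact Real.self_le_rpow_of_le_one ht0 ht1 h1.le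
        _ = (|x| * (1 - |y| / |x|)) ^ γ := (Real.mul_rpow hx0.le ht0).symm
        _ ≤ |x - y| ^ γ := by
            refine Real.rpow_le_rpow (by positivity) ?_ h0.le
            have : |x| * (1 - |y| / |x|) = |x| - |y| := by field_simp
            rw [this]; exact abs_sub_abs_le_abs_sub x y
    · have : 1 ≤ |y| / |x| := (one_le_div hx0).2 hyx
      have h2 : |x| ^ γ * (1 - |y| / |x|) ≤ 0 :=
        mul_nonpos_of_nonneg_of_nonpos (by positivity) (by linarith)
      exact h2.trans (by positivity)
  have e1 : |x| ^ (s + γ) = |x| ^ s * |x| ^ γ := Real.rpow_add hx0 _ _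
  have e2 : |x| ^ (s - 1 + γ) = |x| ^ s * |x| ^ (γ - 1) := by
    rw [← Real.rpow_add hx0]; congr 1; ring
  rw [e1, e2]
  have := mul_le_mul_of_nonneg_left key (by positivity : 0 ≤ |x| ^ s)
  linarith

theorem rpow_abs_sub_le {γ : ℝ} (h0 : 0 ≤ γ) (h1 : γ ≤ 1) (x y : ℝ) :
    |x - y| ^ γ ≤ |x| ^ γ + |y| ^ γ :=
  (Real.rpow_le_rpow (abs_nonneg _) (abs_sub x y) h0).trans
    (Real.rpow_add_le_add_rpow (abs_nonneg _) (abs_nonneg _) h0 h1)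

/-- Pointwise lower bound for the dissipation of `|x| ^ s`. -/
theorem dissipation_ge {γ s : ℝ} (h0 : 0 < γ) (h1 : γ < 1) (hs : 2 ≤ s) (hs3 : s ≤ 3) (x y : ℝ) :
    (1 - 2 ^ (1 - s)) * (|x| ^ (s + γ) + |y| ^ (s + γ))
      - 7 * (|x| ^ (s - 1 + γ) * |y| + |x| * |y| ^ (s - 1 + γ))
      - 6 * (|x| ^ (s - 1) * |y| ^ (1 + γ) + |x| ^ (1 + γ) * |y| ^ (s - 1)) ≤
    (|x| ^ s + |y| ^ s - 2 * |(x + y) / 2| ^ s) * |x - y| ^ γ := by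
  set c : ℝ := 2 ^ (1 - s) with hc
  set w := |x - y| ^ γ with hw
  have hw0 : 0 ≤ w := by positivity
  have hc0 : 0 < c := by positivity
  have hc1 : c ≤ 1 / 2 := by
    calc c ≤ 2 ^ (-1 : ℝ) := Real.rpow_le_rpow_of_exponent_le (by norm_num) (by linarith)
      _ = 1 / 2 := by rw [Real.rpow_neg_one]; norm_num
  have e1 : 2 * |(x + y) / 2| ^ s = c * |x + y| ^ s := by
    rw [abs_div, abs_two, Real.div_rpow (abs_nonneg _) (by norm_num), hc,
      Real.rpow_sub (by norm_num), Real.rpow_one]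
    ring
  have e2 : |x + y| ^ s ≤ |x| ^ s + |y| ^ s + 12 * (|x| ^ (s - 1) * |y| + |x| * |y| ^ (s - 1)) :=
    (Real.rpow_le_rpow (abs_nonneg _) (abs_add_le x y) (by linarith)).trans
      (add_rpow_sub_le (abs_nonneg _) (abs_nonneg _) (by linarith) hs3)
  set P := |x| ^ (s - 1) * |y| + |x| * |y| ^ (s - 1) with hP
  have hP0 : 0 ≤ P := by positivity
  -- The 12 of the binomial remainder becomes 6 because c ≤ 1/2. The 7 in the statement is this 6
  -- plus the loss of 1 in `rpow_mul_rpow_abs_sub_ge`.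
  have e3 : (1 - c) * (|x| ^ s + |y| ^ s) - 6 * P ≤
      |x| ^ s + |y| ^ s - 2 * |(x + y) / 2| ^ s := by
    rw [e1]
    have a1 := mul_le_mul_of_nonneg_left e2 hc0.le
    have a2 : c * P ≤ 1 / 2 * P := by gcongr
    nlinarith
  have e4 := mul_le_mul_of_nonneg_right e3 hw0
  have f1 := rpow_mul_rpow_abs_sub_ge h0 h1 (by linarith : 1 < s) x y
  have f2 := rpow_mul_rpow_abs_sub_ge h0 h1 (by linarith : 1 < s) y x
  rw [abs_sub_comm y x] at f2
  have f3 : w ≤ |x| ^ γ + |y| ^ γ := rpow_abs_sub_le h0.le h1.le x y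
  have f4 := mul_le_mul_of_nonneg_left f3 hP0
  have g1 : ∀ t : ℝ, |t| ^ (s - 1) * |t| ^ γ = |t| ^ (s - 1 + γ) := fun t =>
    (Real.rpow_add' (abs_nonneg _) (by linarith)).symm
  have g2 : ∀ t : ℝ, |t| * |t| ^ γ = |t| ^ (1 + γ) := fun t => by
    rw [Real.rpow_add' (abs_nonneg _) (by linarith), Real.rpow_one]
  have f5 : P * (|x| ^ γ + |y| ^ γ) = |x| ^ (s - 1 + γ) * |y| + |x| ^ (s - 1) * |y| ^ (1 + γ) +
      |x| ^ (1 + γ) * |y| ^ (s - 1) + |x| * |y| ^ (s - 1 + γ) := by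
    rw [← g1, ← g1, ← g2, ← g2, hP]; ring
  have f6 := mul_le_mul_of_nonneg_left (add_le_add f1 f2) (by linarith : 0 ≤ 1 - c)
  have q1 : 0 ≤ |y| * |x| ^ (s - 1 + γ) := by positivity
  have q2 : 0 ≤ |x| * |y| ^ (s - 1 + γ) := by positivity
  have q3 : (1 - c) * (|y| * |x| ^ (s - 1 + γ)) ≤ |y| * |x| ^ (s - 1 + γ) :=
    mul_le_of_le_one_left q1 (by linarith)
  have q4 : (1 - c) * (|x| * |y| ^ (s - 1 + γ)) ≤ |x| * |y| ^ (s - 1 + γ) :=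
    mul_le_of_le_one_left q2 (by linarith)
  linarith

namespace IsProfile

variable {γ : ℝ} {G : ℝ → ℝ}

theorem integrable_abs_rpow (h : IsProfile γ G) {p : ℝ} (h0 : 0 ≤ p) (h3 : p < 3) :
    Integrable (fun x : ℝ => |x| ^ p) (profileMeasure G) :=
  h.integrable_of_le (C := 1) h3 (by fun_prop) fun x => by
    rw [abs_of_nonneg (by positivity), one_mul]
    exact Real.rpow_le_rpow (abs_nonneg _) (by linarith) h0

theorem integrable_pair_mul (h : IsProfile γ G) {p q : ℝ} (hp : 0 ≤ p) (hp3 : p < 3)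
    (hq : 0 ≤ q) (hq3 : q < 3) :
    Integrable (fun r : ℝ × ℝ => |r.1| ^ p * |r.2| ^ q) (pairMeasure G) :=
  (h.integrable_abs_rpow hp hp3).mul_prod (h.integrable_abs_rpow hq hq3)

theorem integral_pair_mul (G : ℝ → ℝ) (p q : ℝ) :
    ∫ r, |r.1| ^ p * |r.2| ^ q ∂(pairMeasure G) = absMoment G p * absMoment G q :=
  integral_prod_mul (fun x : ℝ => |x| ^ p) fun x : ℝ => |x| ^ q

theorem integral_fst (h : IsProfile γ G) (f : ℝ → ℝ) :
    ∫ r, f r.1 ∂(pairMeasure G) = ∫ x, f x ∂(profileMeasure G) := by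
  have := h.isProbabilityMeasure
  have := integral_prod_mul (μ := profileMeasure G) (ν := profileMeasure G) f fun _ => (1 : ℝ)
  simpa [pairMeasure] using this

theorem integral_snd (h : IsProfile γ G) (f : ℝ → ℝ) :
    ∫ r, f r.2 ∂(pairMeasure G) = ∫ x, f x ∂(profileMeasure G) := by
  have := h.isProbabilityMeasure
  have := integral_prod_mul (μ := profileMeasure G) (ν := profileMeasure G) (fun _ => (1 : ℝ)) f
  simpa [pairMeasure] using this

theorem integrable_fst (h : IsProfile γ G) {f : ℝ → ℝ} (hf : Integrable f (profileMeasure G)) :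
    Integrable (fun r : ℝ × ℝ => f r.1) (pairMeasure G) := by
  have := h.isProbabilityMeasure
  exact hf.comp_fst _

theorem integrable_snd (h : IsProfile γ G) {f : ℝ → ℝ} (hf : Integrable f (profileMeasure G)) :
    Integrable (fun r : ℝ × ℝ => f r.2) (pairMeasure G) := by
  have := h.isProbabilityMeasure
  exact hf.comp_snd _

theorem absMoment_nonneg (G : ℝ → ℝ) (p : ℝ) : 0 ≤ absMoment G p :=
  integral_nonneg fun _ => by positivity

theorem mean_eq_zero (h : IsProfile γ G) : ∫ x, x ∂(profileMeasure G) = 0 := by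
  rw [h.integral_measure]; exact h.momentum

/-- Expanding the square, the cross term vanishes because the momentum is zero. -/
theorem pairMoment_two (h : IsProfile γ G) : pairMoment G 2 = 2 * absMoment G 2 := by
  have := h.isProbabilityMeasure
  have i1 : Integrable (fun x : ℝ => |x| ^ (2 : ℝ)) (profileMeasure G) :=
    h.integrable_abs_rpow (by norm_num) (by norm_num)
  have i0 : Integrable (fun x : ℝ => x) (profileMeasure G) :=
    h.integrable_of_le (C := 1) (s := 1) (by norm_num) measurable_id fun x => by simp
  have i2 : Integrable (fun r : ℝ × ℝ => r.1 * r.2) (pairMeasure G) := i0.mul_prod i0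
  have e : ∀ r : ℝ × ℝ, |r.1 - r.2| ^ (2 : ℝ) =
      |r.1| ^ (2 : ℝ) + |r.2| ^ (2 : ℝ) - 2 * (r.1 * r.2) := fun r => by
    simp only [Real.rpow_two, sq_abs]; ring
  unfold pairMoment
  simp only [e]
  rw [integral_sub ((h.integrable_fst i1).fun_add (h.integrable_snd i1)) (i2.const_mul 2),
    integral_add (h.integrable_fst i1) (h.integrable_snd i1),
    h.integral_fst (fun x => |x| ^ (2 : ℝ)), h.integral_snd (fun x => |x| ^ (2 : ℝ)),
    integral_const_mul]
  have : ∫ r, r.1 * r.2 ∂(pairMeasure G) = 0 := by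
    have := integral_prod_mul (μ := profileMeasure G) (ν := profileMeasure G) (fun x : ℝ => x)
      fun x : ℝ => x
    rw [h.mean_eq_zero, mul_zero] at this
    exact this
  rw [this]
  unfold absMoment; ring

/-- Energy balance. -/
theorem pairMoment_two_add (h : IsProfile γ G) (h0 : 0 < γ) (h1 : γ < 1) :
    pairMoment G (2 + γ) = 2 * absMoment G 2 := by
  have := h.moment_identity h0.le h1 le_rfl (by linarith)
  have e : ∀ q : ℝ × ℝ, (|q.1| ^ (2 : ℝ) + |q.2| ^ (2 : ℝ) - 2 * |(q.1 + q.2) / 2| ^ (2 : ℝ)) *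
      |q.1 - q.2| ^ γ = (1 / 2) * |q.1 - q.2| ^ (2 + γ) := fun q => by
    rw [Real.rpow_add' (abs_nonneg _) (by linarith)]
    simp only [Real.rpow_two, sq_abs]; ring
  simp only [e, integral_const_mul] at this
  unfold pairMoment absMoment
  linarith

theorem integrable_pairMoment (h : IsProfile γ G) {p : ℝ} (hp : 0 ≤ p) (hp3 : p < 3) :
    Integrable (fun q : ℝ × ℝ => |q.1 - q.2| ^ p) (pairMeasure G) :=
  h.integrable_pair_of_le (C := 1) hp3 (measurable_abs_sub_rpow p) fun x y => by
    rw [abs_of_nonneg (by positivity), one_mul]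
    exact abs_sub_rpow_le hp x y

/-- Bernoulli with exponent 1 + γ/2 applied to |x - y|^2 bounds the pair moment of order 2 + γ below
by 1 + (1 + γ/2)(N - 1), where N is the one of order 2. Energy balance makes the two equal, so
(γ/2)(N - 1) ≤ 0. -/
theorem pairMoment_two_le_one (h : IsProfile γ G) (h0 : 0 < γ) (h1 : γ < 1) :
    pairMoment G 2 ≤ 1 := by
  have := h.isProbabilityMeasure_pair
  have i2 := h.integrable_pairMoment (p := 2) (by norm_num) (by norm_num)
  have i3 := h.integrable_pairMoment (p := 2 + γ) (by linarith) (by linarith)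
  have hle : ∫ q, (1 + (1 + γ / 2) * (|q.1 - q.2| ^ (2 : ℝ) - 1)) ∂(pairMeasure G) ≤
      pairMoment G (2 + γ) := by
    refine integral_mono ((integrable_const _).fun_add ((i2.fun_sub (integrable_const _)).const_mul _)) i3
      fun q => ?_
    have := one_add_mul_self_le_rpow_one_add (s := |q.1 - q.2| ^ (2 : ℝ) - 1)
      (by linarith [Real.rpow_nonneg (abs_nonneg (q.1 - q.2)) 2]) (p := 1 + γ / 2) (by linarith)
    rw [add_sub_cancel, ← Real.rpow_mul (abs_nonneg _)] at this
    have e : 2 * (1 + γ / 2) = 2 + γ := by ring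
    rw [e] at this
    exact this
  rw [integral_add (integrable_const _) ((i2.fun_sub (integrable_const _)).const_mul _),
    integral_const_mul, integral_sub i2 (integrable_const _)] at hle
  simp only [integral_const, probReal_univ, smul_eq_mul, mul_one] at hle
  rw [h.pairMoment_two_add h0 h1, ← h.pairMoment_two] at hle
  change 1 + (1 + γ / 2) * (pairMoment G 2 - 1) ≤ pairMoment G 2 at hle
  nlinarith

theorem absMoment_two_le (h : IsProfile γ G) (h0 : 0 < γ) (h1 : γ < 1) :
    absMoment G 2 ≤ 1 / 2 := by
  linarith [h.pairMoment_two, h.pairMoment_two_le_one h0 h1]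

/-- Convexity in the exponent: u^p ≥ u^2 + ((p - 2)/γ)(u^(2+γ) - u^2) with u = |x - y|, and the last
term integrates to zero by energy balance. -/
theorem pairMoment_two_le (h : IsProfile γ G) (h0 : 0 < γ) (h1 : γ < 1) {p : ℝ}
    (hp : 2 + γ ≤ p) (hp3 : p < 3) : pairMoment G 2 ≤ pairMoment G p := by
  have i2 := h.integrable_pairMoment (p := 2) (by norm_num) (by norm_num)
  have i3 := h.integrable_pairMoment (p := 2 + γ) (by linarith) (by linarith)
  have i4 := h.integrable_pairMoment (p := p) (by linarith) hp3
  have hle : ∫ q, (|q.1 - q.2| ^ (2 : ℝ) + ((p - 2) / γ) *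
      (|q.1 - q.2| ^ (2 + γ) - |q.1 - q.2| ^ (2 : ℝ))) ∂(pairMeasure G) ≤ pairMoment G p := by
    refine integral_mono (i2.fun_add ((i3.fun_sub i2).const_mul _)) i4 fun q => ?_
    set u := |q.1 - q.2| with hu
    have hu0 : 0 ≤ u := abs_nonneg _
    have := one_add_mul_self_le_rpow_one_add (s := u ^ γ - 1)
      (by linarith [Real.rpow_nonneg hu0 γ]) (p := (p - 2) / γ)
      ((one_le_div h0).2 (by linarith))
    rw [add_sub_cancel, ← Real.rpow_mul hu0, mul_div_cancel₀ _ h0.ne'] at this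
    have e1 : u ^ (2 + γ) = u ^ (2 : ℝ) * u ^ γ := Real.rpow_add' hu0 (by linarith)
    have e2 : u ^ p = u ^ (2 : ℝ) * u ^ (p - 2) := by
      rw [← Real.rpow_add' hu0 (by linarith)]; congr 1; ring
    change u ^ (2 : ℝ) + (p - 2) / γ * (u ^ (2 + γ) - u ^ (2 : ℝ)) ≤ u ^ p
    rw [e1, e2]
    have := mul_le_mul_of_nonneg_left this (by positivity : 0 ≤ u ^ (2 : ℝ))
    linarith
  rw [integral_add i2 ((i3.fun_sub i2).const_mul _), integral_const_mul, integral_sub i3 i2] at hle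
  have e := h.pairMoment_two_add h0 h1
  rw [← h.pairMoment_two] at e
  change pairMoment G 2 + (p - 2) / γ * (pairMoment G (2 + γ) - pairMoment G 2) ≤ _ at hle
  rw [e] at hle
  linarith

theorem pairMoment_le (h : IsProfile γ G) {p : ℝ} (hp : 1 ≤ p) (hp3 : p < 3) :
    pairMoment G p ≤ 8 * absMoment G p := by
  have i := h.integrable_abs_rpow (p := p) (by linarith) hp3
  have hle : pairMoment G p ≤ ∫ q, 4 * (|q.1| ^ p + |q.2| ^ p) ∂(pairMeasure G) := by
    refine integral_mono (h.integrable_pairMoment (by linarith) hp3)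
      (((h.integrable_fst i).fun_add (h.integrable_snd i)).const_mul 4) fun q => ?_
    exact (Real.rpow_le_rpow (abs_nonneg _) (abs_sub _ _) (by linarith)).trans
      (add_rpow_le_four_mul (abs_nonneg _) (abs_nonneg _) hp hp3.le)
  rw [integral_const_mul, integral_add (h.integrable_fst i) (h.integrable_snd i),
    h.integral_fst (fun x => |x| ^ p), h.integral_snd (fun x => |x| ^ p)] at hle
  unfold absMoment
  linarith

theorem absMoment_two_pos (h : IsProfile γ G) : 0 < absMoment G 2 := by
  have := h.isProbabilityMeasure
  unfold absMoment
  rw [integral_pos_iff_support_of_nonneg (fun x => by positivity)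
    (h.integrable_abs_rpow (by norm_num) (by norm_num))]
  have : Function.support (fun x : ℝ => |x| ^ (2 : ℝ)) = {0}ᶜ := by
    ext x; simp
  rw [this, prob_compl_eq_one_sub (measurableSet_singleton _)]
  simp

/-- Jensen's inequality for moments below the second one. -/
theorem absMoment_le (h : IsProfile γ G) {p : ℝ} (hp : 0 ≤ p) (hp2 : p ≤ 2) :
    absMoment G p ≤ Real.sqrt (absMoment G 2) ^ p := by
  have := h.isProbabilityMeasure
  set M := absMoment G 2 with hM
  have hM0 : 0 < M := h.absMoment_two_pos
  set E := Real.sqrt M with hE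
  have hE0 : 0 < E := Real.sqrt_pos.2 hM0
  have hEM : E ^ 2 = M := Real.sq_sqrt hM0.le
  have i2 := h.integrable_abs_rpow (p := 2) (by norm_num) (by norm_num)
  have i0 : Integrable (fun _ : ℝ => (1 : ℝ)) (profileMeasure G) := integrable_const _
  -- Tangent line of the concave power t^(p/2) at t = |x|^2 / M = 1; its linear part integrates to
  -- zero.
  have hle : absMoment G p ≤
      ∫ x, E ^ p * (1 + p / 2 * (|x| ^ (2 : ℝ) / M - 1)) ∂(profileMeasure G) := by
    refine integral_mono (h.integrable_abs_rpow hp (by linarith))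
      ((i0.fun_add (((i2.div_const M).fun_sub i0).const_mul (p / 2))).const_mul _) fun x => ?_
    have := rpow_one_add_le_one_add_mul_self (s := |x| ^ (2 : ℝ) / M - 1)
      (by have : 0 ≤ |x| ^ (2 : ℝ) / M := by positivity
          linarith) (p := p / 2) (by linarith) (by linarith)
    rw [add_sub_cancel, Real.div_rpow (by positivity) hM0.le, ← Real.rpow_mul (abs_nonneg _),
      mul_div_cancel₀ _ (two_ne_zero), ← hEM, ← Real.rpow_natCast, ← Real.rpow_mul hE0.le] at this
    have e : ((2 : ℕ) : ℝ) * (p / 2) = p := by push_cast; ring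
    rw [e, div_le_iff₀ (by positivity), Real.rpow_natCast, hEM] at this
    linarith
  refine hle.trans_eq ?_
  rw [integral_const_mul, integral_add i0 (((i2.div_const M).fun_sub i0).const_mul (p / 2)),
    integral_const_mul, integral_sub (i2.div_const M) i0, integral_div]
  change E ^ p * (_ + p / 2 * (M / M - _)) = _
  simp [div_self hM0.ne']

/-- The order s is θ · 2 + (1 - θ)(s + γ) with θ = γ/(s + γ - 2), and the second moment is at most 4
times the moment of order s + γ. The factor 4^θ tends to 1 with γ, so the drift term can be absorbed
by the dissipation. -/
theorem absMoment_interpolate (h : IsProfile γ G) (h0 : 0 < γ) (h1 : γ < 1) {s : ℝ} (hs : 2 < s)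
    (hsγ : s + γ < 3) :
    absMoment G s ≤ 4 ^ (γ / (s + γ - 2)) * absMoment G (s + γ) := by
  set θ := γ / (s + γ - 2) with hθ
  have hd : 0 < s + γ - 2 := by linarith
  have hθ0 : 0 < θ := by positivity
  have hθ1 : θ < 1 := (div_lt_one hd).2 (by linarith)
  have hM : absMoment G 2 ≤ 4 * absMoment G (s + γ) := by
    linarith [h.pairMoment_two, h.pairMoment_two_le h0 h1 (p := s + γ) (by linarith) hsγ,
      h.pairMoment_le (p := s + γ) (by linarith) hsγ]
  have i2 := h.integrable_abs_rpow (p := 2) (by norm_num) (by norm_num)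
  have i3 := h.integrable_abs_rpow (p := s + γ) (by linarith) hsγ
  have hle : absMoment G s ≤ ∫ x, 4 ^ (θ - 1) * (θ * |x| ^ (2 : ℝ) +
      (1 - θ) * 4 * |x| ^ (s + γ)) ∂(profileMeasure G) := by
    refine integral_mono (h.integrable_abs_rpow (by linarith) (by linarith))
      (((i2.const_mul _).fun_add (i3.const_mul _)).const_mul _) fun x => ?_
    set v := |x| ^ (s + γ - 2) with hv
    have hv0 : 0 ≤ v := by positivity
    have := rpow_one_add_le_one_add_mul_self (s := 4 * v - 1) (by linarith) (p := 1 - θ)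
      (by linarith) (by linarith)
    rw [add_sub_cancel, Real.mul_rpow (by norm_num) hv0, hv, ← Real.rpow_mul (abs_nonneg _)] at this
    have e : (s + γ - 2) * (1 - θ) = s - 2 := by rw [hθ]; field_simp; ring
    rw [e, ← hv] at this
    have e1 : |x| ^ s = |x| ^ (2 : ℝ) * |x| ^ (s - 2) := by
      rw [← Real.rpow_add' (abs_nonneg _) (by linarith)]; congr 1; ring
    have e2 : |x| ^ (s + γ) = |x| ^ (2 : ℝ) * v := by
      rw [hv, ← Real.rpow_add' (abs_nonneg _) (by linarith)]; congr 1; ring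
    have e3 : (4 : ℝ) ^ (θ - 1) * 4 ^ (1 - θ) = 1 := by
      rw [← Real.rpow_add (by norm_num)]; simp
    change |x| ^ s ≤ 4 ^ (θ - 1) * (θ * |x| ^ (2 : ℝ) + (1 - θ) * 4 * |x| ^ (s + γ))
    rw [e1, e2]
    have := mul_le_mul_of_nonneg_left this
      (by positivity : 0 ≤ |x| ^ (2 : ℝ) * (4 : ℝ) ^ (θ - 1))
    calc |x| ^ (2 : ℝ) * |x| ^ (s - 2)
        = |x| ^ (2 : ℝ) * |x| ^ (s - 2) * ((4 : ℝ) ^ (θ - 1) * 4 ^ (1 - θ)) := by rw [e3, mul_one]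
      _ = |x| ^ (2 : ℝ) * (4 : ℝ) ^ (θ - 1) * (4 ^ (1 - θ) * |x| ^ (s - 2)) := by ring
      _ ≤ _ := this
      _ = _ := by ring
  rw [integral_const_mul, integral_add (i2.const_mul _) (i3.const_mul _), integral_const_mul,
    integral_const_mul] at hle
  change absMoment G s ≤ 4 ^ (θ - 1) * (θ * absMoment G 2 + (1 - θ) * 4 * absMoment G (s + γ))
    at hle
  refine hle.trans ?_
  have e4 : (4 : ℝ) ^ θ = 4 ^ (θ - 1) * 4 := by
    rw [← Real.rpow_add_one (by norm_num)]; congr 1; ring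
  rw [e4, mul_assoc (4 ^ (θ - 1)) 4]
  refine mul_le_mul_of_nonneg_left ?_ (by positivity : (0 : ℝ) ≤ 4 ^ (θ - 1))
  nlinarith

/-- Integrates `dissipation_ge` in the moment identity. The mixed terms involve only orders below 2,
namely 1, 1 + γ, s - 1 and s - 1 + γ, which Jensen bounds by powers of the root of the energy of
total degree s + γ; here 13 = 7 + 6. -/
theorem moment_inequality (h : IsProfile γ G) (h0 : 0 < γ) (h1 : γ < 1) {s : ℝ} (hs : 2 < s)
    (hsγ : s + γ < 3) :
    (1 - 2 ^ (1 - s)) * absMoment G (s + γ) - 13 * Real.sqrt (absMoment G 2) ^ (s + γ) ≤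
      (s / 4) * absMoment G s := by
  have hid := h.moment_identity h0.le h1 hs.le hsγ
  have i3 := h.integrable_abs_rpow (p := s + γ) (by linarith) hsγ
  have j1 := h.integrable_pair_mul (p := s - 1 + γ) (q := 1) (by linarith) (by linarith)
    (by linarith) (by linarith)
  have j2 := h.integrable_pair_mul (p := 1) (q := s - 1 + γ) (by linarith) (by linarith)
    (by linarith) (by linarith)
  have j3 := h.integrable_pair_mul (p := s - 1) (q := 1 + γ) (by linarith) (by linarith)
    (by linarith) (by linarith)
  have j4 := h.integrable_pair_mul (p := 1 + γ) (q := s - 1) (by linarith) (by linarith)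
    (by linarith) (by linarith)
  have k1 := ((h.integrable_fst i3).fun_add (h.integrable_snd i3)).const_mul (1 - 2 ^ (1 - s))
  have k2 := (j1.fun_add j2).const_mul 7
  have k3 := (j3.fun_add j4).const_mul 6
  have hint : Integrable (fun q : ℝ × ℝ => (|q.1| ^ s + |q.2| ^ s - 2 * |(q.1 + q.2) / 2| ^ s) *
      |q.1 - q.2| ^ γ) (pairMeasure G) := by
    refine h.integrable_pair_of_le (C := 4) hsγ (by fun_prop) fun x y => ?_
    have px : 0 < 1 + |x| := by positivity
    have py : 0 < 1 + |y| := by positivity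
    set T := (1 + |x|) * (1 + |y|) with hT
    have hT1 : 1 + |x| + |y| ≤ T := one_add_abs_le_mul x y
    have hT0 : 0 < T := by positivity
    have b1 : |x| ^ s ≤ T ^ s :=
      Real.rpow_le_rpow (abs_nonneg _) (by linarith [abs_nonneg y]) (by linarith)
    have b2 : |y| ^ s ≤ T ^ s :=
      Real.rpow_le_rpow (abs_nonneg _) (by linarith [abs_nonneg x]) (by linarith)
    have b3 : |(x + y) / 2| ^ s ≤ T ^ s := by
      refine Real.rpow_le_rpow (abs_nonneg _) ?_ (by linarith)
      rw [abs_div, abs_two]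
      linarith [abs_add_le x y, abs_nonneg x, abs_nonneg y]
    have b4 : |x - y| ^ γ ≤ T ^ γ := Real.rpow_le_rpow (abs_nonneg _) (abs_sub_le_mul x y) h0.le
    have n1 : 0 ≤ |x| ^ s := by positivity
    have n2 : 0 ≤ |y| ^ s := by positivity
    have n3 : 0 ≤ |(x + y) / 2| ^ s := by positivity
    rw [← Real.mul_rpow px.le py.le, abs_mul, Real.rpow_add hT0,
      abs_of_nonneg (Real.rpow_nonneg (abs_nonneg (x - y)) γ), ← mul_assoc]
    gcongr
    rw [abs_le]; constructor <;> linarith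
  have hle := integral_mono ((k1.fun_sub k2).fun_sub k3) hint fun q => by
    simpa only [Real.rpow_one] using dissipation_ge h0 h1 hs.le (by linarith) q.1 q.2
  have v1 : ∫ q : ℝ × ℝ, (|q.1| ^ (s + γ) + |q.2| ^ (s + γ)) ∂(pairMeasure G) =
      2 * absMoment G (s + γ) := by
    rw [integral_add (h.integrable_fst i3) (h.integrable_snd i3),
      h.integral_fst (fun x => |x| ^ (s + γ)), h.integral_snd (fun x => |x| ^ (s + γ))]
    unfold absMoment; ring
  have v2 : ∫ q : ℝ × ℝ, (|q.1| ^ (s - 1 + γ) * |q.2| + |q.1| * |q.2| ^ (s - 1 + γ))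
      ∂(pairMeasure G) = 2 * (absMoment G (s - 1 + γ) * absMoment G 1) := by
    simp only [Real.rpow_one] at j1 j2
    have a1 := integral_pair_mul G (s - 1 + γ) 1
    have a2 := integral_pair_mul G 1 (s - 1 + γ)
    simp only [Real.rpow_one] at a1 a2
    rw [integral_add j1 j2, a1, a2]; ring
  have v3 : ∫ q : ℝ × ℝ, (|q.1| ^ (s - 1) * |q.2| ^ (1 + γ) + |q.1| ^ (1 + γ) * |q.2| ^ (s - 1))
      ∂(pairMeasure G) = 2 * (absMoment G (s - 1) * absMoment G (1 + γ)) := by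
    rw [integral_add j3 j4, integral_pair_mul, integral_pair_mul]; ring
  have v4 : ∫ q : ℝ × ℝ, ((1 - 2 ^ (1 - s)) * (|q.1| ^ (s + γ) + |q.2| ^ (s + γ))
      - 7 * (|q.1| ^ (s - 1 + γ) * |q.2| + |q.1| * |q.2| ^ (s - 1 + γ))
      - 6 * (|q.1| ^ (s - 1) * |q.2| ^ (1 + γ) + |q.1| ^ (1 + γ) * |q.2| ^ (s - 1)))
      ∂(pairMeasure G) = (1 - 2 ^ (1 - s)) * (2 * absMoment G (s + γ))
      - 7 * (2 * (absMoment G (s - 1 + γ) * absMoment G 1))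
      - 6 * (2 * (absMoment G (s - 1) * absMoment G (1 + γ))) := by
    simp only [Real.rpow_one] at k2
    have e1 := integral_sub (k1.fun_sub k2) k3
    have e2 := integral_sub k1 k2
    rw [integral_const_mul, v1, integral_const_mul, v2] at e2
    rw [integral_const_mul 6, v3] at e1
    rw [e1, e2]
  simp only [Real.rpow_one] at hle
  replace hle := v4.symm.trans_le hle
  set E := Real.sqrt (absMoment G 2) with hE
  have hE0 : 0 < E := Real.sqrt_pos.2 h.absMoment_two_pos
  have w1 : absMoment G (s - 1 + γ) * absMoment G 1 ≤ E ^ (s + γ) := by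
    calc _ ≤ E ^ (s - 1 + γ) * E ^ (1 : ℝ) := by
          gcongr
          · exact absMoment_nonneg _ _
          · exact h.absMoment_le (by linarith) (by linarith)
          · exact h.absMoment_le (by linarith) (by linarith)
      _ = _ := by rw [← Real.rpow_add hE0]; congr 1; ring
  change (s / 4) * absMoment G s = _ at hid
  have w2 : absMoment G (s - 1) * absMoment G (1 + γ) ≤ E ^ (s + γ) := by
    calc _ ≤ E ^ (s - 1) * E ^ (1 + γ) := by
          gcongr
          · exact absMoment_nonneg _ _
          · exact h.absMoment_le (by linarith) (by linarith)
          · exact h.absMoment_le (by linarith) (by linarith)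
      _ = _ := by rw [← Real.rpow_add hE0]; congr 1; ring
  linarith

end IsProfile

/-- Strict concavity gives 2^(3-s) < 1 + (3 - s); divide by 4. Equality holds at s = 2 and s = 3, so
the gap between dissipation and drift is positive only strictly between these orders. -/
theorem two_rpow_one_sub_lt {s : ℝ} (hs : 2 < s) (hs3 : s < 3) : (2 : ℝ) ^ (1 - s) < 1 - s / 4 := by
  have := rpow_one_add_lt_one_add_mul_self (s := 1) (by norm_num) (by norm_num) (p := 3 - s)
    (by linarith) (by linarith)
  have e : (2 : ℝ) ^ (1 - s) = (1 + 1) ^ (3 - s) / 4 := by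
    have : (4 : ℝ) = 2 ^ (2 : ℝ) := by norm_num
    rw [this, show (1 + 1 : ℝ) = 2 by norm_num, ← Real.rpow_sub (by norm_num)]
    congr 1; ring
  rw [e, div_lt_iff₀ (by norm_num)]
  refine this.trans_eq ?_
  ring

/-- Uniform upper bounds for the moments and a uniform lower bound for the energy. -/
theorem exists_moment_bounds {s : ℝ} (hs : 2 < s) (hs3 : s < 3) :
    ∃ γ₁ > 0, ∃ C > 0, ∃ e > 0, ∀ γ, 0 < γ → γ < γ₁ → ∀ G, IsProfile γ G →
      γ < 1 ∧ s + γ < 3 ∧ absMoment G (s + γ) ≤ C ∧ e ≤ absMoment G 2 := by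
  set κ : ℝ := 1 - 2 ^ (1 - s) - s / 4 with hκ
  have hκ0 : 0 < κ := by linarith [two_rpow_one_sub_lt hs hs3]
  have hs2 : 0 < s - 2 := by linarith
  -- Root of (104/κ) e0^(s-2) = 1. It arises from E^2 ≤ 4 M ≤ (104/κ) E^(s+γ), with M the moment of
  -- order s + γ, after dividing by E^2 and using E ≤ 1.
  set e0 : ℝ := (κ / 104) ^ (1 / (s - 2)) with he0
  have he00 : 0 < e0 := by positivity
  -- The first bound on γ forces 3 θ ≤ κ/2, so interpolation uses up at most half of the gap κ.
  refine ⟨min (κ * (s - 2) / 6) (min (3 - s) (s - 2)), lt_min (by positivity)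
    (lt_min (by linarith) (by linarith)), 26 / κ, by positivity, e0 ^ 2, by positivity, ?_⟩
  intro γ h0 hγ G h
  have g1 : γ < κ * (s - 2) / 6 := hγ.trans_le (min_le_left _ _)
  have g2 : γ < 3 - s := hγ.trans_le ((min_le_right _ _).trans (min_le_left _ _))
  have g3 : γ < s - 2 := hγ.trans_le ((min_le_right _ _).trans (min_le_right _ _))
  have h1 : γ < 1 := by linarith
  have hsγ : s + γ < 3 := by linarith
  set θ := γ / (s + γ - 2) with hθ
  have hd : 0 < s + γ - 2 := by linarith
  have hθ0 : 0 < θ := by positivity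
  have hθ1 : θ < 1 := (div_lt_one hd).2 (by linarith)
  have hθκ : 3 * θ ≤ κ / 2 := by
    have : θ ≤ γ / (s - 2) := by rw [hθ]; gcongr; linarith
    have h2 : γ / (s - 2) ≤ κ / 6 := by
      rw [div_le_iff₀ hs2]; linarith
    linarith
  have h4 : (4 : ℝ) ^ θ ≤ 1 + 3 * θ := by
    have := rpow_one_add_le_one_add_mul_self (s := 3) (by norm_num) (p := θ) hθ0.le hθ1.le
    norm_num at this
    linarith
  set E := Real.sqrt (absMoment G 2) with hE
  have hM0 := h.absMoment_two_pos
  have hE0 : 0 < E := Real.sqrt_pos.2 hM0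
  have hEM : E ^ 2 = absMoment G 2 := Real.sq_sqrt hM0.le
  have hE1 : E ≤ 1 := by
    rw [hE]; refine Real.sqrt_le_one.2 ?_
    linarith [h.absMoment_two_le h0 h1]
  have m0 : 0 ≤ absMoment G (s + γ) := IsProfile.absMoment_nonneg _ _
  have m1 := h.moment_inequality h0 h1 hs hsγ
  have m2 := h.absMoment_interpolate h0 h1 hs hsγ
  have m3 : s / 4 * absMoment G s ≤ (s / 4 + κ / 2) * absMoment G (s + γ) := by
    calc s / 4 * absMoment G s ≤ s / 4 * ((1 + 3 * θ) * absMoment G (s + γ)) := by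
          gcongr
          exact m2.trans (by gcongr)
      _ = (s / 4 + s / 4 * (3 * θ)) * absMoment G (s + γ) := by ring
      _ ≤ (s / 4 + κ / 2) * absMoment G (s + γ) := by
          gcongr
          nlinarith
  have m4 : κ / 2 * absMoment G (s + γ) ≤ 13 * E ^ (s + γ) := by
    have : 1 - 2 ^ (1 - s) = κ + s / 4 := by rw [hκ]; ring
    rw [this] at m1
    linarith
  have m5 : absMoment G (s + γ) ≤ 26 / κ * E ^ (s + γ) := by
    rw [div_mul_eq_mul_div, le_div_iff₀ hκ0]; linarith
  refine ⟨h1, hsγ, m5.trans ?_, ?_⟩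
  · have : E ^ (s + γ) ≤ 1 := Real.rpow_le_one hE0.le hE1 (by linarith)
    calc _ ≤ 26 / κ * 1 := by gcongr
      _ = _ := mul_one _
  · have hM : absMoment G 2 ≤ 4 * absMoment G (s + γ) := by
      linarith [h.pairMoment_two, h.pairMoment_two_le h0 h1 (p := s + γ) (by linarith) hsγ,
        h.pairMoment_le (p := s + γ) (by linarith) hsγ]
    have e1 : E ^ (s + γ) = E ^ 2 * E ^ (s + γ - 2) := by
      rw [← Real.rpow_natCast, ← Real.rpow_add hE0]; congr 1; push_cast; ring
    have e2 : E ^ (s + γ - 2) ≤ E ^ (s - 2) :=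
      Real.rpow_le_rpow_of_exponent_ge hE0 hE1 (by linarith)
    have e3 : E ^ 2 ≤ E ^ 2 * (104 / κ * E ^ (s - 2)) := by
      calc E ^ 2 ≤ 4 * (26 / κ * E ^ (s + γ)) := by rw [hEM]; linarith
        _ = E ^ 2 * (104 / κ * E ^ (s + γ - 2)) := by rw [e1]; ring
        _ ≤ _ := by gcongr
    have e4 : 1 ≤ 104 / κ * E ^ (s - 2) := by
      have : 0 < E ^ 2 := by positivity
      nlinarith
    have e5 : κ / 104 ≤ E ^ (s - 2) := by
      rw [div_mul_eq_mul_div, le_div_iff₀ hκ0] at e4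
      linarith
    have e6 : e0 ≤ E := by
      calc e0 ≤ (E ^ (s - 2)) ^ (1 / (s - 2)) :=
            Real.rpow_le_rpow (by positivity) e5 (by positivity)
        _ = E := by
            rw [← Real.rpow_mul hE0.le, mul_one_div_cancel hs2.ne', Real.rpow_one]
    rw [← hEM]
    gcongr

/-! ### The representative continuous off the origin; decay from moments -/

/-- A profile given by its canonical representative, continuous away from the origin. -/
structure GoodProfile (γ : ℝ) (g : ℝ → ℝ) : Prop where
  profile : IsProfile γ g
  pos : 0 < γ
  lt_one : γ < 1
  nonneg : ∀ x, 0 ≤ g x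
  map_zero : g 0 = 0
  measurable : Measurable g
  continuousAt : ∀ x, x ≠ 0 → ContinuousAt g x
  flux : ∀ x, x ≠ 0 → x * g x / 4 = profileFlux γ g x

theorem profileMeasure_congr {G H : ℝ → ℝ} (h : G =ᵐ[volume] H) :
    profileMeasure G = profileMeasure H := by
  unfold profileMeasure
  refine withDensity_congr_ae ?_
  filter_upwards [h] with x hx
  rw [hx]

theorem profileFlux_congr (γ : ℝ) {G H : ℝ → ℝ} (h : G =ᵐ[volume] H) :
    profileFlux γ G = profileFlux γ H := by
  unfold profileFlux pairMeasure
  rw [profileMeasure_congr h]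

/-- These are the three lines across which the jump is discontinuous in its level z. The pair
measure does not charge them, so dominated convergence makes the flux continuous. -/
theorem ae_pair_ne (G : ℝ → ℝ) (z : ℝ) :
    ∀ᵐ p ∂(pairMeasure G), p.1 ≠ z ∧ p.2 ≠ z ∧ (p.1 + p.2) / 2 ≠ z := by
  have hne : ∀ᵐ x ∂(profileMeasure G), x ≠ z := by
    rw [ae_iff]; simp
  have h1 : ∀ᵐ p ∂(pairMeasure G), p.1 ≠ z := Measure.quasiMeasurePreserving_fst.ae hne
  have h2 : ∀ᵐ p ∂(pairMeasure G), p.2 ≠ z := Measure.quasiMeasurePreserving_snd.ae hne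
  have h3 : ∀ᵐ p ∂(pairMeasure G), (p.1 + p.2) / 2 ≠ z := by
    rw [ae_iff]
    unfold pairMeasure
    have hms : MeasurableSet {p : ℝ × ℝ | ¬(p.1 + p.2) / 2 ≠ z} := by
      simp only [not_not]
      exact measurableSet_eq_fun (by fun_prop) measurable_const
    rw [Measure.measure_prod_null hms]
    refine Filter.Eventually.of_forall fun x => ?_
    have : (Prod.mk x ⁻¹' {p : ℝ × ℝ | ¬(p.1 + p.2) / 2 ≠ z}) ⊆ {2 * z - x} := by
      intro y hy
      simp only [Set.mem_preimage, Set.mem_ofPred_eq, not_not] at hy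
      rw [Set.mem_singleton_iff]; linarith
    exact measure_mono_null this (measure_singleton _)
  filter_upwards [h1, h2, h3] with p a b c using ⟨a, b, c⟩

theorem continuousAt_step {z x : ℝ} (h : x ≠ z) : ContinuousAt (fun z => step z x) z := by
  rcases lt_or_gt_of_ne h with h | h
  · refine ContinuousAt.congr (continuousAt_const (y := (0 : ℝ))) ?_
    filter_upwards [lt_mem_nhds h] with w hw
    unfold step; rw [if_neg (not_lt.2 (le_of_lt hw))]
  · refine ContinuousAt.congr (continuousAt_const (y := (1 : ℝ))) ?_
    filter_upwards [gt_mem_nhds h] with w hw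
    unfold step; rw [if_pos hw]

theorem IsProfile.continuous_flux {γ : ℝ} {G : ℝ → ℝ} (h : IsProfile γ G) (h0 : 0 ≤ γ)
    (h3 : γ < 3) : Continuous (profileFlux γ G) := by
  rw [continuous_iff_continuousAt]
  intro z
  unfold profileFlux
  refine continuousAt_const.mul ?_
  refine continuousAt_of_dominated (bound := fun p : ℝ × ℝ => |p.1 - p.2| ^ γ) ?_ ?_
    (h.integrable_abs_sub_rpow h0 h3) ?_
  · exact Filter.Eventually.of_forall fun w =>
      ((measurable_stepJump_right w).mul (measurable_abs_sub_rpow γ)).aestronglyMeasurable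
  · refine Filter.Eventually.of_forall fun w => Filter.Eventually.of_forall fun p => ?_
    have hw : 0 ≤ |p.1 - p.2| ^ γ := by positivity
    rw [norm_mul, Real.norm_eq_abs, Real.norm_eq_abs, abs_of_nonneg hw]
    exact mul_le_of_le_one_left hw (abs_stepJump_le_one _ _ _)
  · filter_upwards [ae_pair_ne G z] with p hp
    unfold stepJump
    exact (((continuousAt_step hp.1).add (continuousAt_step hp.2.1)).sub
      (continuousAt_const.mul (continuousAt_step hp.2.2))).mul continuousAt_const

/-- Every profile has a representative which is nonnegative and continuous off the origin. -/
theorem IsProfile.exists_good {γ : ℝ} {G : ℝ → ℝ} (h : IsProfile γ G) (h0 : 0 < γ) (h1 : γ < 1) :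
    ∃ g, G =ᵐ[volume] g ∧ GoodProfile γ g := by
  have hcont := h.continuous_flux h0.le (by linarith)
  -- The value at 0 is 0 by the convention for division, not the limit of g there; that limit is
  -- later identified as `centralValue`.
  set g : ℝ → ℝ := fun x => 4 * profileFlux γ G x / x with hg
  have hGg : G =ᵐ[volume] g := by
    have hne : ∀ᵐ x : ℝ, x ≠ 0 := by rw [ae_iff]; simp
    filter_upwards [h.ae_eq_flux h0.le h1, hne] with x hx hx0
    rw [hg]
    simp only [← hx]
    field_simp
  have hgc : ∀ x, x ≠ 0 → ContinuousAt g x := fun x hx =>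
    (hcont.continuousAt.const_mul 4).div continuousAt_id hx
  refine ⟨g, hGg, h.congr hGg, h0, h1, fun x => ?_, by simp [hg], ?_, hgc, fun x hx => ?_⟩
  · rcases eq_or_ne x 0 with rfl | hx
    · simp [hg]
    -- Almost everywhere nonnegativity becomes pointwise: off the origin the set where g < 0 is open
    -- and null, hence empty.
    have hopen : IsOpen ({0}ᶜ ∩ g ⁻¹' Set.Iio 0 : Set ℝ) :=
      ContinuousOn.isOpen_inter_preimage
        (fun y hy => (hgc y hy).continuousWithinAt) isOpen_compl_singleton isOpen_Iio
    have hnull : volume ({0}ᶜ ∩ g ⁻¹' Set.Iio 0 : Set ℝ) = 0 := by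
      have := (h.congr hGg).nonneg
      rw [ae_iff] at this
      exact measure_mono_null (fun y hy => not_le.2 hy.2) this
    have hempty := hopen.measure_eq_zero_iff volume |>.1 hnull
    by_contra hlt
    exact (Set.ext_iff.1 hempty x).1 ⟨hx, not_le.1 hlt⟩
  · exact (hcont.measurable.const_mul 4).div measurable_id
  · rw [← profileFlux_congr γ hGg, hg]
    field_simp

namespace GoodProfile

variable {γ : ℝ} {g : ℝ → ℝ}

theorem reflect (h : GoodProfile γ g) : GoodProfile γ fun x => g (-x) where
  profile := h.profile.reflect
  pos := h.pos
  lt_one := h.lt_one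
  nonneg x := h.nonneg _
  map_zero := by rw [neg_zero, h.map_zero]
  measurable := h.measurable.comp measurable_neg
  continuousAt x hx := (h.continuousAt (-x) (neg_ne_zero.2 hx)).comp continuousAt_neg
  flux x hx := by
    have hp := h.profile.reflect
    have hae := hp.ae_eq_flux h.pos.le h.lt_one
    have := Measure.eqOn_open_of_ae_eq (U := ({0}ᶜ : Set ℝ)) (μ := volume)
      (f := fun x => x * g (-x) / 4) (g := profileFlux γ fun x => g (-x))
      (ae_restrict_of_ae hae) isOpen_compl_singleton
      (fun y hy => ((continuousAt_id.mul ((h.continuousAt (-y) (neg_ne_zero.2 hy)).comp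
        continuousAt_neg)).div_const 4).continuousWithinAt)
      (hp.continuous_flux h.pos.le (by linarith [h.lt_one])).continuousOn
    exact this hx

theorem integral_measure (h : GoodProfile γ g) (f : ℝ → ℝ) :
    ∫ x, f x ∂(profileMeasure g) = ∫ x, g x * f x := h.profile.integral_measure f

theorem absMoment_le_one (h : GoodProfile γ g) {p : ℝ} (hp : 0 ≤ p) (hp2 : p ≤ 2) :
    absMoment g p ≤ 1 := by
  refine (h.profile.absMoment_le hp hp2).trans (Real.rpow_le_one (Real.sqrt_nonneg _) ?_ hp)
  exact Real.sqrt_le_one.2 (by linarith [h.profile.absMoment_two_le h.pos h.lt_one])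

/-- For z > 0 the midpoint enters with the good sign and is dropped, and each remaining step is
bounded by (|t|/|z|)^p as in Chebyshev. For z < 0 the same works with the complements 1 - step,
which only change the sign of the jump. -/
theorem stepJump_sign_le {z : ℝ} (hz : z ≠ 0) {p : ℝ} (hp : 0 ≤ p) (x y : ℝ) :
    SignType.sign z * stepJump z x y ≤ (|z| ^ p)⁻¹ * (|x| ^ p + |y| ^ p) := by
  have hz0 : 0 < |z| := abs_pos.2 hz
  have key : ∀ t : ℝ, |z| ≤ |t| → 1 ≤ (|z| ^ p)⁻¹ * |t| ^ p := fun t ht => by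
    rw [inv_mul_eq_div, one_le_div (by positivity)]
    exact Real.rpow_le_rpow hz0.le ht hp
  have key0 : ∀ t : ℝ, 0 ≤ (|z| ^ p)⁻¹ * |t| ^ p := fun t => by positivity
  rw [mul_add]
  rcases lt_or_gt_of_ne hz with hneg | hpos
  · rw [sign_neg hneg]
    have a : ∀ t : ℝ, 1 - step z t ≤ (|z| ^ p)⁻¹ * |t| ^ p := fun t => by
      unfold step
      split_ifs with ht
      · simpa using key0 t
      · rw [sub_zero]
        refine key t ?_
        rw [abs_of_neg hneg, abs_of_nonpos (by linarith)]; linarith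
    have b := step_le_one z ((x + y) / 2)
    have := a x
    have := a y
    simp only [SignType.coe_neg_one]
    unfold stepJump
    linarith
  · rw [sign_pos hpos]
    have a : ∀ t : ℝ, step z t ≤ (|z| ^ p)⁻¹ * |t| ^ p := fun t => by
      unfold step
      split_ifs with ht
      · refine key t ?_
        rw [abs_of_pos hpos, abs_of_pos (by linarith)]; linarith
      · exact key0 t
    have b := step_nonneg z ((x + y) / 2)
    have := a x
    have := a y
    simp only [SignType.coe_one]
    unfold stepJump
    linarith

/-- Pointwise decay from moments. -/
theorem decay (h : GoodProfile γ g) {p : ℝ} (hp : 0 ≤ p) (hpγ : p + γ < 3) {z : ℝ} (hz : z ≠ 0) :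
    |z| ^ (1 + p) * g z ≤ 4 * (absMoment g (p + γ) + absMoment g p * absMoment g γ) := by
  have hP := h.profile
  have h0 := h.pos
  have h1 := h.lt_one
  have hz0 : 0 < |z| := abs_pos.2 hz
  have e : |z| * g z / 4 = 1 / 2 * ∫ q, SignType.sign z * stepJump z q.1 q.2 * |q.1 - q.2| ^ γ
      ∂(pairMeasure g) := by
    rw [← sign_mul_self z, mul_assoc, mul_div_assoc, h.flux z hz, profileFlux]
    simp only [mul_assoc, integral_const_mul]
    ring
  have i1 := hP.integrable_abs_rpow (p := p + γ) (by linarith) hpγ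
  have j1 := hP.integrable_pair_mul (p := p) (q := γ) hp (by linarith) h0.le (by linarith)
  have j2 := hP.integrable_pair_mul (p := γ) (q := p) h0.le (by linarith) hp (by linarith)
  have k := ((hP.integrable_fst i1).fun_add (hP.integrable_snd i1)).fun_add (j1.fun_add j2)
  have hle : ∫ q, SignType.sign z * stepJump z q.1 q.2 * |q.1 - q.2| ^ γ ∂(pairMeasure g) ≤
      ∫ q, (|z| ^ p)⁻¹ * ((|q.1| ^ (p + γ) + |q.2| ^ (p + γ)) +
        (|q.1| ^ p * |q.2| ^ γ + |q.1| ^ γ * |q.2| ^ p)) ∂(pairMeasure g) := by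
    refine integral_mono ?_ (k.const_mul _) fun q => ?_
    · have := (hP.integrable_stepJump h0.le (by linarith) z).const_mul (SignType.sign z : ℝ)
      simpa only [mul_assoc] using this
    · have a := stepJump_sign_le hz hp q.1 q.2
      have b := rpow_abs_sub_le h0.le h1.le q.1 q.2
      calc _ ≤ (|z| ^ p)⁻¹ * (|q.1| ^ p + |q.2| ^ p) * |q.1 - q.2| ^ γ := by gcongr
        _ ≤ (|z| ^ p)⁻¹ * (|q.1| ^ p + |q.2| ^ p) * (|q.1| ^ γ + |q.2| ^ γ) := by gcongr
        _ = _ := by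
          have g1 : ∀ t : ℝ, |t| ^ (p + γ) = |t| ^ p * |t| ^ γ := fun t =>
            Real.rpow_add' (abs_nonneg _) (by linarith)
          simp only [g1]; ring
  rw [integral_const_mul, integral_add ((hP.integrable_fst i1).fun_add (hP.integrable_snd i1))
    (j1.fun_add j2), integral_add (hP.integrable_fst i1) (hP.integrable_snd i1),
    integral_add j1 j2, IsProfile.integral_pair_mul, IsProfile.integral_pair_mul,
    hP.integral_fst (fun x => |x| ^ (p + γ)), hP.integral_snd (fun x => |x| ^ (p + γ))] at hle
  change _ ≤ (|z| ^ p)⁻¹ * (absMoment g (p + γ) + absMoment g (p + γ) + _) at hle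
  rw [Real.rpow_add hz0, Real.rpow_one]
  have hzp : 0 < |z| ^ p := by positivity
  rw [inv_mul_eq_div, le_div_iff₀ hzp] at hle
  have : |z| * |z| ^ p * g z = 4 * (|z| * g z / 4) * |z| ^ p := by ring
  rw [this, e]
  linarith

/-- The decay estimate at p = 0, where the moments involved are at most 1. It degenerates at the
origin but requires no smallness of γ, and it starts both the concentration argument and the
supremum iteration. -/
theorem abs_mul_le (h : GoodProfile γ g) {z : ℝ} (hz : z ≠ 0) : |z| * g z ≤ 8 := by
  have := h.decay (p := 0) le_rfl (by linarith [h.lt_one]) hz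
  rw [add_zero, Real.rpow_one, zero_add] at this
  have h1 := h.absMoment_le_one (p := γ) h.pos.le (by linarith [h.lt_one])
  have h2 := h.absMoment_le_one (p := 0) le_rfl (by norm_num)
  have := IsProfile.absMoment_nonneg g γ
  have := IsProfile.absMoment_nonneg g 0
  nlinarith

theorem le_div_abs (h : GoodProfile γ g) {z : ℝ} (hz : z ≠ 0) : g z ≤ 8 / |z| := by
  rw [le_div_iff₀ (abs_pos.2 hz), mul_comm]; exact h.abs_mul_le hz

/-- Increment of the flux: gain minus loss. -/
theorem flux_sub (h : GoodProfile γ g) (w z : ℝ) :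
    profileFlux γ g z - profileFlux γ g w =
      (∫ q, (step w ((q.1 + q.2) / 2) - step z ((q.1 + q.2) / 2)) * |q.1 - q.2| ^ γ
        ∂(pairMeasure g)) - ∫ q, (step w q.1 - step z q.1) * |q.1 - q.2| ^ γ ∂(pairMeasure g) := by
  have hP := h.profile
  have hw := hP.integrable_abs_sub_rpow h.pos.le (by linarith [h.lt_one])
  have hint : ∀ f : ℝ × ℝ → ℝ, Measurable f → Integrable (fun q : ℝ × ℝ =>
      (step w (f q) - step z (f q)) * |q.1 - q.2| ^ γ) (pairMeasure g) := fun f hf => by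
    refine hw.bdd_mul (c := 1) ?_ (Filter.Eventually.of_forall fun q => ?_)
    · exact ((measurable_step.comp (measurable_const.prodMk hf)).sub
        (measurable_step.comp (measurable_const.prodMk hf))).aestronglyMeasurable
    · rw [Real.norm_eq_abs, abs_le]
      constructor <;> linarith [step_nonneg w (f q), step_nonneg z (f q), step_le_one w (f q),
        step_le_one z (f q)]
  have i1 := hint (fun q => q.1) measurable_fst
  have i2 := hint (fun q => q.2) measurable_snd
  have i3 := hint (fun q => (q.1 + q.2) / 2) (by fun_prop)
  have hsymm : ∫ q, (step w q.2 - step z q.2) * |q.1 - q.2| ^ γ ∂(pairMeasure g) =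
      ∫ q, (step w q.1 - step z q.1) * |q.1 - q.2| ^ γ ∂(pairMeasure g) := by
    have := integral_prod_swap (μ := profileMeasure g) (ν := profileMeasure g)
      fun q : ℝ × ℝ => (step w q.1 - step z q.1) * |q.1 - q.2| ^ γ
    simp only [Prod.fst_swap, Prod.snd_swap] at this
    unfold pairMeasure
    rw [← this]
    congr 1; funext q; rw [abs_sub_comm]
  unfold profileFlux
  rw [← mul_sub, ← integral_sub (hP.integrable_stepJump h.pos.le (by linarith [h.lt_one]) z)
    (hP.integrable_stepJump h.pos.le (by linarith [h.lt_one]) w)]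
  have e : ∀ q : ℝ × ℝ, stepJump z q.1 q.2 * |q.1 - q.2| ^ γ - stepJump w q.1 q.2 *
      |q.1 - q.2| ^ γ =
      2 * ((step w ((q.1 + q.2) / 2) - step z ((q.1 + q.2) / 2)) * |q.1 - q.2| ^ γ) -
      ((step w q.1 - step z q.1) * |q.1 - q.2| ^ γ +
        (step w q.2 - step z q.2) * |q.1 - q.2| ^ γ) := fun q => by
    unfold stepJump; ring
  simp only [e]
  rw [integral_sub (i3.const_mul 2) (i1.fun_add i2), integral_const_mul, integral_add i1 i2, hsymm]
  ring

end GoodProfile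

/-! ### Absence of concentration at the origin -/

/-- The mass of the interval `(-ρ, ρ)`. -/
def massNear (g : ℝ → ℝ) (ρ : ℝ) : ℝ := (profileMeasure g).real (Set.Ioo (-ρ) ρ)

/-- The Cauchy bump of width `r`. -/
def cauchyBump (r x : ℝ) : ℝ := r ^ 2 / (r ^ 2 + x ^ 2)

theorem cauchyBump_nonneg (r x : ℝ) : 0 ≤ cauchyBump r x := by unfold cauchyBump; positivity

theorem cauchyBump_le_one (r x : ℝ) : cauchyBump r x ≤ 1 := by
  unfold cauchyBump
  exact div_le_one_of_le₀ (by nlinarith [sq_nonneg x]) (by positivity)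

theorem hasDerivAt_cauchyBump {r : ℝ} (hr : 0 < r) (x : ℝ) :
    HasDerivAt (cauchyBump r) (-(2 * x * r ^ 2 / (r ^ 2 + x ^ 2) ^ 2)) x := by
  unfold cauchyBump
  have hne : r ^ 2 + x ^ 2 ≠ 0 := by positivity
  have h1 : HasDerivAt (fun x : ℝ => r ^ 2 + x ^ 2) (2 * x) x := by
    simpa using (hasDerivAt_pow 2 x).const_add (r ^ 2)
  have h2 := (hasDerivAt_const x (r ^ 2)).div h1 hne
  refine h2.congr_deriv ?_
  field_simp
  ring

theorem abs_deriv_cauchyBump_le {r : ℝ} (hr : 0 < r) (x : ℝ) :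
    |2 * x * r ^ 2 / (r ^ 2 + x ^ 2) ^ 2| ≤ 1 / r := by
  have hx : 2 * |x| * r ≤ r ^ 2 + x ^ 2 := by
    rw [← sq_abs x]; nlinarith [sq_nonneg (r - |x|)]
  rw [abs_div, abs_of_pos (by positivity : 0 < (r ^ 2 + x ^ 2) ^ 2), div_le_div_iff₀ (by positivity)
    hr, abs_mul, abs_mul, abs_two, abs_of_pos (by positivity : 0 < r ^ 2)]
  calc 2 * |x| * r ^ 2 * r = (2 * |x| * r) * r ^ 2 := by ring
    _ ≤ (r ^ 2 + x ^ 2) * (r ^ 2 + x ^ 2) := by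
      gcongr
      nlinarith [sq_nonneg x]
    _ = _ := by ring

theorem isCb1_cauchyBump {r : ℝ} (hr : 0 < r) : IsCb1 (cauchyBump r) := by
  refine ⟨?_, ⟨1, fun x => ?_⟩, ⟨1 / r, fun x => ?_⟩⟩
  · unfold cauchyBump
    exact contDiff_const.div (contDiff_const.add (contDiff_id.pow 2)) fun x => by
      have : 0 < r ^ 2 + x ^ 2 := by positivity
      exact this.ne'
  · rw [abs_of_nonneg (cauchyBump_nonneg r x)]; exact cauchyBump_le_one r x
  · rw [(hasDerivAt_cauchyBump hr x).deriv, abs_neg]; exact abs_deriv_cauchyBump_le hr x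

theorem continuous_cauchyBump {r : ℝ} (hr : 0 < r) : Continuous (cauchyBump r) :=
  (isCb1_cauchyBump hr).1.continuous

theorem abs_cauchyBump_sub_le {r : ℝ} (hr : 0 < r) (a b : ℝ) :
    |cauchyBump r a - cauchyBump r b| ≤ 1 / r * |a - b| := by
  refine Convex.norm_image_sub_le_of_norm_deriv_le (s := Set.univ) (f := cauchyBump r)
    (fun x _ => (hasDerivAt_cauchyBump hr x).differentiableAt) (fun x _ => ?_) convex_univ
    (Set.mem_univ b) (Set.mem_univ a)
  rw [(hasDerivAt_cauchyBump hr x).deriv, norm_neg]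
  exact abs_deriv_cauchyBump_le hr x

theorem integral_cauchyBump {r : ℝ} (hr : 0 < r) :
    Integrable (cauchyBump r) ∧ ∫ x, cauchyBump r x = r * Real.pi := by
  have e : cauchyBump r = fun x => (fun y : ℝ => (1 + y ^ 2)⁻¹) (x / r) := by
    funext x; unfold cauchyBump; field_simp
  rw [e]
  refine ⟨integrable_inv_one_add_sq.comp_div hr.ne', ?_⟩
  rw [Measure.integral_comp_div (fun y : ℝ => (1 + y ^ 2)⁻¹) r, integral_univ_inv_one_add_sq,
    abs_of_pos hr, smul_eq_mul]

theorem integral_cauchyBump_midpoint {r : ℝ} (hr : 0 < r) (y : ℝ) :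
    Integrable (fun x => cauchyBump r ((x + y) / 2)) ∧
      ∫ x, cauchyBump r ((x + y) / 2) = 2 * (r * Real.pi) := by
  obtain ⟨h1, h2⟩ := integral_cauchyBump hr
  refine ⟨(h1.comp_div two_ne_zero).comp_add_right y, ?_⟩
  rw [integral_add_right_eq_self (fun x => cauchyBump r (x / 2)) y,
    Measure.integral_comp_div (cauchyBump r) 2, h2]
  simp

theorem abs_indicator_one_le (S : Set ℝ) (x : ℝ) : |S.indicator (1 : ℝ → ℝ) x| ≤ 1 := by
  by_cases hx : x ∈ S <;> simp [hx]

/-- `u |u ^ γ - 1| ≤ γ (1 + u²)`. -/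
theorem mul_abs_rpow_sub_one_le {γ u : ℝ} (h0 : 0 ≤ γ) (h1 : γ ≤ 1) (hu : 0 ≤ u) :
    u * |u ^ γ - 1| ≤ γ * (1 + u ^ 2) := by
  rcases hu.eq_or_lt with rfl | hu0
  · simpa using h0
  rcases le_total 1 u with h | h
  · have hb := rpow_one_add_le_one_add_mul_self (s := u - 1) (by linarith) h0 h1
    rw [add_sub_cancel] at hb
    have h3 : 1 ≤ u ^ γ := Real.one_le_rpow h h0
    rw [abs_of_nonneg (by linarith)]
    nlinarith [mul_le_mul_of_nonneg_left hb hu]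
  · have h3 : u ^ γ ≤ 1 := Real.rpow_le_one hu h h0
    have h4 : 0 < u ^ γ := by positivity
    rw [abs_of_nonpos (by linarith)]
    have hb := rpow_one_add_le_one_add_mul_self (s := u⁻¹ - 1)
      (by linarith [inv_pos.2 hu0]) h0 h1
    rw [add_sub_cancel, Real.inv_rpow hu] at hb
    have h5 : 1 ≤ u ^ γ * (1 + γ * (u⁻¹ - 1)) := by
      calc 1 = u ^ γ * (u ^ γ)⁻¹ := (mul_inv_cancel₀ h4.ne').symm
        _ ≤ _ := by gcongr
    have h6 : 0 ≤ u⁻¹ - 1 := by rw [sub_nonneg]; exact (one_le_inv₀ hu0).2 h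
    have h7 : 1 - u ^ γ ≤ γ * (u⁻¹ - 1) := by nlinarith [mul_nonneg h0 h6]
    have h8 := mul_le_mul_of_nonneg_left h7 hu
    have h9 : u * (γ * (u⁻¹ - 1)) = γ * (1 - u) := by field_simp
    nlinarith [mul_nonneg h0 hu, mul_nonneg h0 (sq_nonneg u)]

namespace GoodProfile

variable {γ : ℝ} {g : ℝ → ℝ}

theorem isProbabilityMeasure (h : GoodProfile γ g) : IsProbabilityMeasure (profileMeasure g) :=
  h.profile.isProbabilityMeasure

theorem massNear_nonneg (g : ℝ → ℝ) (ρ : ℝ) : 0 ≤ massNear g ρ := measureReal_nonneg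

theorem massNear_mono (h : GoodProfile γ g) {r ρ : ℝ} (hr : r ≤ ρ) :
    massNear g r ≤ massNear g ρ := by
  have := h.isProbabilityMeasure
  exact measureReal_mono (Set.Ioo_subset_Ioo (by linarith) hr)

/-- On a set where `g ≤ A`, integrals against the profile are at most `A` times those against
Lebesgue measure. -/
theorem integral_indicator_le (h : GoodProfile γ g) {S : Set ℝ} (hS : MeasurableSet S) {A : ℝ}
    (hA : ∀ x ∈ S, g x ≤ A) {f : ℝ → ℝ} (hf : ∀ x, 0 ≤ f x) (hint : IntegrableOn f S) :
    ∫ x, S.indicator f x ∂(profileMeasure g) ≤ A * ∫ x in S, f x := by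
  rw [h.integral_measure, ← integral_indicator hS, ← integral_const_mul]
  refine integral_mono_of_nonneg (Filter.Eventually.of_forall fun x =>
    mul_nonneg (h.nonneg x) (Set.indicator_nonneg (fun y _ => hf y) x))
    (((integrable_indicator_iff hS).2 hint).const_mul A) (Filter.Eventually.of_forall fun x => ?_)
  by_cases hx : x ∈ S
  · simp only [Set.indicator_of_mem hx]
    exact mul_le_mul_of_nonneg_right (hA x hx) (hf x)
  · simp [Set.indicator_of_notMem hx]

theorem integrable_pair_of_bounded (h : GoodProfile γ g) {f : ℝ × ℝ → ℝ} (hf : Measurable f)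
    {C : ℝ} (hC : ∀ q, |f q| ≤ C) : Integrable f (pairMeasure g) := by
  have := h.profile.isProbabilityMeasure_pair
  exact Integrable.of_bound hf.aestronglyMeasurable C (Filter.Eventually.of_forall hC)

theorem integrable_of_bounded (h : GoodProfile γ g) {f : ℝ → ℝ} (hf : Measurable f)
    {C : ℝ} (hC : ∀ q, |f q| ≤ C) : Integrable f (profileMeasure g) := by
  have := h.isProbabilityMeasure
  exact Integrable.of_bound hf.aestronglyMeasurable C (Filter.Eventually.of_forall hC)

/-- The bump decreases away from 0, so the drift side of the weak equation is nonnegative and hence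
so is the collision term. Replacing the kernel by 1 there costs at most u |u^γ - 1| / r ≤ γ (1 +
u^2) / r with u = |x - y|, and the pair moment of order 2 is at most 1. -/
theorem integral_bump_le (h : GoodProfile γ g) {r : ℝ} (hr : 0 < r) :
    ∫ x, cauchyBump r x ∂(profileMeasure g) ≤
      (∫ q, cauchyBump r ((q.1 + q.2) / 2) ∂(pairMeasure g)) + γ / r := by
  have hP := h.profile
  have h0 := h.pos
  have hpr := hP.isProbabilityMeasure_pair
  set φ := cauchyBump r with hφ
  have hφm : Measurable φ := (continuous_cauchyBump hr).measurable
  have hφb : ∀ x, |φ x| ≤ 1 := fun x => by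
    rw [abs_of_nonneg (cauchyBump_nonneg r x)]; exact cauchyBump_le_one r x
  have hs := hP.steady φ (isCb1_cauchyBump hr)
  rw [hP.collisionWeak_eq] at hs
  have hneg : ∫ x, x * deriv φ x * g x ≤ 0 := by
    refine integral_nonpos fun x => ?_
    rw [(hasDerivAt_cauchyBump hr x).deriv]
    have : 0 ≤ 2 * x ^ 2 * r ^ 2 / (r ^ 2 + x ^ 2) ^ 2 * g x :=
      mul_nonneg (by positivity) (h.nonneg x)
    have e : x * -(2 * x * r ^ 2 / (r ^ 2 + x ^ 2) ^ 2) * g x =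
        -(2 * x ^ 2 * r ^ 2 / (r ^ 2 + x ^ 2) ^ 2 * g x) := by ring
    change x * -(2 * x * r ^ 2 / (r ^ 2 + x ^ 2) ^ 2) * g x ≤ 0
    rw [e]; linarith
  have j1 : Integrable (fun q : ℝ × ℝ => φ q.1) (pairMeasure g) :=
    h.integrable_pair_of_bounded (hφm.comp measurable_fst) fun q => hφb _
  have j2 : Integrable (fun q : ℝ × ℝ => φ q.2) (pairMeasure g) :=
    h.integrable_pair_of_bounded (hφm.comp measurable_snd) fun q => hφb _
  have j3 : Integrable (fun q : ℝ × ℝ => φ ((q.1 + q.2) / 2)) (pairMeasure g) :=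
    h.integrable_pair_of_bounded
      (hφm.comp (g := φ) (f := fun q : ℝ × ℝ => (q.1 + q.2) / 2) (by fun_prop)) fun q => hφb _
  have i2 := hP.integrable_pairMoment (p := 2) (by norm_num) (by norm_num)
  have j4 : Integrable (fun q : ℝ × ℝ => γ / r * (1 + |q.1 - q.2| ^ (2 : ℝ))) (pairMeasure g) :=
    ((integrable_const 1).fun_add i2).const_mul _
  have jJ : Integrable (fun q : ℝ × ℝ => 2 * φ ((q.1 + q.2) / 2) - (φ q.1 + φ q.2))
      (pairMeasure g) := (j3.const_mul 2).fun_sub (j1.fun_add j2)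
  have hJm : Measurable fun q : ℝ × ℝ => stickyJump φ q.1 q.2 := by
    unfold stickyJump
    have : Measurable fun q : ℝ × ℝ => φ ((q.1 + q.2) / 2) :=
      hφm.comp (g := φ) (f := fun q : ℝ × ℝ => (q.1 + q.2) / 2) (by fun_prop)
    exact ((this.const_mul 2).sub (hφm.comp measurable_fst)).sub (hφm.comp measurable_snd)
  have hle : ∫ q, stickyJump φ q.1 q.2 * |q.1 - q.2| ^ γ ∂(pairMeasure g) ≤
      ∫ q, ((2 * φ ((q.1 + q.2) / 2) - (φ q.1 + φ q.2)) +
        γ / r * (1 + |q.1 - q.2| ^ (2 : ℝ))) ∂(pairMeasure g) := by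
    refine integral_mono ?_ (jJ.fun_add j4) fun q => ?_
    · refine (hP.integrable_abs_sub_rpow h0.le (by linarith [h.lt_one])).bdd_mul (c := 4)
        hJm.aestronglyMeasurable (Filter.Eventually.of_forall fun q => ?_)
      unfold stickyJump
      rw [Real.norm_eq_abs, abs_le]
      have a1 := abs_le.1 (hφb q.1)
      have a2 := abs_le.1 (hφb q.2)
      have a3 := abs_le.1 (hφb ((q.1 + q.2) / 2))
      constructor <;> linarith [a1.1, a1.2, a2.1, a2.2, a3.1, a3.2]
    · set u := |q.1 - q.2| with hu
      have hu0 : 0 ≤ u := abs_nonneg _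
      have b1 := abs_cauchyBump_sub_le hr ((q.1 + q.2) / 2) q.1
      have b2 := abs_cauchyBump_sub_le hr ((q.1 + q.2) / 2) q.2
      have c1 : |(q.1 + q.2) / 2 - q.1| = u / 2 := by
        rw [hu, abs_sub_comm q.1 q.2, ← abs_two, ← abs_div, abs_two]; congr 1; ring
      have c2 : |(q.1 + q.2) / 2 - q.2| = u / 2 := by
        rw [hu, ← abs_two, ← abs_div, abs_two]; congr 1; ring
      rw [c1] at b1
      rw [c2] at b2
      have b3 : |stickyJump φ q.1 q.2| ≤ 1 / r * u := by
        unfold stickyJump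
        rw [abs_le] at b1 b2 ⊢
        constructor <;> linarith [b1.1, b1.2, b2.1, b2.2]
      have b4 := mul_abs_rpow_sub_one_le h0.le h.lt_one.le hu0
      have b5 : stickyJump φ q.1 q.2 * (u ^ γ - 1) ≤ γ / r * (1 + u ^ (2 : ℝ)) := by
        calc stickyJump φ q.1 q.2 * (u ^ γ - 1) ≤ |stickyJump φ q.1 q.2| * |u ^ γ - 1| := by
              rw [← abs_mul]; exact le_abs_self _
          _ ≤ 1 / r * u * |u ^ γ - 1| := by gcongr
          _ = 1 / r * (u * |u ^ γ - 1|) := by ring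
          _ ≤ 1 / r * (γ * (1 + u ^ 2)) := by gcongr
          _ = _ := by rw [Real.rpow_two]; ring
      have e : stickyJump φ q.1 q.2 = 2 * φ ((q.1 + q.2) / 2) - (φ q.1 + φ q.2) := by
        unfold stickyJump; ring
      change stickyJump φ q.1 q.2 * u ^ γ ≤ _
      rw [← e]
      linarith
  rw [integral_add jJ j4, integral_sub (j3.const_mul 2) (j1.fun_add j2), integral_const_mul,
    integral_add j1 j2, hP.integral_fst φ, hP.integral_snd φ, integral_const_mul,
    integral_add (integrable_const _) i2, integral_const, probReal_univ, one_smul] at hle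
  change _ ≤ _ + γ / r * (1 + pairMoment g 2) at hle
  have hN := hP.pairMoment_two_le_one h0 h.lt_one
  have : γ / r * (1 + pairMoment g 2) ≤ γ / r * 2 := by
    have : 0 ≤ γ / r := by positivity
    gcongr
    linarith
  linarith

/-- Either both points lie within ρ of the origin, which has probability `massNear g ρ ^ 2`, or one
lies where g ≤ 8/ρ. In the latter case, integrating the bump in that variable alone gives at most
(8/ρ) · 2πr; the factor 2 counts the choice of variable. -/
theorem integral_bump_midpoint_le (h : GoodProfile γ g) {r ρ : ℝ} (hr : 0 < r) (hρ : 0 < ρ) :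
    ∫ q, cauchyBump r ((q.1 + q.2) / 2) ∂(pairMeasure g) ≤
      massNear g ρ ^ 2 + 2 * (8 / ρ * (2 * (r * Real.pi))) := by
  have hpr := h.isProbabilityMeasure
  set φ := cauchyBump r with hφ
  have hφm : Measurable φ := (continuous_cauchyBump hr).measurable
  set S : Set ℝ := (Set.Ioo (-ρ) ρ)ᶜ with hS
  have hSm : MeasurableSet S := measurableSet_Ioo.compl
  set χ : ℝ → ℝ := (Set.Ioo (-ρ) ρ).indicator 1 with hχ
  set χ' : ℝ → ℝ := S.indicator 1 with hχ'
  have hχm : Measurable χ := measurable_one.indicator measurableSet_Ioo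
  have hχm' : Measurable χ' := measurable_one.indicator hSm
  have hmid : Measurable fun q : ℝ × ℝ => φ ((q.1 + q.2) / 2) :=
    hφm.comp (g := φ) (f := fun q : ℝ × ℝ => (q.1 + q.2) / 2) (by fun_prop)
  have hφ0 : ∀ x, 0 ≤ φ x := cauchyBump_nonneg r
  have hφ1 : ∀ x, φ x ≤ 1 := cauchyBump_le_one r
  have hχ0 : ∀ x, 0 ≤ χ x := fun x => Set.indicator_nonneg (fun _ _ => zero_le_one) x
  have hχ1 : ∀ x, χ x ≤ 1 := fun x => Set.indicator_le_self' (fun _ _ => zero_le_one) x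
  have hχ0' : ∀ x, 0 ≤ χ' x := fun x => Set.indicator_nonneg (fun _ _ => zero_le_one) x
  have hχ1' : ∀ x, χ' x ≤ 1 := fun x => Set.indicator_le_self' (fun _ _ => zero_le_one) x
  have hχχ : ∀ x, χ x + χ' x = 1 := fun x => by
    rw [hχ, hχ', hS]
    simp
  have k1 : Integrable (fun q : ℝ × ℝ => χ q.1 * χ q.2) (pairMeasure g) :=
    h.integrable_pair_of_bounded (C := 1)
      ((hχm.comp measurable_fst).mul (hχm.comp measurable_snd)) fun q => by
        rw [abs_of_nonneg (mul_nonneg (hχ0 _) (hχ0 _))]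
        exact mul_le_one₀ (hχ1 _) (hχ0 _) (hχ1 _)
  have k2 : Integrable (fun q : ℝ × ℝ => χ' q.1 * φ ((q.1 + q.2) / 2)) (pairMeasure g) :=
    h.integrable_pair_of_bounded (C := 1)
      ((hχm'.comp measurable_fst).mul hmid) fun q => by
        rw [abs_of_nonneg (mul_nonneg (hχ0' _) (hφ0 _))]
        exact mul_le_one₀ (hχ1' _) (hφ0 _) (hφ1 _)
  have k3 : Integrable (fun q : ℝ × ℝ => χ' q.2 * φ ((q.1 + q.2) / 2)) (pairMeasure g) :=
    h.integrable_pair_of_bounded (C := 1)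
      ((hχm'.comp measurable_snd).mul hmid) fun q => by
        rw [abs_of_nonneg (mul_nonneg (hχ0' _) (hφ0 _))]
        exact mul_le_one₀ (hχ1' _) (hφ0 _) (hφ1 _)
  have hle : ∫ q, φ ((q.1 + q.2) / 2) ∂(pairMeasure g) ≤
      ∫ q, (χ q.1 * χ q.2 + (χ' q.1 * φ ((q.1 + q.2) / 2) + χ' q.2 * φ ((q.1 + q.2) / 2)))
        ∂(pairMeasure g) := by
    refine integral_mono (h.integrable_pair_of_bounded (C := 1) hmid fun q => ?_)
      (k1.fun_add (k2.fun_add k3)) fun q => ?_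
    · rw [abs_of_nonneg (hφ0 _)]; exact hφ1 _
    · have e : χ' q.1 = 1 - χ q.1 := by linarith [hχχ q.1]
      have e' : χ' q.2 = 1 - χ q.2 := by linarith [hχχ q.2]
      change φ ((q.1 + q.2) / 2) ≤ χ q.1 * χ q.2 +
        (χ' q.1 * φ ((q.1 + q.2) / 2) + χ' q.2 * φ ((q.1 + q.2) / 2))
      rw [e, e']
      set m := φ ((q.1 + q.2) / 2)
      have := hφ0 ((q.1 + q.2) / 2)
      have := hφ1 ((q.1 + q.2) / 2)
      nlinarith [mul_nonneg (hχ0 q.1) (hχ0 q.2), mul_nonneg (sub_nonneg.2 (hχ1 q.1))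
        (sub_nonneg.2 (hχ1 q.2)), mul_nonneg (mul_nonneg (sub_nonneg.2 (hχ1 q.1))
        (sub_nonneg.2 (hχ1 q.2))) (hφ0 ((q.1 + q.2) / 2)),
        mul_nonneg (mul_nonneg (hχ0 q.1) (hχ0 q.2)) (sub_nonneg.2 (hφ1 ((q.1 + q.2) / 2)))]
  rw [integral_add k1 (k2.fun_add k3), integral_add k2 k3] at hle
  have v1 : ∫ q, χ q.1 * χ q.2 ∂(pairMeasure g) = massNear g ρ ^ 2 := by
    have := integral_prod_mul (μ := profileMeasure g) (ν := profileMeasure g) χ χ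
    rw [pairMeasure, this, hχ, integral_indicator_one measurableSet_Ioo, massNear]
    ring
  have hA : ∀ x ∈ S, g x ≤ 8 / ρ := fun x hx => by
    have hx' : ρ ≤ |x| := by
      rw [hS, Set.mem_compl_iff, Set.mem_Ioo, ← abs_lt, not_lt] at hx
      exact hx
    refine (h.le_div_abs (abs_pos.1 (hρ.trans_le hx'))).trans ?_
    gcongr
  have inner : ∀ y, ∫ x, χ' x * φ ((x + y) / 2) ∂(profileMeasure g) ≤
      8 / ρ * (2 * (r * Real.pi)) := fun y => by
    obtain ⟨i1, i2⟩ := integral_cauchyBump_midpoint hr y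
    have e : (fun x => χ' x * φ ((x + y) / 2)) = S.indicator fun x => φ ((x + y) / 2) := by
      funext x
      by_cases hx : x ∈ S
      · simp [hχ', Set.indicator_of_mem hx]
      · simp [hχ', Set.indicator_of_notMem hx]
    rw [e]
    refine (h.integral_indicator_le hSm hA (fun x => hφ0 _) i1.integrableOn).trans ?_
    have : ∫ x in S, φ ((x + y) / 2) ≤ 2 * (r * Real.pi) := by
      rw [← i2]
      exact setIntegral_le_integral i1 (Filter.Eventually.of_forall fun x => hφ0 _)
    gcongr
  have v2 : ∫ q, χ' q.1 * φ ((q.1 + q.2) / 2) ∂(pairMeasure g) ≤ 8 / ρ * (2 * (r * Real.pi)) := by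
    rw [pairMeasure, integral_prod_symm _ k2]
    refine (integral_mono k2.integral_prod_right (integrable_const _) inner).trans ?_
    simp
  have v3 : ∫ q, χ' q.2 * φ ((q.1 + q.2) / 2) ∂(pairMeasure g) ≤ 8 / ρ * (2 * (r * Real.pi)) := by
    rw [pairMeasure, integral_prod _ k3]
    refine (integral_mono (g := fun _ => 8 / ρ * (2 * (r * Real.pi))) k3.integral_prod_left
      (integrable_const _) fun y => ?_).trans ?_
    · have := inner y
      simpa only [add_comm] using this
    · simp
  rw [v1] at hle
  linarith

/-- The recursive control of the mass near the origin. -/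
theorem massNear_step (h : GoodProfile γ g) {r ρ κ : ℝ} (hr : 0 < r) (hρ : 0 < ρ) :
    massNear g (κ * r) ≤ (1 + κ ^ 2) * (massNear g ρ ^ 2 + 128 * (r / ρ) + γ / r) := by
  have hpr := h.isProbabilityMeasure
  have hφi : Integrable (cauchyBump r) (profileMeasure g) :=
    h.integrable_of_bounded (C := 1) (continuous_cauchyBump hr).measurable fun x => by
      rw [abs_of_nonneg (cauchyBump_nonneg r x)]; exact cauchyBump_le_one r x
  -- On |x| < κ r the bump is at least 1/(1 + κ^2). Taking κ small keeps this loss close to 1, as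
  -- the iteration requires.
  have h1 : massNear g (κ * r) ≤ ∫ x, (1 + κ ^ 2) * cauchyBump r x ∂(profileMeasure g) := by
    rw [massNear, ← integral_indicator_one measurableSet_Ioo]
    refine integral_mono (h.integrable_of_bounded (C := 1)
      (measurable_one.indicator measurableSet_Ioo) fun x => abs_indicator_one_le _ x) (hφi.const_mul _) fun x => ?_
    · by_cases hx : x ∈ Set.Ioo (-(κ * r)) (κ * r)
      · simp only [Set.indicator_of_mem hx, Pi.one_apply, cauchyBump]
        have hx2 : x ^ 2 ≤ (κ * r) ^ 2 := by nlinarith [hx.1, hx.2]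
        rw [← mul_div_assoc, one_le_div (by positivity)]
        nlinarith
      · simp only [Set.indicator_of_notMem hx]
        exact mul_nonneg (by positivity) (cauchyBump_nonneg r x)
  rw [integral_const_mul] at h1
  refine h1.trans ?_
  gcongr
  refine (h.integral_bump_le hr).trans ?_
  have h2 := h.integral_bump_midpoint_le hr hρ
  have h3 : 2 * (8 / ρ * (2 * (r * Real.pi))) ≤ 128 * (r / ρ) := by
    have : Real.pi ≤ 4 := Real.pi_le_four
    have e : 2 * (8 / ρ * (2 * (r * Real.pi))) = 32 * (r / ρ) * Real.pi := by ring
    have : 0 ≤ r / ρ := by positivity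
    rw [e]; nlinarith
  linarith

end GoodProfile

/-- The energy bounds prevent all the mass from sitting near the origin. -/
theorem exists_massNear_lt_one :
    ∃ γ₁ > 0, ∃ r > 0, ∃ c > 0, c < 1 ∧ ∀ γ, γ < γ₁ → ∀ g, GoodProfile γ g →
      massNear g r ≤ 1 - c := by
  obtain ⟨γ₁, hγ₁, C, hC, e, he, H⟩ :=
    exists_moment_bounds (s := 5 / 2) (by norm_num) (by norm_num)
  -- Beyond L one has |x|^2 ≤ (e/(4C)) |x|^q, so the tail carries energy at most e/4. The choice r^2
  -- = e/4 limits |x| < r to another e/4, and the remaining e/2 must come from mass in r ≤ |x| ≤ L.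
  set L : ℝ := (4 * C / e) ^ 2 + 1 with hL
  have hL1 : 1 ≤ L := by rw [hL]; nlinarith [sq_nonneg (4 * C / e)]
  set r : ℝ := Real.sqrt (e / 4) with hr
  have hr2 : r ^ 2 = e / 4 := Real.sq_sqrt (by positivity)
  set c : ℝ := min (1 / 2) (e / (2 * L ^ 2)) with hc
  have hc0 : 0 < c := lt_min (by norm_num) (by positivity)
  refine ⟨γ₁, hγ₁, r, Real.sqrt_pos.2 (by positivity), c, hc0,
    (min_le_left _ _).trans_lt (by norm_num), fun γ hγ g h => ?_⟩
  obtain ⟨-, h3, hM, hE⟩ := H γ h.pos hγ g h.profile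
  have hpr := h.isProbabilityMeasure
  have hγ0 := h.pos
  set q := 5 / 2 + γ with hq
  have iq := h.profile.integrable_abs_rpow (p := q) (by linarith) h3
  have i2 := h.profile.integrable_abs_rpow (p := 2) (by norm_num) (by norm_num)
  set S : Set ℝ := (Set.Ioo (-r) r)ᶜ with hS
  have hSm : MeasurableSet S := measurableSet_Ioo.compl
  have iS : Integrable (S.indicator (1 : ℝ → ℝ)) (profileMeasure g) :=
    h.integrable_of_bounded (C := 1) (measurable_one.indicator hSm) fun x =>
      abs_indicator_one_le S x
  have hle : absMoment g 2 ≤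
      ∫ x, (r ^ 2 + L ^ 2 * S.indicator 1 x + e / (4 * C) * |x| ^ q) ∂(profileMeasure g) := by
    refine integral_mono i2 (((integrable_const _).fun_add (iS.const_mul _)).fun_add
      (iq.const_mul _)) fun x => ?_
    have n0 : 0 ≤ L ^ 2 * S.indicator (1 : ℝ → ℝ) x :=
      mul_nonneg (by positivity) (Set.indicator_nonneg (fun _ _ => zero_le_one) x)
    have n1 : 0 ≤ e / (4 * C) * |x| ^ q := by positivity
    have n2 : 0 ≤ r ^ 2 := by positivity
    change |x| ^ (2 : ℝ) ≤ _
    rw [Real.rpow_two]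
    by_cases hx : x ∈ S
    · rcases le_total |x| L with hxL | hxL
      · simp only [Set.indicator_of_mem hx, Pi.one_apply, mul_one]
        have : |x| ^ 2 ≤ L ^ 2 := by gcongr
        linarith
      · have hx1 : 1 ≤ |x| := hL1.trans hxL
        have hx0 : 0 < |x| := by linarith
        have a1 : |x| ^ 2 * (4 * C / e) ≤ |x| ^ q := by
          have a2 : |x| ^ (5 / 2 : ℝ) ≤ |x| ^ q :=
            Real.rpow_le_rpow_of_exponent_le hx1 (by linarith)
          have a3 : |x| ^ (5 / 2 : ℝ) = |x| ^ 2 * Real.sqrt |x| := by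
            rw [Real.sqrt_eq_rpow, ← Real.rpow_natCast, ← Real.rpow_add hx0]; norm_num
          have a4 : 4 * C / e ≤ Real.sqrt |x| := by
            refine Real.le_sqrt_of_sq_le ?_
            linarith
          calc _ ≤ |x| ^ 2 * Real.sqrt |x| := by gcongr
            _ ≤ _ := by rw [← a3]; exact a2
        have a5 : |x| ^ 2 ≤ e / (4 * C) * |x| ^ q := by
          calc |x| ^ 2 = e / (4 * C) * (|x| ^ 2 * (4 * C / e)) := by field_simp
            _ ≤ _ := by gcongr
        linarith
    · have hx' : |x| < r := by
        rw [hS, Set.mem_compl_iff, not_not, Set.mem_Ioo, ← abs_lt] at hx; exact hx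
      have : |x| ^ 2 ≤ r ^ 2 := by gcongr
      linarith
  rw [integral_add ((integrable_const _).fun_add (iS.const_mul _)) (iq.const_mul _),
    integral_add (integrable_const _) (iS.const_mul _), integral_const, probReal_univ,
    integral_const_mul, integral_const_mul, integral_indicator_one hSm, one_smul, hr2] at hle
  change _ ≤ _ + e / (4 * C) * absMoment g q at hle
  have hS1 : (profileMeasure g).real S = 1 - massNear g r := by
    rw [hS, probReal_compl_eq_one_sub measurableSet_Ioo, massNear]
  rw [hS1] at hle
  have b1 : e / (4 * C) * absMoment g q ≤ e / 4 := by
    calc _ ≤ e / (4 * C) * C := by gcongr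
      _ = e / 4 := by field_simp
  have b2 : e / 2 ≤ L ^ 2 * (1 - massNear g r) := by linarith
  have b3 : c ≤ e / (2 * L ^ 2) := min_le_right _ _
  have b4 : e / (2 * L ^ 2) ≤ 1 - massNear g r := by
    rw [div_le_iff₀ (by positivity)]; linarith
  linarith

/-- No mass concentrates at the origin, uniformly for small `γ`. -/
theorem exists_massNear_le {η : ℝ} (hη : 0 < η) :
    ∃ γ₁ > 0, ∃ r > 0, ∀ γ, γ < γ₁ → ∀ g, GoodProfile γ g → massNear g r ≤ η := by
  obtain ⟨γ₀, hγ₀, r₀, hr₀, c, hc, hc1, H⟩ := exists_massNear_lt_one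
  -- Squaring q ≤ 1 - c gains a factor 1 - c, and half of that gain pays for the errors. The radius
  -- and the range of γ shrink at each stage, which is harmless because only finitely many stages
  -- are needed to reach η.
  have key : ∀ n : ℕ, ∃ γ₁ > 0, ∃ r > 0, ∀ γ, γ < γ₁ → ∀ g, GoodProfile γ g →
      massNear g r ≤ (1 - c) * (1 - c / 2) ^ n := by
    intro n
    induction n with
    | zero => exact ⟨γ₀, hγ₀, r₀, hr₀, by simpa using H⟩
    | succ n ih =>
      obtain ⟨γ₁, hγ₁, ρ, hρ, hn⟩ := ih
      set q : ℝ := (1 - c) * (1 - c / 2) ^ n with hq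
      have hb : 0 < 1 - c / 2 := by linarith
      have hq0 : 0 < q := mul_pos (by linarith) (by positivity)
      have hq1 : q ≤ 1 - c :=
        mul_le_of_le_one_right (by linarith) (pow_le_one₀ hb.le (by linarith))
      set κ : ℝ := Real.sqrt (c / 4) with hκ
      have hκ2 : κ ^ 2 = c / 4 := Real.sq_sqrt (by positivity)
      have hκ0 : 0 < κ := Real.sqrt_pos.2 (by positivity)
      -- Makes 128 r/ρ equal to c q/16; the new range of γ makes γ/r at most c q/16 as well.
      set r : ℝ := ρ * (c * q) / 2048 with hr
      have hr0 : 0 < r := by positivity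
      refine ⟨min γ₁ (r * (c * q) / 16), lt_min hγ₁ (by positivity), κ * r, by positivity,
        fun γ hγ g h => ?_⟩
      have hm := hn γ (hγ.trans_le (min_le_left _ _)) g h
      have hγr : γ / r ≤ c * q / 16 := by
        rw [div_le_iff₀ hr0]
        linarith [hγ.trans_le (min_le_right γ₁ (r * (c * q) / 16))]
      have hrρ : r / ρ = c * q / 2048 := by rw [hr]; field_simp
      refine (h.massNear_step hr0 hρ).trans ?_
      rw [hκ2, hrρ]
      have hm2 : massNear g ρ ^ 2 ≤ (1 - c) * q := by
        calc massNear g ρ ^ 2 ≤ q ^ 2 := by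
              gcongr
              exact GoodProfile.massNear_nonneg _ _
          _ ≤ (1 - c) * q := by rw [sq]; gcongr
      calc (1 + c / 4) * (massNear g ρ ^ 2 + 128 * (c * q / 2048) + γ / r)
          ≤ (1 + c / 4) * ((1 - c) * q + 128 * (c * q / 2048) + c * q / 16) := by gcongr
        _ = (1 - c) * q + c * q / 8 + c / 4 * ((1 - c) * q) + c / 32 * (c * q) := by ring
        _ ≤ (1 - c / 2) * q := by
          have t1 : 0 < c * q := by positivity
          have t2 : 0 < c * (c * q) := by positivity
          nlinarith
        _ = (1 - c) * (1 - c / 2) ^ (n + 1) := by rw [hq]; ring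
  obtain ⟨n, hn⟩ := exists_pow_lt_of_lt_one hη (by linarith : 1 - c / 2 < 1)
  obtain ⟨γ₁, hγ₁, r, hr, h⟩ := key n
  refine ⟨γ₁, hγ₁, r, hr, fun γ hγ g hg => (h γ hγ g hg).trans ?_⟩
  have : 0 ≤ (1 - c / 2) ^ n := pow_nonneg (by linarith) n
  nlinarith

/-! ### Uniform boundedness: gain and loss across dyadic windows -/

theorem step_sub_step (w z : ℝ) (hwz : w ≤ z) (x : ℝ) :
    step w x - step z x = (Set.Ioc w z).indicator 1 x := by
  unfold step
  by_cases hx : x ∈ Set.Ioc w z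
  · rw [Set.indicator_of_mem hx, if_pos hx.1, if_neg (not_lt.2 hx.2)]; simp
  · rw [Set.indicator_of_notMem hx]
    rw [Set.mem_Ioc, not_and_or, not_lt, not_le] at hx
    rcases hx with hx | hx
    · rw [if_neg (not_lt.2 hx), if_neg (not_lt.2 (hx.trans hwz))]; simp
    · rw [if_pos hx, if_pos (hwz.trans_lt hx)]; simp

theorem step_sub_step_midpoint (w z : ℝ) (hwz : w ≤ z) (x y : ℝ) :
    step w ((x + y) / 2) - step z ((x + y) / 2) =
      (Set.Ioc (2 * w - y) (2 * z - y)).indicator 1 x := by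
  rw [step_sub_step w z hwz]
  refine Set.indicator_eq_indicator ?_ rfl
  simp only [Set.mem_Ioc]
  constructor <;> rintro ⟨a, b⟩ <;> constructor <;> linarith

theorem one_sub_mul_inv_le_rpow {u γ : ℝ} (hu : 0 < u) (h0 : 0 ≤ γ) (h1 : γ ≤ 1) :
    1 - γ * u⁻¹ ≤ u ^ γ := by
  have hb := rpow_one_add_le_one_add_mul_self (s := u⁻¹ - 1)
    (by linarith [inv_pos.2 hu]) h0 h1
  rw [add_sub_cancel, Real.inv_rpow hu.le] at hb
  have h4 : 0 < u ^ γ := by positivity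
  have h5 : (u ^ γ)⁻¹ ≤ 1 + γ * u⁻¹ := by nlinarith
  have h6 : 0 ≤ γ * u⁻¹ := mul_nonneg h0 (inv_pos.2 hu).le
  have h7 : 1 ≤ u ^ γ * (1 + γ * u⁻¹) := by
    calc 1 = u ^ γ * (u ^ γ)⁻¹ := (mul_inv_cancel₀ h4.ne').symm
      _ ≤ _ := by gcongr
  by_contra hlt
  push Not at hlt
  nlinarith [mul_lt_mul_of_pos_right hlt (by linarith : 0 < 1 + γ * u⁻¹)]

theorem rpow_le_one_add {u γ : ℝ} (hu : 0 ≤ u) (h0 : 0 ≤ γ) (h1 : γ ≤ 1) : u ^ γ ≤ 1 + u := by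
  calc u ^ γ ≤ (1 + u) ^ γ := Real.rpow_le_rpow hu (by linarith) h0
    _ ≤ (1 + u) ^ (1 : ℝ) := Real.rpow_le_rpow_of_exponent_le (by linarith) h1
    _ = 1 + u := Real.rpow_one _

/-- The collision frequency. -/
def collisionRate (γ : ℝ) (g : ℝ → ℝ) (x : ℝ) : ℝ := ∫ y, |x - y| ^ γ ∂(profileMeasure g)

namespace GoodProfile

variable {γ : ℝ} {g : ℝ → ℝ}

theorem integrable_rate (h : GoodProfile γ g) (x : ℝ) :
    Integrable (fun y => |x - y| ^ γ) (profileMeasure g) := by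
  refine h.profile.integrable_of_le (C := (1 + |x|) ^ γ) (s := γ) (by linarith [h.lt_one])
    (by fun_prop) fun y => ?_
  rw [abs_of_nonneg (by positivity)]
  exact abs_sub_rpow_le h.pos.le x y

/-- At least 63/64 of the mass lies outside (-r, r), hence at distance at least r/2 from x, and γ ≤
r/6 ensures (r/2)^γ ≥ 2/3. -/
theorem half_le_rate (h : GoodProfile γ g) {r : ℝ} (hr : 0 < r) (hm : massNear g r ≤ 1 / 64)
    (hγ : γ ≤ r / 6) {x : ℝ} (hx : |x| ≤ r / 2) : 1 / 2 ≤ collisionRate γ g x := by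
  have hpr := h.isProbabilityMeasure
  set S : Set ℝ := (Set.Ioo (-r) r)ᶜ with hS
  have hSm : MeasurableSet S := measurableSet_Ioo.compl
  have iS : Integrable (S.indicator (1 : ℝ → ℝ)) (profileMeasure g) :=
    h.integrable_of_bounded (C := 1) (measurable_one.indicator hSm) fun x =>
      abs_indicator_one_le S x
  have hb : 2 / 3 ≤ (r / 2) ^ γ := by
    refine le_trans ?_ (one_sub_mul_inv_le_rpow (by positivity) h.pos.le h.lt_one.le)
    have : γ * (r / 2)⁻¹ ≤ 1 / 3 := by
      rw [← div_eq_mul_inv, div_le_iff₀ (by positivity)]; linarith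
    linarith
  have hle : ∫ y, (r / 2) ^ γ * S.indicator 1 y ∂(profileMeasure g) ≤ collisionRate γ g x := by
    refine integral_mono (iS.const_mul _) (h.integrable_rate x) fun y => ?_
    by_cases hy : y ∈ S
    · simp only [Set.indicator_of_mem hy, Pi.one_apply, mul_one]
      rw [hS, Set.mem_compl_iff, Set.mem_Ioo, ← abs_lt, not_lt] at hy
      refine Real.rpow_le_rpow (by positivity) ?_ h.pos.le
      have := abs_sub_abs_le_abs_sub y x
      rw [abs_sub_comm] at this
      linarith
    · simp only [Set.indicator_of_notMem hy, mul_zero]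
      positivity
  rw [integral_const_mul, integral_indicator_one hSm, hS,
    probReal_compl_eq_one_sub measurableSet_Ioo] at hle
  change (r / 2) ^ γ * (1 - massNear g r) ≤ _ at hle
  nlinarith

/-- For fixed y, a midpoint in (w, z] confines x to an interval of length 2 (z - w). -/
theorem integral_window_le (h : GoodProfile γ g) {S : Set ℝ} (hS : MeasurableSet S) {A : ℝ}
    (hA0 : 0 ≤ A) (hA : ∀ x ∈ S, g x ≤ A) {w z : ℝ} (hwz : w ≤ z) (y : ℝ) :
    ∫ x, (step w ((x + y) / 2) - step z ((x + y) / 2)) * S.indicator 1 x ∂(profileMeasure g) ≤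
      A * (2 * (z - w)) := by
  set I : Set ℝ := Set.Ioc (2 * w - y) (2 * z - y) with hI
  have e : (fun x => (step w ((x + y) / 2) - step z ((x + y) / 2)) * S.indicator 1 x) =
      (I ∩ S).indicator 1 := by
    funext x
    rw [step_sub_step_midpoint w z hwz, Set.inter_indicator_one, Pi.mul_apply]
  rw [e]
  have hvol : volume I ≠ ⊤ := by simp [hI]
  have hle := h.integral_indicator_le (f := fun _ => (1 : ℝ)) (measurableSet_Ioc.inter hS)
    (fun x hx => hA x hx.2) (fun _ => zero_le_one) (integrableOn_const
      (measure_ne_top_of_subset Set.inter_subset_left hvol))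
  refine hle.trans ?_
  gcongr
  simp only [integral_const, smul_eq_mul, mul_one, measureReal_restrict_apply_univ]
  refine (measureReal_mono Set.inter_subset_left hvol).trans ?_
  rw [hI, Real.volume_real_Ioc]
  exact max_le (by linarith) (by linarith)

/-- A midpoint above w forces one particle, say x, above w ≥ z/2, where g ≤ A. If the other lies in
(-r, r), the kernel is at most 1 since r ≤ 1/4, and the small mass 1/64 gives A z/64. If it lies
outside, its density is at most 8/r while the kernel is at most 2 + 2|x|, giving 32 z/r. Exchanging
the two particles doubles both. -/
theorem gain_window_le (h : GoodProfile γ g) {r : ℝ} (hr : 0 < r) (hr4 : r ≤ 1 / 4)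
    (hm : massNear g r ≤ 1 / 64) {w z A : ℝ} (hz : 0 < z) (hzr : z ≤ r / 2) (hw : z / 2 ≤ w)
    (hwz : w ≤ z) (hA : ∀ x, z / 2 ≤ |x| → g x ≤ A) :
    ∫ q, (step w ((q.1 + q.2) / 2) - step z ((q.1 + q.2) / 2)) * |q.1 - q.2| ^ γ
      ∂(pairMeasure g) ≤ A * z / 32 + 64 * (z / r) := by
  have hpr := h.isProbabilityMeasure
  have h0 := h.pos
  have hA0 : 0 ≤ A := (h.nonneg z).trans (hA z (by rw [abs_of_pos hz]; linarith))
  set N : Set ℝ := Set.Ioo (-r) r with hN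
  have hNm : MeasurableSet N := measurableSet_Ioo
  set U : Set ℝ := Set.Ioi w with hU
  have hUm : MeasurableSet U := measurableSet_Ioi
  set J : ℝ × ℝ → ℝ := fun q => step w ((q.1 + q.2) / 2) - step z ((q.1 + q.2) / 2) with hJ
  have hJm : Measurable J :=
    (measurable_step.comp (measurable_const.prodMk
      (g := fun q : ℝ × ℝ => (q.1 + q.2) / 2) (by fun_prop))).sub
    (measurable_step.comp (measurable_const.prodMk
      (g := fun q : ℝ × ℝ => (q.1 + q.2) / 2) (by fun_prop)))
  have hJswap : ∀ x y, J (x, y) = J (y, x) := fun x y => by simp only [hJ, add_comm]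
  have hJI : ∀ q, J q = (Set.Ioc w z).indicator 1 ((q.1 + q.2) / 2) := fun q =>
    step_sub_step w z hwz _
  have hJ0 : ∀ q, 0 ≤ J q := fun q => by
    rw [hJI]; exact Set.indicator_nonneg (fun _ _ => zero_le_one) _
  have hJ1 : ∀ q, |J q| ≤ 1 := fun q => by rw [hJI]; exact abs_indicator_one_le _ _
  have iabs : Integrable (fun x : ℝ => 2 + 2 * |x|) (profileMeasure g) :=
    h.profile.integrable_of_le (C := 2) (s := 1) (by norm_num) (by fun_prop) fun x => by
      rw [abs_of_nonneg (by positivity), Real.rpow_one]; linarith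
  set P1 : ℝ × ℝ → ℝ := fun q => J q * U.indicator 1 q.1 * N.indicator 1 q.2 with hP1
  set P2 : ℝ × ℝ → ℝ := fun q => J q * (Nᶜ).indicator 1 q.2 * (2 + 2 * |q.1|) with hP2
  have hP1m : Measurable P1 := (hJm.mul ((measurable_one.indicator hUm).comp measurable_fst)).mul
    ((measurable_one.indicator hNm).comp measurable_snd)
  have i1 : Integrable P1 (pairMeasure g) := by
    refine h.integrable_pair_of_bounded (C := 1) hP1m fun q => ?_
    rw [hP1, abs_mul, abs_mul]
    exact mul_le_one₀ (mul_le_one₀ (hJ1 q) (abs_nonneg _) (abs_indicator_one_le U _))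
      (abs_nonneg _) (abs_indicator_one_le N _)
  have i2 : Integrable P2 (pairMeasure g) := by
    refine (h.profile.integrable_fst iabs).bdd_mul (c := 1)
      (hJm.mul ((measurable_one.indicator hNm.compl).comp measurable_snd)).aestronglyMeasurable
      (Filter.Eventually.of_forall fun q => ?_)
    rw [Real.norm_eq_abs, abs_mul]
    exact mul_le_one₀ (hJ1 q) (abs_nonneg _) (abs_indicator_one_le _ _)
  have i1' : Integrable (fun q : ℝ × ℝ => P1 q.swap) (pairMeasure g) := i1.swap
  have i2' : Integrable (fun q : ℝ × ℝ => P2 q.swap) (pairMeasure g) := i2.swap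
  have hle : ∫ q, J q * |q.1 - q.2| ^ γ ∂(pairMeasure g) ≤
      ∫ q, ((P1 q + P1 q.swap) + (P2 q + P2 q.swap)) ∂(pairMeasure g) := by
    have iW := h.profile.integrable_abs_sub_rpow h0.le (by linarith [h.lt_one])
    refine integral_mono (iW.bdd_mul (c := 1) hJm.aestronglyMeasurable
      (Filter.Eventually.of_forall hJ1)) ((i1.fun_add i1').fun_add (i2.fun_add i2')) ?_
    have key : ∀ x y, w < x → J (x, y) * |x - y| ^ γ ≤ P1 (x, y) + P2 (x, y) := by
      intro x y hx
      have n1 : 0 ≤ P1 (x, y) := mul_nonneg (mul_nonneg (hJ0 _)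
        (Set.indicator_nonneg (fun _ _ => zero_le_one) _))
        (Set.indicator_nonneg (fun _ _ => zero_le_one) _)
      have n2 : 0 ≤ P2 (x, y) := mul_nonneg (mul_nonneg (hJ0 _)
        (Set.indicator_nonneg (fun _ _ => zero_le_one) _)) (by positivity)
      by_cases hm : (x + y) / 2 ∈ Set.Ioc w z
      · have hJe : J (x, y) = 1 := by rw [hJI]; simp only [Set.indicator_of_mem hm, Pi.one_apply]
        have hx0 : 0 < x := by linarith
        by_cases hy : y ∈ N
        · have e : P1 (x, y) = 1 := by
            simp only [hP1, hJe, Set.indicator_of_mem (show x ∈ U from hx),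
              Set.indicator_of_mem hy, Pi.one_apply, mul_one]
          have : |x - y| ^ γ ≤ 1 := by
            refine Real.rpow_le_one (abs_nonneg _) ?_ h0.le
            rw [abs_le]
            constructor <;> linarith [hm.1, hm.2, hy.1, hy.2]
          rw [hJe, e]; linarith
        · have e : P2 (x, y) = 2 + 2 * |x| := by
            simp only [hP2, hJe, Set.indicator_of_mem (show y ∈ Nᶜ from hy), Pi.one_apply, mul_one,
              one_mul]
          have h2 := rpow_le_one_add (abs_nonneg (x - y)) h0.le h.lt_one.le
          have h3 : |x - y| ≤ 1 + 2 * |x| := by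
            rw [abs_of_pos hx0, abs_le]
            constructor <;> linarith [hm.1, hm.2]
          rw [hJe, e]; linarith
      · have hJe : J (x, y) = 0 := by rw [hJI]; exact Set.indicator_of_notMem hm _
        rw [hJe]; linarith
    have hP1n : ∀ q, 0 ≤ P1 q := fun q => mul_nonneg (mul_nonneg (hJ0 _)
        (Set.indicator_nonneg (fun _ _ => zero_le_one) _))
        (Set.indicator_nonneg (fun _ _ => zero_le_one) _)
    have hP2n : ∀ q, 0 ≤ P2 q := fun q => mul_nonneg (mul_nonneg (hJ0 _)
        (Set.indicator_nonneg (fun _ _ => zero_le_one) _)) (by positivity)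
    rintro ⟨x, y⟩
    change J (x, y) * |x - y| ^ γ ≤ P1 (x, y) + P1 (y, x) + (P2 (x, y) + P2 (y, x))
    have a1 := hP1n (x, y)
    have a2 := hP1n (y, x)
    have a3 := hP2n (x, y)
    have a4 := hP2n (y, x)
    by_cases hx : w < x
    · linarith [key x y hx]
    · by_cases hy : w < y
      · have := key y x hy
        rw [hJswap y x, abs_sub_comm] at this
        linarith
      · have : J (x, y) = 0 := by
          rw [hJI]
          refine Set.indicator_of_notMem (fun hm => ?_) _
          have := hm.1
          simp only at this
          linarith
        rw [this]; linarith
  have s1 : ∫ q, P1 q.swap ∂(pairMeasure g) = ∫ q, P1 q ∂(pairMeasure g) := integral_prod_swap _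
  have s2 : ∫ q, P2 q.swap ∂(pairMeasure g) = ∫ q, P2 q ∂(pairMeasure g) := integral_prod_swap _
  rw [integral_add (i1.fun_add i1') (i2.fun_add i2'), integral_add i1 i1', integral_add i2 i2',
    s1, s2] at hle
  have v1 : ∫ q, P1 q ∂(pairMeasure g) ≤ A * z / 64 := by
    have inner : ∀ y, ∫ x, P1 (x, y) ∂(profileMeasure g) ≤ A * z * N.indicator 1 y := fun y => by
      simp only [hP1, integral_mul_const]
      have hn : 0 ≤ N.indicator (1 : ℝ → ℝ) y := Set.indicator_nonneg (fun _ _ => zero_le_one) _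
      refine mul_le_mul_of_nonneg_right ?_ hn
      refine (h.integral_window_le hUm hA0 (fun x hx => hA x ?_) hwz y).trans ?_
      · have : w < x := hx
        rw [abs_of_pos (by linarith)]; linarith
      · gcongr; linarith
    rw [pairMeasure, integral_prod_symm _ i1]
    refine (integral_mono i1.integral_prod_right ((h.integrable_of_bounded (C := 1)
      (measurable_one.indicator hNm) fun x => abs_indicator_one_le N x).const_mul (A * z))
      inner).trans ?_
    rw [integral_const_mul, integral_indicator_one hNm]
    change A * z * massNear g r ≤ _
    have : 0 ≤ A * z := by positivity
    nlinarith
  have v2 : ∫ q, P2 q ∂(pairMeasure g) ≤ 32 * (z / r) := by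
    have inner : ∀ x, ∫ y, P2 (x, y) ∂(profileMeasure g) ≤ 8 / r * z * (2 + 2 * |x|) :=
      fun x => by
      simp only [hP2, integral_mul_const]
      refine mul_le_mul_of_nonneg_right ?_ (by positivity)
      have := h.integral_window_le (S := Nᶜ) hNm.compl (A := 8 / r) (by positivity)
        (fun y hy => ?_) hwz x
      · simp only [add_comm _ x] at this
        refine this.trans ?_
        gcongr; linarith
      · have hy' : r ≤ |y| := by
          rw [hN, Set.mem_compl_iff, Set.mem_Ioo, ← abs_lt, not_lt] at hy
          exact hy
        refine (h.le_div_abs (abs_pos.1 (hr.trans_le hy'))).trans ?_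
        gcongr
    rw [pairMeasure, integral_prod _ i2]
    refine (integral_mono i2.integral_prod_left (iabs.const_mul (8 / r * z)) inner).trans ?_
    have ia : Integrable (fun x : ℝ => |x|) (profileMeasure g) := by
      simpa using h.profile.integrable_abs_rpow (p := 1) (by norm_num) (by norm_num)
    have hM1 := h.absMoment_le_one (p := 1) (by norm_num) (by norm_num)
    simp only [absMoment, Real.rpow_one] at hM1
    rw [integral_const_mul, integral_add (integrable_const _) (ia.const_mul _), integral_const,
      probReal_univ, one_smul, integral_const_mul]
    calc 8 / r * z * (2 + 2 * ∫ x, |x| ∂(profileMeasure g)) ≤ 8 / r * z * (2 + 2 * 1) := by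
          gcongr
      _ = 32 * (z / r) := by ring
  linarith

theorem loss_window_ge (h : GoodProfile γ g) {r : ℝ} (hr : 0 < r) (hm : massNear g r ≤ 1 / 64)
    (hγ : γ ≤ r / 6) {w z a : ℝ} (hw : 0 ≤ w) (hzr : z ≤ r / 2) (hwz : w ≤ z)
    (ha : ∀ x ∈ Set.Ioc w z, a ≤ g x) :
    a * (z - w) / 2 ≤ ∫ q, (step w q.1 - step z q.1) * |q.1 - q.2| ^ γ ∂(pairMeasure g) := by
  have hpr := h.isProbabilityMeasure
  have iW := h.profile.integrable_abs_sub_rpow h.pos.le (by linarith [h.lt_one])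
  set I := Set.Ioc w z with hI
  have hIm : MeasurableSet I := measurableSet_Ioc
  have i1 : Integrable (fun q : ℝ × ℝ => I.indicator (1 : ℝ → ℝ) q.1 * |q.1 - q.2| ^ γ)
      (pairMeasure g) := iW.bdd_mul (c := 1)
    ((measurable_one.indicator hIm).comp measurable_fst).aestronglyMeasurable
    (Filter.Eventually.of_forall fun q => abs_indicator_one_le I _)
  simp only [step_sub_step w z hwz, ← hI]
  rw [pairMeasure, integral_prod _ i1]
  have hle : ∫ x, 1 / 2 * I.indicator 1 x ∂(profileMeasure g) ≤
      ∫ x, ∫ y, I.indicator (1 : ℝ → ℝ) x * |x - y| ^ γ ∂(profileMeasure g)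
        ∂(profileMeasure g) := by
    refine integral_mono ((h.integrable_of_bounded (C := 1) (measurable_one.indicator hIm)
      fun x => abs_indicator_one_le I x).const_mul _) i1.integral_prod_left fun x => ?_
    simp only [integral_const_mul]
    by_cases hx : x ∈ I
    · simp only [Set.indicator_of_mem hx, Pi.one_apply, mul_one, one_mul]
      refine h.half_le_rate hr hm hγ ?_
      rw [abs_of_nonneg (by linarith [hx.1])]; linarith [hx.2]
    · simp [Set.indicator_of_notMem hx]
  refine le_trans ?_ hle
  rw [integral_const_mul, h.integral_measure]
  have hle2 : ∫ x, a * I.indicator 1 x ≤ ∫ x, g x * I.indicator 1 x := by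
    have i2 : Integrable (I.indicator (1 : ℝ → ℝ)) :=
      (integrable_indicator_iff hIm).2 (integrableOn_const (by simp [hI]))
    refine integral_mono (i2.const_mul a) ((h.profile.integrable_measure_iff _).1
      (h.integrable_of_bounded (C := 1) (measurable_one.indicator hIm)
        fun x => abs_indicator_one_le I x)) fun x => ?_
    by_cases hx : x ∈ I
    · simpa only [Set.indicator_of_mem hx, Pi.one_apply, mul_one] using ha x hx
    · simp [Set.indicator_of_notMem hx]
  rw [integral_const_mul, integral_indicator_one hIm, hI, Real.volume_real_Ioc_of_le hwz] at hle2
  linarith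

/-- Compares z g(z) with w g(w) through the flux increment. If some w in [z/2, z] has g(w) ≤ A/4,
dropping the loss gives 1/4 + 1/8 = 3/8. Otherwise g > A/4 on the whole window, and w = z/2 with the
resulting loss gives 1/2 + 1/8 - 1/4 = 3/8. -/
theorem sup_step_pos (h : GoodProfile γ g) {r : ℝ} (hr : 0 < r) (hr4 : r ≤ 1 / 4)
    (hm : massNear g r ≤ 1 / 64) (hγ : γ ≤ r / 6) {z A : ℝ} (hz : 0 < z) (hzr : z ≤ r / 2)
    (hA : ∀ x, z / 2 ≤ |x| → g x ≤ A) : g z ≤ 3 / 8 * A + 256 / r := by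
  have hA0 : 0 ≤ A := (h.nonneg z).trans (hA z (by rw [abs_of_pos hz]; linarith))
  have main : ∀ w, z / 2 ≤ w → w ≤ z → ∀ L, L ≤ ∫ q, (step w q.1 - step z q.1) *
      |q.1 - q.2| ^ γ ∂(pairMeasure g) → z * g z ≤ w * g w + A * z / 8 + 256 * (z / r) - 4 * L := by
    intro w hw hwz L hL
    have f1 := h.flux_sub w z
    have f2 := h.gain_window_le hr hr4 hm hz hzr hw hwz hA
    have f3 := h.flux z hz.ne'
    have f4 := h.flux w (by linarith : 0 < w).ne'
    linarith
  have fin : z * g z ≤ z * (3 / 8 * A + 256 / r) → g z ≤ 3 / 8 * A + 256 / r := fun hh =>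
    le_of_mul_le_mul_left hh hz
  have e : z * (3 / 8 * A + 256 / r) = A * z * (3 / 8) + 256 * (z / r) := by ring
  refine fin ?_
  rw [e]
  by_cases hcase : ∃ w, z / 2 ≤ w ∧ w ≤ z ∧ g w ≤ A / 4
  · obtain ⟨w, hw, hwz, hgw⟩ := hcase
    have := main w hw hwz (0 * (z - w) / 2)
      (h.loss_window_ge hr hm hγ (by linarith) hzr hwz fun x _ => h.nonneg x)
    have h2 : w * g w ≤ z * (A / 4) := mul_le_mul hwz hgw (h.nonneg w) hz.le
    linarith
  · push Not at hcase
    have := main (z / 2) le_rfl (by linarith) (A / 4 * (z - z / 2) / 2)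
      (h.loss_window_ge hr hm hγ (by linarith) hzr (by linarith) fun x hx =>
        (hcase x hx.1.le hx.2).le)
    have h2 : z / 2 * g (z / 2) ≤ z / 2 * A := by
      gcongr
      exact hA _ (le_abs_self _)
    linarith

theorem massNear_reflect (h : GoodProfile γ g) (r : ℝ) :
    massNear (fun x => g (-x)) r = massNear g r := by
  unfold massNear
  rw [← integral_indicator_one measurableSet_Ioo, ← integral_indicator_one measurableSet_Ioo,
    h.reflect.integral_measure, h.integral_measure,
    ← integral_neg_eq_self (fun x => g x * (Set.Ioo (-r) r).indicator 1 x) volume]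
  congr 1
  funext x
  congr 1
  refine Set.indicator_eq_indicator ?_ rfl
  simp only [Set.mem_Ioo]
  constructor <;> rintro ⟨a, b⟩ <;> constructor <;> linarith

theorem sup_step (h : GoodProfile γ g) {r : ℝ} (hr : 0 < r) (hr4 : r ≤ 1 / 4)
    (hm : massNear g r ≤ 1 / 64) (hγ : γ ≤ r / 6) {z A : ℝ} (hz : z ≠ 0)
    (hA : ∀ x, |z| / 2 ≤ |x| → g x ≤ A) : g z ≤ 3 / 8 * A + 256 / r := by
  have hA0 : 0 ≤ A := (h.nonneg z).trans (hA z (by linarith [abs_nonneg z]))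
  rcases le_total |z| (r / 2) with hzr | hzr
  · rcases lt_or_gt_of_ne hz with hneg | hpos
    · rw [abs_of_neg hneg] at hA hzr
      have := h.reflect.sup_step_pos hr hr4 (by rwa [h.massNear_reflect]) hγ (z := -z)
        (by linarith) hzr fun x hx => hA (-x) (by rwa [abs_neg])
      simpa using this
    · rw [abs_of_pos hpos] at hA hzr
      exact h.sup_step_pos hr hr4 hm hγ hpos hzr hA
  · refine (h.le_div_abs hz).trans ?_
    have : 8 / |z| ≤ 8 / (r / 2) := by gcongr
    have e : 8 / (r / 2) = 16 * (1 / r) := by ring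
    have e2 : 256 / r = 256 * (1 / r) := by ring
    have : 0 < 1 / r := by positivity
    rw [e2]; linarith

/-- The uniform bound. -/
theorem bounded (h : GoodProfile γ g) {r : ℝ} (hr : 0 < r) (hr4 : r ≤ 1 / 4)
    (hm : massNear g r ≤ 1 / 64) (hγ : γ ≤ r / 6) {x : ℝ} (hx : x ≠ 0) : g x ≤ 512 / r := by
  -- Halving the radius doubles the singular part, and 2 · 3/8 = 3/4 < 1. The constant part is
  -- stable because (3/8) · 512 + 256 = 448 ≤ 512.
  have key : ∀ n : ℕ, ∀ x, x ≠ 0 → g x ≤ 8 * (3 / 4) ^ n / |x| + 512 / r := by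
    intro n
    induction n with
    | zero =>
      intro x hx
      have := h.le_div_abs hx
      have : 0 < 512 / r := by positivity
      rw [pow_zero, mul_one]; linarith
    | succ n ih =>
      intro x hx
      have hx0 := abs_pos.2 hx
      have := h.sup_step hr hr4 hm hγ hx (A := 8 * (3 / 4) ^ n / (|x| / 2) + 512 / r)
        fun y hy => by
          have hy0 : 0 < |y| := by linarith
          refine (ih y (abs_pos.1 hy0)).trans ?_
          gcongr
      refine this.trans ?_
      have e : 3 / 8 * (8 * (3 / 4) ^ n / (|x| / 2) + 512 / r) + 256 / r =
        8 * (3 / 4) ^ (n + 1) / |x| + 448 / r := by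
        rw [pow_succ]; field_simp; ring
      rw [e]
      gcongr
      norm_num
  have hlim : Filter.Tendsto (fun n : ℕ => 8 * (3 / 4 : ℝ) ^ n / |x| + 512 / r) Filter.atTop
      (nhds (8 * 0 / |x| + 512 / r)) :=
    (((tendsto_pow_atTop_nhds_zero_of_lt_one (by norm_num) (by norm_num)).const_mul 8).div_const
      _).add_const _
  have := ge_of_tendsto' hlim fun n => key n x hx
  simpa using this

end GoodProfile

/-! ### Uniform polynomial decay -/

theorem one_add_abs_rpow_neg_le_one {s : ℝ} (hs : 0 ≤ s) (x : ℝ) : (1 + |x|) ^ (-s) ≤ 1 :=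
  Real.rpow_le_one_of_one_le_of_nonpos (by linarith [abs_nonneg x]) (by linarith)

theorem integrable_one_add_abs {s : ℝ} (hs : 1 < s) :
    Integrable fun x : ℝ => (1 + |x|) ^ (-s) := by
  have := integrable_one_add_norm (E := ℝ) (μ := volume) (r := s) (by simpa using hs)
  simpa [Real.norm_eq_abs] using this

/-- The pointwise bound `g ≤ C (1 + |x|) ^ (-(1 + s))`. -/
def HasDecay (C s : ℝ) (g : ℝ → ℝ) : Prop := ∀ x, g x ≤ C * (1 + |x|) ^ (-(1 + s))

/-- Uniform pointwise decay of the profiles. -/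
theorem exists_decay {s : ℝ} (hs : 2 < s) (hs3 : s < 3) :
    ∃ γ₁ > 0, ∃ C > 0, ∀ γ, γ < γ₁ → ∀ g, GoodProfile γ g → HasDecay C s g := by
  obtain ⟨γ₁, hγ₁, C, hC, e, he, H⟩ := exists_moment_bounds hs hs3
  obtain ⟨γ₂, hγ₂, r₀, hr₀, H'⟩ := exists_massNear_le (η := 1 / 64) (by norm_num)
  set r := min r₀ (1 / 4) with hr
  have hr0 : 0 < r := lt_min hr₀ (by norm_num)
  -- The first term bounds |x|^(1+s) g for |x| ≥ 1, using that the moment of order s is at most 1 +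
  -- C; the second bounds g for |x| ≤ 1. The further factor 16 covers 2^(1+s) when passing to the
  -- weight 1 + |x|.
  set D : ℝ := 4 * (C + (1 + C)) + 512 / r with hD
  have hD0 : 0 < D := by positivity
  refine ⟨min γ₁ (min γ₂ (r / 6)), lt_min hγ₁ (lt_min hγ₂ (by positivity)), 16 * D, by positivity,
    fun γ hγ g h x => ?_⟩
  have g1 : γ < γ₁ := hγ.trans_le (min_le_left _ _)
  have g2 : γ < γ₂ := hγ.trans_le ((min_le_right _ _).trans (min_le_left _ _))
  have g3 : γ < r / 6 := hγ.trans_le ((min_le_right _ _).trans (min_le_right _ _))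
  have h0 := h.pos
  obtain ⟨-, hsγ, hM, -⟩ := H γ h.pos g1 g h.profile
  have hpr := h.isProbabilityMeasure
  have hm : massNear g r ≤ 1 / 64 := (h.massNear_mono (min_le_left _ _)).trans (H' γ g2 g h)
  rcases eq_or_ne x 0 with rfl | hx
  · rw [h.map_zero]; positivity
  have key : ∀ t : ℝ, 0 < t → 1 + |x| ≤ 2 * t → t ^ (-(1 + s)) ≤ 16 * (1 + |x|) ^ (-(1 + s)) := by
    intro t ht hxt
    have e1 : (16 : ℝ) = 2 ^ (4 : ℝ) := by norm_num
    calc t ^ (-(1 + s)) ≤ ((1 + |x|) / 2) ^ (-(1 + s)) :=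
          Real.rpow_le_rpow_of_nonpos (by positivity) (by linarith) (by linarith)
      _ = 2 ^ (1 + s) * (1 + |x|) ^ (-(1 + s)) := by
          rw [Real.div_rpow (by positivity) (by norm_num), Real.rpow_neg (by norm_num : (0:ℝ) ≤ 2),
            div_inv_eq_mul, mul_comm]
      _ ≤ _ := by
          rw [e1]; gcongr
          · norm_num
          · linarith
  rcases le_total |x| 1 with hx1 | hx1
  · have hb := h.bounded hr0 (min_le_right _ _) hm g3.le hx
    have := key 1 one_pos (by linarith)
    rw [Real.one_rpow] at this
    calc g x ≤ D * 1 := by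
          have : 0 < 4 * (C + (1 + C)) := by positivity
          linarith
      _ ≤ D * (16 * (1 + |x|) ^ (-(1 + s))) := by gcongr
      _ = _ := by ring
  · have hx0 : 0 < |x| := by linarith
    have hd := h.decay (p := s) (by linarith) hsγ hx
    have hMs : absMoment g s ≤ 1 + C := by
      have i1 := h.profile.integrable_abs_rpow (p := s) (by linarith) (by linarith)
      have i2 := h.profile.integrable_abs_rpow (p := s + γ) (by linarith) hsγ
      have hle : absMoment g s ≤ ∫ x, (1 + |x| ^ (s + γ)) ∂(profileMeasure g) := by
        refine integral_mono i1 ((integrable_const _).fun_add i2) fun y => ?_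
        change |y| ^ s ≤ 1 + |y| ^ (s + γ)
        rcases le_total |y| 1 with hy | hy
        · have := Real.rpow_le_one (abs_nonneg y) hy (by linarith : 0 ≤ s)
          have : 0 ≤ |y| ^ (s + γ) := by positivity
          linarith
        · have := Real.rpow_le_rpow_of_exponent_le hy (by linarith : s ≤ s + γ)
          linarith
      rw [integral_add (integrable_const _) i2, integral_const, probReal_univ, one_smul] at hle
      change _ ≤ 1 + absMoment g (s + γ) at hle
      linarith
    have hMγ := h.absMoment_le_one h.pos.le (by linarith [h.lt_one])
    have n1 := IsProfile.absMoment_nonneg g s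
    have n2 := IsProfile.absMoment_nonneg g γ
    have hd' : |x| ^ (1 + s) * g x ≤ D := by
      have : absMoment g s * absMoment g γ ≤ (1 + C) * 1 := by gcongr
      have : 0 < 512 / r := by positivity
      linarith
    calc g x = (|x| ^ (1 + s) * g x) * |x| ^ (-(1 + s)) := by
          rw [mul_right_comm, ← Real.rpow_add hx0]; simp
      _ ≤ D * (16 * (1 + |x|) ^ (-(1 + s))) := by
          gcongr
          exact key |x| hx0 (by linarith)
      _ = _ := by ring

/-! ### Differentiability off the origin -/

/-- The density of the gain term of the collision operator. -/
def gainDensity (γ : ℝ) (g : ℝ → ℝ) (z : ℝ) : ℝ :=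
  2 * ∫ u, g (z + u) * g (z - u) * |2 * u| ^ γ

/-- The derivative of a profile away from the origin. -/
def profileDeriv (γ : ℝ) (g : ℝ → ℝ) (x : ℝ) : ℝ :=
  (4 * gainDensity γ g x - (4 * collisionRate γ g x + 1) * g x) / x

theorem rpow_two_mul_le {γ : ℝ} (h0 : 0 ≤ γ) (h1 : γ ≤ 1) (z u : ℝ) :
    |2 * u| ^ γ ≤ (1 + |z + u|) * (1 + |z - u|) := by
  refine (rpow_le_one_add (abs_nonneg _) h0 h1).trans (le_trans ?_ (one_add_abs_le_mul _ _))
  have : 2 * u = (z + u) - (z - u) := by ring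
  rw [this]
  linarith [abs_sub (z + u) (z - u)]

theorem one_add_abs_le_mul_shift (z u : ℝ) : 1 + |u| ≤ (1 + |z|) * (1 + |z + u|) := by
  refine le_trans ?_ (one_add_abs_le_mul _ _)
  have : u = (z + u) - z := by ring
  have h := abs_sub (z + u) z
  rw [← this] at h
  linarith

/-- A form of Peetre's inequality. -/
theorem shift_rpow_neg_le {s : ℝ} (hs : 0 ≤ s) (z u : ℝ) :
    (1 + |z + u|) ^ (-s) ≤ (1 + |z|) ^ s * (1 + |u|) ^ (-s) := by
  have p1 : 0 < 1 + |z + u| := by positivity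
  have p2 : 0 < 1 + |z| := by positivity
  have p3 : 0 < 1 + |u| := by positivity
  rw [Real.rpow_neg p1.le, Real.rpow_neg p3.le, ← div_eq_mul_inv, inv_eq_one_div,
    div_le_div_iff₀ (by positivity) (by positivity), one_mul, ← Real.mul_rpow p2.le p1.le]
  exact Real.rpow_le_rpow p3.le (one_add_abs_le_mul_shift z u) hs

namespace GoodProfile

variable {γ C s : ℝ} {g : ℝ → ℝ}

theorem weighted_le (hd : HasDecay C s g) (x : ℝ) : (1 + |x|) * g x ≤ C * (1 + |x|) ^ (-s) := by
  have p : 0 < 1 + |x| := by positivity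
  calc (1 + |x|) * g x ≤ (1 + |x|) * (C * (1 + |x|) ^ (-(1 + s))) := by gcongr; exact hd x
    _ = C * ((1 + |x|) ^ (1 : ℝ) * (1 + |x|) ^ (-(1 + s))) := by rw [Real.rpow_one]; ring
    _ = _ := by rw [← Real.rpow_add p]; congr 2; ring

theorem gain_integrand_nonneg (h : GoodProfile γ g) (z u : ℝ) :
    0 ≤ g (z + u) * g (z - u) * |2 * u| ^ γ :=
  mul_nonneg (mul_nonneg (h.nonneg _) (h.nonneg _)) (by positivity)

theorem gain_integrand_le (h : GoodProfile γ g) (z u : ℝ) :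
    g (z + u) * g (z - u) * |2 * u| ^ γ ≤
      ((1 + |z + u|) * g (z + u)) * ((1 + |z - u|) * g (z - u)) := by
  have := rpow_two_mul_le h.pos.le h.lt_one.le z u
  have n := mul_nonneg (h.nonneg (z + u)) (h.nonneg (z - u))
  calc _ ≤ g (z + u) * g (z - u) * ((1 + |z + u|) * (1 + |z - u|)) := by gcongr
    _ = _ := by ring

theorem gain_integrand_le_shift (h : GoodProfile γ g) (hs : 0 ≤ s) (hC : 0 ≤ C)
    (hd : HasDecay C s g) (z u : ℝ) :
    g (z + u) * g (z - u) * |2 * u| ^ γ ≤ C * ((1 + |z|) ^ s * (1 + |u|) ^ (-s)) * C := by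
  refine (h.gain_integrand_le z u).trans ?_
  have a1 := weighted_le hd (z + u)
  have a2 := weighted_le hd (z - u)
  have a3 := one_add_abs_rpow_neg_le_one hs (z - u)
  have a4 := shift_rpow_neg_le hs z u
  have n := mul_nonneg (by positivity : 0 ≤ 1 + |z - u|) (h.nonneg (z - u))
  calc _ ≤ (C * (1 + |z + u|) ^ (-s)) * (C * (1 + |z - u|) ^ (-s)) := by gcongr
    _ ≤ (C * ((1 + |z|) ^ s * (1 + |u|) ^ (-s))) * (C * 1) := by gcongr
    _ = _ := by ring

theorem measurable_gain_integrand (h : GoodProfile γ g) :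
    Measurable fun q : ℝ × ℝ => g (q.1 + q.2) * g (q.1 - q.2) * |2 * q.2| ^ γ :=
  ((h.measurable.comp (measurable_fst.add measurable_snd)).mul
    (h.measurable.comp (measurable_fst.sub measurable_snd))).mul (by fun_prop)

theorem integrable_gain_integrand (h : GoodProfile γ g) (hs : 1 < s) (hC : 0 ≤ C)
    (hd : HasDecay C s g) (z : ℝ) :
    Integrable fun u => g (z + u) * g (z - u) * |2 * u| ^ γ := by
  refine ((((integrable_one_add_abs hs).const_mul ((1 + |z|) ^ s)).const_mul C).mul_const C).mono'
    (h.measurable_gain_integrand.comp (measurable_const.prodMk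
      measurable_id)).aestronglyMeasurable (Filter.Eventually.of_forall fun u => ?_)
  rw [Real.norm_eq_abs]
  exact (abs_of_nonneg (h.gain_integrand_nonneg z u)).trans_le
    (h.gain_integrand_le_shift (by linarith) hC hd z u)

theorem continuous_gain (h : GoodProfile γ g) (hs : 1 < s) (hC : 0 ≤ C)
    (hd : HasDecay C s g) : Continuous (gainDensity γ g) := by
  rw [continuous_iff_continuousAt]
  intro z
  unfold gainDensity
  refine continuousAt_const.mul ?_
  refine continuousAt_of_dominated
    (bound := fun u => C * ((2 + |z|) ^ s * (1 + |u|) ^ (-s)) * C) ?_ ?_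
    ((((integrable_one_add_abs hs).const_mul _).const_mul C).mul_const C) ?_
  · exact Filter.Eventually.of_forall fun w =>
      (h.measurable_gain_integrand.comp (measurable_const.prodMk
        measurable_id)).aestronglyMeasurable
  · filter_upwards [Metric.ball_mem_nhds z one_pos] with w hw
    refine Filter.Eventually.of_forall fun u => ?_
    rw [Real.norm_eq_abs, abs_of_nonneg (h.gain_integrand_nonneg w u)]
    refine (h.gain_integrand_le_shift (by linarith) hC hd w u).trans ?_
    have : |w| ≤ 1 + |z| := by
      rw [Metric.mem_ball, Real.dist_eq] at hw
      linarith [abs_sub_abs_le_abs_sub w z]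
    have hb : 1 + |w| ≤ 2 + |z| := by linarith
    have := Real.rpow_le_rpow (by positivity) hb (by linarith : 0 ≤ s)
    gcongr
  · have n1 : ∀ᵐ u : ℝ, u ≠ -z := by rw [ae_iff]; simp
    have n2 : ∀ᵐ u : ℝ, u ≠ z := by rw [ae_iff]; simp
    filter_upwards [n1, n2] with u hu1 hu2
    have c1 : ContinuousAt (fun w => g (w + u)) z :=
      (h.continuousAt (z + u) fun e => hu1 (by linarith)).comp (f := fun w => w + u)
        (by fun_prop)
    have c2 : ContinuousAt (fun w => g (w - u)) z :=
      (h.continuousAt (z - u) fun e => hu2 (by linarith)).comp (f := fun w => w - u)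
        (by fun_prop)
    exact (c1.mul c2).mul continuousAt_const

theorem continuous_rate (h : GoodProfile γ g) : Continuous (collisionRate γ g) := by
  rw [continuous_iff_continuousAt]
  intro z
  unfold collisionRate
  refine continuousAt_of_dominated
    (bound := fun y => (2 + |z|) ^ γ * (1 + |y|) ^ γ) ?_ ?_
    ((h.profile.integrable_weight_measure (by linarith [h.lt_one])).const_mul _) ?_
  · exact Filter.Eventually.of_forall fun w =>
      (by fun_prop : Measurable fun y : ℝ => |w - y| ^ γ).aestronglyMeasurable
  · filter_upwards [Metric.ball_mem_nhds z one_pos] with w hw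
    refine Filter.Eventually.of_forall fun u => ?_
    rw [Real.norm_eq_abs, abs_of_nonneg (by positivity)]
    refine (abs_sub_rpow_le h.pos.le w u).trans ?_
    have : |w| ≤ 1 + |z| := by
      rw [Metric.mem_ball, Real.dist_eq] at hw
      linarith [abs_sub_abs_le_abs_sub w z]
    have hb : 1 + |w| ≤ 2 + |z| := by linarith
    have := Real.rpow_le_rpow (by positivity) hb h.pos.le
    gcongr
  · refine Filter.Eventually.of_forall fun u => ?_
    have : Continuous fun w : ℝ => |w - u| ^ γ :=
      (continuous_abs.comp (continuous_id.sub continuous_const)).rpow_const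
        fun w => Or.inr h.pos.le
    exact this.continuousAt

theorem rate_nonneg (γ : ℝ) (g : ℝ → ℝ) (x : ℝ) : 0 ≤ collisionRate γ g x :=
  integral_nonneg fun _ => by positivity

theorem rate_le (h : GoodProfile γ g) (x : ℝ) : collisionRate γ g x ≤ 2 + |x| := by
  have hpr := h.isProbabilityMeasure
  have ia : Integrable (fun x : ℝ => |x|) (profileMeasure g) := by
    simpa using h.profile.integrable_abs_rpow (p := 1) (by norm_num) (by norm_num)
  have hM1 := h.absMoment_le_one (p := 1) (by norm_num) (by norm_num)
  simp only [absMoment, Real.rpow_one] at hM1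
  have hle : collisionRate γ g x ≤ ∫ y, ((1 + |x|) + |y|) ∂(profileMeasure g) := by
    refine integral_mono (h.integrable_rate x) ((integrable_const _).fun_add ia) fun y => ?_
    have := rpow_le_one_add (abs_nonneg (x - y)) h.pos.le h.lt_one.le
    change |x - y| ^ γ ≤ 1 + |x| + |y|
    linarith [abs_sub x y]
  rw [integral_add (integrable_const _) ia, integral_const, probReal_univ, one_smul] at hle
  linarith

theorem integrable_weighted (h : GoodProfile γ g) : Integrable fun x => (1 + |x|) * g x := by
  have := (h.profile.integrable_measure_iff _).1
    (h.profile.integrable_weight_measure (s := 1) (by norm_num))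
  simpa [mul_comm] using this

theorem integral_weighted_le (h : GoodProfile γ g) : ∫ x, (1 + |x|) * g x ≤ 2 := by
  have hpr := h.isProbabilityMeasure
  have ia : Integrable (fun x : ℝ => |x|) (profileMeasure g) := by
    simpa using h.profile.integrable_abs_rpow (p := 1) (by norm_num) (by norm_num)
  have hM1 := h.absMoment_le_one (p := 1) (by norm_num) (by norm_num)
  simp only [absMoment, Real.rpow_one] at hM1
  have e : ∫ x, (1 + |x|) * g x = ∫ x, (1 + |x|) ∂(profileMeasure g) := by
    rw [h.integral_measure]; simp only [mul_comm]
  rw [e, integral_add (integrable_const _) ia, integral_const, probReal_univ, one_smul]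
  linarith

theorem gain_nonneg (h : GoodProfile γ g) (z : ℝ) : 0 ≤ gainDensity γ g z :=
  mul_nonneg two_pos.le (integral_nonneg fun u => h.gain_integrand_nonneg z u)

/-- Since 2z = (z + u) + (z - u), one of the two arguments has modulus at least |z|. Its factor
supplies the decay, and the other integrates to at most 2. -/
theorem gain_le (h : GoodProfile γ g) (hs : 1 < s) (hC : 0 ≤ C) (hd : HasDecay C s g) (z : ℝ) :
    gainDensity γ g z ≤ 8 * C * (1 + |z|) ^ (-s) := by
  set f : ℝ → ℝ := fun x => (1 + |x|) * g x with hf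
  have hf0 : ∀ x, 0 ≤ f x := fun x => mul_nonneg (by positivity) (h.nonneg x)
  have hfi : Integrable f := h.integrable_weighted
  have i1 : Integrable fun u => f (z + u) := hfi.comp_add_left z
  have i2 : Integrable fun u => f (z - u) := hfi.comp_sub_left z
  have hle : ∫ u, g (z + u) * g (z - u) * |2 * u| ^ γ ≤
      ∫ u, C * (1 + |z|) ^ (-s) * (f (z + u) + f (z - u)) := by
    refine integral_mono (h.integrable_gain_integrand hs hC hd z)
      ((i1.fun_add i2).const_mul _) fun u => ?_
    refine (h.gain_integrand_le z u).trans ?_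
    change f (z + u) * f (z - u) ≤ C * (1 + |z|) ^ (-s) * (f (z + u) + f (z - u))
    have hz : |z| ≤ |z + u| ∨ |z| ≤ |z - u| := by
      by_contra! hcon
      have : 2 * z = (z + u) + (z - u) := by ring
      have h2 := abs_add_le (z + u) (z - u)
      rw [← this, abs_mul, abs_two] at h2
      linarith
    have hmono : ∀ t : ℝ, |z| ≤ |t| → f t ≤ C * (1 + |z|) ^ (-s) := fun t ht => by
      refine (weighted_le hd t).trans ?_
      gcongr C * ?_
      exact Real.rpow_le_rpow_of_nonpos (by positivity) (by linarith) (by linarith)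
    have nn : 0 ≤ C * (1 + |z|) ^ (-s) := by positivity
    rcases hz with hz | hz
    · nlinarith [hmono _ hz, hf0 (z - u), hf0 (z + u), mul_nonneg nn (hf0 (z + u)),
        mul_le_mul_of_nonneg_right (hmono _ hz) (hf0 (z - u))]
    · nlinarith [hmono _ hz, hf0 (z - u), hf0 (z + u), mul_nonneg nn (hf0 (z - u)),
        mul_le_mul_of_nonneg_left (hmono _ hz) (hf0 (z + u))]
  rw [integral_const_mul, integral_add i1 i2, integral_add_left_eq_self f z,
    integral_sub_left_eq_self f volume z] at hle
  have h2 := h.integral_weighted_le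
  unfold gainDensity
  calc _ ≤ 2 * (C * (1 + |z|) ^ (-s) * ((∫ x, f x) + ∫ x, f x)) := by gcongr
    _ ≤ 2 * (C * (1 + |z|) ^ (-s) * (2 + 2)) := by gcongr
    _ = _ := by ring

/-- The constant is 41 = 32 + 9: 4 · 8 from the gain, and 4 ν + 1 ≤ 9 (1 + |x|) from the loss with
collision rate ν. -/
theorem abs_deriv_le (h : GoodProfile γ g) (hs : 1 < s) (hC : 0 ≤ C) (hd : HasDecay C s g)
    (x : ℝ) : |profileDeriv γ g x| ≤ 41 * C * (1 + |x|) ^ (-s) / |x| := by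
  unfold profileDeriv
  rw [abs_div]
  gcongr
  have a1 := h.gain_le hs hC hd x
  have a2 := h.gain_nonneg x
  have a3 := h.rate_le x
  have a4 := rate_nonneg γ g x
  have a5 := weighted_le hd x
  have a6 : (4 * collisionRate γ g x + 1) * g x ≤ 9 * ((1 + |x|) * g x) := by
    rw [← mul_assoc]
    gcongr
    · exact h.nonneg x
    · linarith [abs_nonneg x]
  have a7 : 0 ≤ (4 * collisionRate γ g x + 1) * g x := mul_nonneg (by positivity) (h.nonneg x)
  have a8 : 0 ≤ C * (1 + |x|) ^ (-s) := by positivity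
  rw [abs_le]
  constructor <;> linarith

/-- Substituting y = 2m - x at fixed x introduces the midpoint m with Jacobian 2; after Fubini, x =
m + u centres the inner integral. The decay of g provides the integrability that the exchange
requires. -/
theorem integral_gain_window (h : GoodProfile γ g) (hs : 1 < s) (hC : 0 ≤ C) (hd : HasDecay C s g)
    {w z : ℝ} (hwz : w ≤ z) :
    ∫ q, (step w ((q.1 + q.2) / 2) - step z ((q.1 + q.2) / 2)) * |q.1 - q.2| ^ γ
      ∂(pairMeasure g) = ∫ m in w..z, gainDensity γ g m := by
  set I : Set ℝ := Set.Ioc w z with hI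
  have hIm : MeasurableSet I := measurableSet_Ioc
  set F : ℝ → ℝ → ℝ := fun x y => g x * g y * (I.indicator 1 ((x + y) / 2) * |x - y| ^ γ) with hF
  have hFm : Measurable fun q : ℝ × ℝ => F q.1 q.2 :=
    ((h.measurable.comp measurable_fst).mul (h.measurable.comp measurable_snd)).mul
      (((measurable_one.indicator hIm).comp (f := fun q : ℝ × ℝ => (q.1 + q.2) / 2)
        (by fun_prop)).mul (measurable_abs_sub_rpow γ))
  have iW := h.profile.integrable_abs_sub_rpow h.pos.le (by linarith [h.lt_one])
  set f : ℝ → ℝ := fun x => (1 + |x|) * g x with hf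
  have hf0 : ∀ x, 0 ≤ f x := fun x => mul_nonneg (by positivity) (h.nonneg x)
  have hfi : Integrable f := h.integrable_weighted
  have hfC : ∀ x, f x ≤ C := fun x => (weighted_le hd x).trans
    (mul_le_of_le_one_right hC (one_add_abs_rpow_neg_le_one (by linarith) x))
  have hind : ∀ x, 0 ≤ I.indicator (1 : ℝ → ℝ) x := fun x =>
    Set.indicator_nonneg (fun _ _ => zero_le_one) x
  have hFf : ∀ x y, ‖F x y‖ ≤ f x * f y * I.indicator 1 ((x + y) / 2) := fun x y => by
    have n : 0 ≤ F x y := mul_nonneg (mul_nonneg (h.nonneg _) (h.nonneg _))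
      (mul_nonneg (hind _) (by positivity))
    have b : |x - y| ^ γ ≤ (1 + |x|) * (1 + |y|) :=
      (rpow_le_one_add (abs_nonneg _) h.pos.le h.lt_one.le).trans
        ((by linarith [abs_sub x y] : 1 + |x - y| ≤ 1 + |x| + |y|).trans (one_add_abs_le_mul x y))
    rw [Real.norm_eq_abs, abs_of_nonneg n]
    have n1 := mul_nonneg (mul_nonneg (h.nonneg x) (h.nonneg y)) (hind ((x + y) / 2))
    calc F x y = g x * g y * I.indicator 1 ((x + y) / 2) * |x - y| ^ γ := by rw [hF]; ring
      _ ≤ g x * g y * I.indicator 1 ((x + y) / 2) * ((1 + |x|) * (1 + |y|)) := by gcongr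
      _ = _ := by rw [hf]; ring
  have iF : Integrable (fun q : ℝ × ℝ => F q.1 q.2) (volume.prod volume) := by
    refine (hfi.mul_prod hfi).mono' hFm.aestronglyMeasurable (Filter.Eventually.of_forall fun q => ?_)
    refine (hFf q.1 q.2).trans (mul_le_of_le_one_right (mul_nonneg (hf0 _) (hf0 _)) ?_)
    exact Set.indicator_le_self' (fun _ _ => zero_le_one) _
  have iI : Integrable (I.indicator (1 : ℝ → ℝ)) :=
    (integrable_indicator_iff hIm).2 (integrableOn_const (by simp [hI]))
  have hmid : ∀ x m : ℝ, (x + (2 * m - x)) / 2 = m := fun x m => by ring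
  have iF' : Integrable (fun q : ℝ × ℝ => F q.1 (2 * q.2 - q.1)) (volume.prod volume) := by
    refine ((hfi.mul_prod iI).mul_const C).mono' ?_ (Filter.Eventually.of_forall fun q => ?_)
    · exact (hFm.comp (f := fun q : ℝ × ℝ => (q.1, 2 * q.2 - q.1))
        (by fun_prop)).aestronglyMeasurable
    · refine (hFf _ _).trans ?_
      rw [hmid]
      have := mul_nonneg (hf0 q.1) (hind q.2)
      calc _ = f q.1 * I.indicator 1 q.2 * f (2 * q.2 - q.1) := by ring
        _ ≤ _ := by gcongr; exact hfC _
  have e1 : ∫ q, (step w ((q.1 + q.2) / 2) - step z ((q.1 + q.2) / 2)) * |q.1 - q.2| ^ γ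
      ∂(pairMeasure g) = ∫ x, ∫ y, F x y := by
    rw [h.profile.integral_pair, Measure.volume_eq_prod]
    simp only [step_sub_step w z hwz]
    exact integral_prod (fun q : ℝ × ℝ => F q.1 q.2) iF
  have e2 : ∀ x, ∫ y, F x y = 2 * ∫ m, F x (2 * m - x) := fun x => by
    rw [Measure.integral_comp_mul_left (fun m => F x (m - x)) 2,
      integral_sub_right_eq_self (F x) x]
    simp
  have e3 : ∀ m, ∫ x, F x (2 * m - x) =
      I.indicator 1 m * ∫ u, g (m + u) * g (m - u) * |2 * u| ^ γ := fun m => by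
    rw [← integral_add_left_eq_self (fun x => F x (2 * m - x)) m, ← integral_const_mul]
    congr 1
    funext u
    have a1 : 2 * m - (m + u) = m - u := by ring
    have a2 : (m + u + (m - u)) / 2 = m := by ring
    have a3 : m + u - (m - u) = 2 * u := by ring
    simp only [hF, a1, a2, a3]
    ring
  rw [e1]
  simp only [e2, integral_const_mul]
  rw [integral_integral_swap (f := fun x m => F x (2 * m - x)) iF']
  simp only [e3]
  rw [intervalIntegral.integral_of_le hwz, ← integral_indicator hIm, ← integral_const_mul]
  congr 1
  funext m
  unfold gainDensity
  by_cases hm : m ∈ I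
  · simp only [Set.indicator_of_mem hm, Pi.one_apply, one_mul]
  · simp only [Set.indicator_of_notMem hm, zero_mul, mul_zero]

theorem integral_loss_window (h : GoodProfile γ g) {w z : ℝ} (hwz : w ≤ z) :
    ∫ q, (step w q.1 - step z q.1) * |q.1 - q.2| ^ γ ∂(pairMeasure g) =
      ∫ x in w..z, collisionRate γ g x * g x := by
  set I : Set ℝ := Set.Ioc w z with hI
  have hIm : MeasurableSet I := measurableSet_Ioc
  have iW := h.profile.integrable_abs_sub_rpow h.pos.le (by linarith [h.lt_one])
  have i1 : Integrable (fun q : ℝ × ℝ => I.indicator (1 : ℝ → ℝ) q.1 * |q.1 - q.2| ^ γ)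
      (pairMeasure g) := iW.bdd_mul (c := 1)
    ((measurable_one.indicator hIm).comp measurable_fst).aestronglyMeasurable
    (Filter.Eventually.of_forall fun q => abs_indicator_one_le I _)
  simp only [step_sub_step w z hwz, ← hI]
  rw [pairMeasure, integral_prod _ i1]
  simp only [integral_const_mul]
  rw [h.integral_measure, intervalIntegral.integral_of_le hwz, ← integral_indicator hIm]
  congr 1
  funext x
  unfold collisionRate
  by_cases hx : x ∈ I
  · simp only [Set.indicator_of_mem hx, Pi.one_apply, one_mul, mul_comm]
  · simp only [Set.indicator_of_notMem hx, zero_mul, mul_zero]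

/-- The window formulas exhibit the flux as a primitive of gain minus loss, which is continuous at
every nonzero point. -/
theorem hasDerivAt_flux (h : GoodProfile γ g) (hs : 1 < s) (hC : 0 ≤ C) (hd : HasDecay C s g)
    {x : ℝ} (hx : x ≠ 0) :
    HasDerivAt (profileFlux γ g) (gainDensity γ g x - collisionRate γ g x * g x) x := by
  have cg := h.continuous_gain hs hC hd
  have cr := h.continuous_rate
  set f : ℝ → ℝ := fun x => gainDensity γ g x - collisionRate γ g x * g x with hf
  have i1 : ∀ a b, IntervalIntegrable (gainDensity γ g) volume a b := fun a b =>
    cg.intervalIntegrable a b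
  have i2 : ∀ a b, IntervalIntegrable (fun x => collisionRate γ g x * g x) volume a b :=
    fun a b => h.profile.integrable.intervalIntegrable.continuousOn_mul cr.continuousOn
  have ile : ∀ w z, w ≤ z → profileFlux γ g z - profileFlux γ g w = ∫ x in w..z, f x := by
    intro w z hwz
    rw [h.flux_sub, h.integral_gain_window hs hC hd hwz, h.integral_loss_window hwz,
      ← intervalIntegral.integral_sub (i1 w z) (i2 w z)]
  have hall : ∀ z, profileFlux γ g z = profileFlux γ g 0 + ∫ x in (0 : ℝ)..z, f x := by
    intro z
    rcases le_total 0 z with hz | hz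
    · linarith [ile 0 z hz]
    · rw [intervalIntegral.integral_symm]
      linarith [ile z 0 hz]
  have hfm : Measurable f := cg.measurable.sub (cr.measurable.mul h.measurable)
  have hderiv := intervalIntegral.integral_hasDerivAt_right (f := f) (a := 0) (b := x)
    ((i1 0 x).sub (i2 0 x)) (hfm.stronglyMeasurable.stronglyMeasurableAtFilter)
    (cg.continuousAt.sub (cr.continuousAt.mul (h.continuousAt x hx)))
  have := hderiv.const_add (profileFlux γ g 0)
  exact this.congr_of_eventuallyEq (Filter.Eventually.of_forall hall)

theorem hasDerivAt (h : GoodProfile γ g) (hs : 1 < s) (hC : 0 ≤ C) (hd : HasDecay C s g)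
    {x : ℝ} (hx : x ≠ 0) : HasDerivAt g (profileDeriv γ g x) x := by
  have h1 := ((h.hasDerivAt_flux hs hC hd hx).const_mul 4).div (hasDerivAt_id x) hx
  refine (h1.congr_of_eventuallyEq ?_).congr_deriv ?_
  · filter_upwards [isOpen_compl_singleton.mem_nhds hx] with y hy
    simp only [Pi.div_apply, id]
    have hy0 : y ≠ 0 := hy
    rw [← h.flux y hy]
    field_simp
  · unfold profileDeriv
    simp only [id]
    rw [← h.flux x hx]
    field_simp
    ring

end GoodProfile

/-! ### Hölder estimate at the origin -/

theorem integrable_abs_rpow_mul {a b : ℝ} (ha : 0 ≤ a) (ha1 : a < 1) (hb : 1 < b) :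
    Integrable fun x : ℝ => |x| ^ (-a) * (1 + |x|) ^ (-b) := by
  have hm : Measurable fun x : ℝ => |x| ^ (-a) * (1 + |x|) ^ (-b) := by fun_prop
  have hloc : IntegrableOn (fun x : ℝ => |x| ^ (-a)) (Set.Icc (-1) 1) := by
    have hpos : IntegrableOn (fun x : ℝ => |x| ^ (-a)) (Set.Ioc 0 1) := by
      have := (intervalIntegrable_iff_integrableOn_Ioc_of_le zero_le_one).1
        (intervalIntegral.intervalIntegrable_rpow' (a := 0) (b := 1) (by linarith : -1 < -a))
      refine this.congr_fun (fun x hx => ?_) measurableSet_Ioc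
      simp only [abs_of_pos hx.1]
    have hneg : IntegrableOn (fun x : ℝ => |x| ^ (-a)) (Set.Ico (-1) 0) := by
      have h := (Measure.measurePreserving_neg (volume : Measure ℝ)).integrableOn_comp_preimage
        (Homeomorph.neg ℝ).measurableEmbedding (f := fun x : ℝ => |x| ^ (-a)) (s := Set.Ioc 0 1)
      have h' := h.2 hpos
      simpa [Function.comp_def] using h'
    have h0 : IntegrableOn (fun x : ℝ => |x| ^ (-a)) {0} := by simp
    refine ((hneg.union h0).union hpos).mono_set fun x hx => ?_
    rcases lt_trichotomy x 0 with h | h | h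
    · exact Or.inl (Or.inl ⟨hx.1, h⟩)
    · exact Or.inl (Or.inr h)
    · exact Or.inr ⟨h, hx.2⟩
  have hI := (integrable_indicator_iff measurableSet_Icc).2 hloc
  refine (hI.fun_add (integrable_one_add_abs hb)).mono' hm.aestronglyMeasurable
    (Filter.Eventually.of_forall fun x => ?_)
  have n1 : 0 ≤ |x| ^ (-a) := by positivity
  have n2 : 0 ≤ (1 + |x|) ^ (-b) := by positivity
  rw [Real.norm_eq_abs, abs_of_nonneg (mul_nonneg n1 n2)]
  by_cases hx : x ∈ Set.Icc (-1 : ℝ) 1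
  · rw [Set.indicator_of_mem hx]
    have := one_add_abs_rpow_neg_le_one (by linarith : 0 ≤ b) x
    have := mul_le_of_le_one_right n1 this
    linarith
  · rw [Set.indicator_of_notMem hx]
    have hx1 : 1 ≤ |x| := by
      by_contra! hcon
      exact hx ⟨by linarith [neg_abs_le x], by linarith [le_abs_self x]⟩
    have := Real.rpow_le_one_of_one_le_of_nonpos hx1 (by linarith : -a ≤ 0)
    have := mul_le_of_le_one_left n2 this
    linarith

theorem abs_rpow_sub_one_le {t γ : ℝ} (ht : 0 ≤ t) (h0 : 0 ≤ γ) (h1 : γ ≤ 1) :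
    |t ^ γ - 1| ≤ |t - 1| := by
  rcases le_total t 1 with h | h
  · have a := Real.rpow_le_one ht h h0
    have b : t ≤ t ^ γ := by
      simpa using Real.rpow_le_rpow_of_exponent_ge_of_imp ht h h1 (by intro _ h; simp_all)
    rw [abs_of_nonpos (by linarith), abs_of_nonpos (by linarith)]
    linarith
  · have a := Real.one_le_rpow h h0
    have b : t ^ γ ≤ t := by simpa using Real.rpow_le_rpow_of_exponent_le h h1
    rw [abs_of_nonneg (by linarith), abs_of_nonneg (by linarith)]
    linarith

/-- For |z| ≤ |y|, factor out |y|^γ and use |t^γ - 1| ≤ |t - 1|; otherwise both powers are at most 2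
and the ratio |z|/|y| exceeds 1. The order 3/4 does not degenerate as γ tends to 0; the price is the
integrable singularity |y|^(-3/4). -/
theorem abs_rpow_sub_rpow_le {γ z y : ℝ} (h0 : 0 ≤ γ) (h1 : γ ≤ 1) (hz : |z| ≤ 1) (hy : y ≠ 0) :
    |(|z - y| ^ γ - |y| ^ γ)| ≤ 2 * (1 + |y|) * (|z| / |y|) ^ (3 / 4 : ℝ) := by
  have hy0 : 0 < |y| := abs_pos.2 hy
  have yγ := rpow_le_one_add hy0.le h0 h1
  rcases lt_or_ge |y| |z| with h | h
  · have r : 1 ≤ (|z| / |y|) ^ (3 / 4 : ℝ) :=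
      Real.one_le_rpow ((one_le_div hy0).2 h.le) (by norm_num)
    have b : |z - y| ^ γ ≤ 2 := by
      have h2 : |z - y| ≤ 2 := by linarith [abs_sub z y]
      calc |z - y| ^ γ ≤ 2 ^ γ := by gcongr
        _ ≤ 2 ^ (1 : ℝ) := Real.rpow_le_rpow_of_exponent_le (by norm_num) h1
        _ = 2 := by norm_num
    have b' : |y| ^ γ ≤ 2 := by linarith
    have : |(|z - y| ^ γ - |y| ^ γ)| ≤ 2 := by
      have p1 : 0 ≤ |z - y| ^ γ := by positivity
      have p2 : 0 ≤ |y| ^ γ := by positivity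
      rw [abs_le]; constructor <;> linarith
    nlinarith
  · set t := |z| / |y| with ht
    have ht0 : 0 ≤ t := by positivity
    have ht1 : t ≤ 1 := (div_le_one hy0).2 h
    have tt : t ≤ t ^ (3 / 4 : ℝ) := by
      simpa using Real.rpow_le_rpow_of_exponent_ge_of_imp ht0 ht1 (by norm_num : (3 / 4 : ℝ) ≤ 1)
        (by intro _ h; norm_num at h)
    have e : |z - y| ^ γ - |y| ^ γ = |y| ^ γ * ((|z - y| / |y|) ^ γ - 1) := by
      rw [Real.div_rpow (abs_nonneg _) (abs_nonneg _)]
      have : |y| ^ γ ≠ 0 := (Real.rpow_pos_of_pos hy0 _).ne'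
      field_simp
    have d : |(|z - y| / |y|) - 1| ≤ t := by
      have : |z - y| / |y| - 1 = (|z - y| - |y|) / |y| := by field_simp
      have hle := abs_abs_sub_abs_le (z - y) (-y)
      rw [abs_neg, sub_neg_eq_add, sub_add_cancel] at hle
      rw [this, abs_div, abs_abs, ht]
      exact div_le_div_of_nonneg_right hle hy0.le
    rw [e, abs_mul, abs_of_nonneg (by positivity : 0 ≤ |y| ^ γ)]
    have := (abs_rpow_sub_one_le (by positivity : 0 ≤ |z - y| / |y|) h0 h1).trans d
    calc _ ≤ (1 + |y|) * t ^ (3 / 4 : ℝ) := by gcongr; exact this.trans tt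
      _ ≤ _ := by
        gcongr
        linarith

/-- One-sided comparison for a damped linear equation near a singular endpoint. -/
theorem le_of_damped {y E a : ℝ → ℝ} {K B : ℝ} (hK : 0 < K)
    (hB : ∀ x ∈ Set.Ioc (0 : ℝ) 1, y x ≤ B * x)
    (hy : ∀ x ∈ Set.Ioc (0 : ℝ) 1, HasDerivAt y (E x - a x * y x) x)
    (ha : ∀ x ∈ Set.Ioc (0 : ℝ) 1, 0 ≤ a x)
    (hE : ∀ x ∈ Set.Ioc (0 : ℝ) 1, E x ≤ K * x ^ (3 / 4 : ℝ)) {x : ℝ}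
    (hx : x ∈ Set.Ioc (0 : ℝ) 1) : y x ≤ K * x ^ (7 / 4 : ℝ) := by
  refine le_of_forall_pos_le_add fun κ hκ => ?_
  set ε := min x (κ / (|B| + 1)) with hε
  have hB1 : 0 < |B| + 1 := by positivity
  have hε0 : 0 < ε := lt_min hx.1 (by positivity)
  have hεx : ε ≤ x := min_le_left _ _
  have hsub : ∀ t ∈ Set.Icc ε x, t ∈ Set.Ioc (0 : ℝ) 1 := fun t ht =>
    ⟨hε0.trans_le ht.1, ht.2.trans hx.2⟩
  -- The barrier κ + K t^(7/4) starts above y at ε because y ≤ B t. At a contact point y ≥ 0, so the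
  -- damping helps, and the barrier's slope (7/4) K t^(3/4) strictly exceeds the forcing bound. Then
  -- κ tends to 0.
  have key := image_le_of_deriv_right_lt_deriv_boundary' (f := y)
    (f' := fun t => E t - a t * y t) (a := ε) (b := x)
    (B := fun t => κ + K * t ^ (7 / 4 : ℝ)) (B' := fun t => K * ((7 / 4) * t ^ (3 / 4 : ℝ)))
    (fun t ht => (hy t (hsub t ht)).continuousAt.continuousWithinAt)
    (fun t ht => (hy t (hsub t (Set.Ico_subset_Icc_self ht))).hasDerivWithinAt) ?_ ?_ ?_ ?_
    (Set.right_mem_Icc.2 hεx)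
  · change y x ≤ κ + _ at key
    linarith
  · have h1 := hB ε (hsub ε (Set.left_mem_Icc.2 hεx))
    have h2 : ε * (|B| + 1) ≤ κ := (le_div_iff₀ hB1).1 (min_le_right _ _)
    have h3 : 0 ≤ K * ε ^ (7 / 4 : ℝ) := by positivity
    nlinarith [le_abs_self B]
  · intro t ht
    exact (continuousAt_const.add (continuousAt_const.mul
      (Real.continuousAt_rpow_const t _ (Or.inr (by norm_num))))).continuousWithinAt
  · intro t ht
    have ht0 : t ≠ 0 := (hsub t (Set.Ico_subset_Icc_self ht)).1.ne'
    have h := ((Real.hasDerivAt_rpow_const (p := 7 / 4) (Or.inl ht0)).const_mul K).const_add κ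
    exact (h.congr_deriv (by norm_num)).hasDerivWithinAt
  · intro t ht hyt
    have hm := hsub t (Set.Ico_subset_Icc_self ht)
    have p : 0 < t ^ (3 / 4 : ℝ) := Real.rpow_pos_of_pos hm.1 _
    have hy0 : 0 ≤ y t := by
      rw [hyt]
      have := hm.1
      positivity
    have := mul_nonneg (ha t hm) hy0
    have h4 := hE t hm
    have : 0 < K * t ^ (3 / 4 : ℝ) := by positivity
    change E t - a t * y t < K * (7 / 4 * t ^ (3 / 4 : ℝ))
    linarith

theorem abs_le_of_damped {y E a : ℝ → ℝ} {K B : ℝ} (hK : 0 < K)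
    (hB : ∀ x ∈ Set.Ioc (0 : ℝ) 1, |y x| ≤ B * x)
    (hy : ∀ x ∈ Set.Ioc (0 : ℝ) 1, HasDerivAt y (E x - a x * y x) x)
    (ha : ∀ x ∈ Set.Ioc (0 : ℝ) 1, 0 ≤ a x)
    (hE : ∀ x ∈ Set.Ioc (0 : ℝ) 1, |E x| ≤ K * x ^ (3 / 4 : ℝ)) {x : ℝ}
    (hx : x ∈ Set.Ioc (0 : ℝ) 1) : |y x| ≤ K * x ^ (7 / 4 : ℝ) := by
  rw [abs_le']
  refine ⟨le_of_damped hK (fun t ht => (le_abs_self _).trans (hB t ht)) hy ha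
    (fun t ht => (le_abs_self _).trans (hE t ht)) hx,
    le_of_damped (y := fun t => -y t) (E := fun t => -E t) hK
    (fun t ht => (neg_le_abs _).trans (hB t ht)) (fun t ht => ?_) ha
    (fun t ht => (neg_le_abs _).trans (hE t ht)) hx⟩
  exact (hy t ht).fun_neg.congr_deriv (by ring)

/-- The integral of the majorant of the increments of the collision coefficients. -/
def singularMass (s : ℝ) : ℝ := ∫ u : ℝ, |u| ^ (-(3 / 4 : ℝ)) * (1 + |u|) ^ (-s)

theorem singularMass_nonneg (s : ℝ) : 0 ≤ singularMass s :=
  integral_nonneg fun _ => by positivity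

namespace GoodProfile

variable {γ C s : ℝ} {g : ℝ → ℝ}

theorem le_of_hasDecay (hs : 0 ≤ s) (hC : 0 ≤ C) (hd : HasDecay C s g) (x : ℝ) : g x ≤ C :=
  (hd x).trans (mul_le_of_le_one_right hC (one_add_abs_rpow_neg_le_one (by linarith) x))

/-- Mean value inequality with |g'| = O(1/|x|) when 2|z| ≤ |a|; otherwise the ratio is at least 1/2
and boundedness of g suffices. An order below 1 makes |a|^(-3/4) integrable; an order above 1/2 is
needed for g' to be square integrable at 0. -/
theorem abs_increment_le (h : GoodProfile γ g) (hs : 1 < s) (hC : 0 ≤ C) (hd : HasDecay C s g)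
    {a : ℝ} (ha : a ≠ 0) (z : ℝ) :
    |g (z + a) - g a| ≤ 82 * C * (|z| / |a|) ^ (3 / 4 : ℝ) := by
  have ha0 : 0 < |a| := abs_pos.2 ha
  set t := |z| / |a| with ht
  have ht0 : 0 ≤ t := by positivity
  rcases le_total (2 * |z|) |a| with hza | hza
  · have ht1 : t ≤ 1 := (div_le_one ha0).2 (by linarith [abs_nonneg z])
    have tt : t ≤ t ^ (3 / 4 : ℝ) := by
      simpa using Real.rpow_le_rpow_of_exponent_ge_of_imp ht0 ht1 (by norm_num : (3 / 4 : ℝ) ≤ 1)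
        (by intro _ h; norm_num at h)
    have hball : ∀ x ∈ Metric.closedBall a |z|, |a| / 2 ≤ |x| := fun x hx => by
      rw [Metric.mem_closedBall, Real.dist_eq] at hx
      have := abs_sub_abs_le_abs_sub a x
      rw [abs_sub_comm] at this
      linarith
    have key := (convex_closedBall a |z|).norm_image_sub_le_of_norm_hasDerivWithin_le
      (f := g) (f' := profileDeriv γ g) (C := 82 * C / |a|) (x := a) (y := z + a)
      (fun x hx => (h.hasDerivAt hs hC hd (abs_pos.1 (by linarith [hball x hx]))).hasDerivWithinAt)
      (fun x hx => ?_) (Metric.mem_closedBall_self (abs_nonneg z))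
      (by rw [Metric.mem_closedBall, Real.dist_eq]; simp)
    · rw [add_sub_cancel_right, Real.norm_eq_abs, Real.norm_eq_abs] at key
      calc _ ≤ 82 * C / |a| * |z| := key
        _ = 82 * C * t := by rw [ht]; ring
        _ ≤ _ := by gcongr
    · have hx2 := hball x hx
      have hx0 : 0 < |x| := by linarith
      rw [Real.norm_eq_abs]
      refine (h.abs_deriv_le hs hC hd x).trans ?_
      have := one_add_abs_rpow_neg_le_one (by linarith : 0 ≤ s) x
      rw [div_le_div_iff₀ hx0 ha0]
      have : 41 * C * (1 + |x|) ^ (-s) ≤ 41 * C := mul_le_of_le_one_right (by positivity) this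
      calc _ ≤ 41 * C * |a| := by gcongr
        _ ≤ 41 * C * (2 * |x|) := by gcongr; linarith
        _ = _ := by ring
  · have ht2 : 1 / 2 ≤ t := by rw [ht, le_div_iff₀ ha0]; linarith
    have h1 : (1 / 2 : ℝ) ≤ t ^ (3 / 4 : ℝ) := by
      calc (1 / 2 : ℝ) = (1 / 2) ^ (1 : ℝ) := by norm_num
        _ ≤ (1 / 2) ^ (3 / 4 : ℝ) :=
          Real.rpow_le_rpow_of_exponent_ge (by norm_num) (by norm_num) (by norm_num)
        _ ≤ _ := by gcongr
    have b1 := le_of_hasDecay (by linarith) hC hd (z + a)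
    have b2 := le_of_hasDecay (by linarith) hC hd a
    have n1 := h.nonneg (z + a)
    have n2 := h.nonneg a
    have : |g (z + a) - g a| ≤ C := by rw [abs_le]; constructor <;> linarith
    nlinarith

theorem weighted_shift_le (hs : 0 ≤ s) (hs3 : s ≤ 3) (hC : 0 ≤ C) (h : GoodProfile γ g)
    (hd : HasDecay C s g) {z : ℝ} (hz : |z| ≤ 1) (u : ℝ) :
    (1 + |u|) * g (z - u) ≤ 16 * C * (1 + |u|) ^ (-s) := by
  have a1 := one_add_abs_le_mul_shift z (-u)
  rw [abs_neg, ← sub_eq_add_neg] at a1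
  have a2 := shift_rpow_neg_le hs z (-u)
  rw [abs_neg, ← sub_eq_add_neg] at a2
  have a3 := weighted_le hd (z - u)
  have a4 : (1 + |z|) ^ s ≤ 8 := by
    calc (1 + |z|) ^ s ≤ 2 ^ s := by gcongr; linarith
      _ ≤ 2 ^ (3 : ℝ) := Real.rpow_le_rpow_of_exponent_le (by norm_num) hs3
      _ = 8 := by norm_num
  have n := h.nonneg (z - u)
  calc _ ≤ (1 + |z|) * (1 + |z - u|) * g (z - u) := by gcongr
    _ = (1 + |z|) * ((1 + |z - u|) * g (z - u)) := by ring
    _ ≤ 2 * (C * (1 + |z - u|) ^ (-s)) := by gcongr; linarith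
    _ ≤ 2 * (C * (8 * (1 + |u|) ^ (-s))) := by
      gcongr
      exact a2.trans (by gcongr)
    _ = _ := by ring

/-- The difference of products splits into two terms, each with one increment of g based at u or -u
and bounded by a multiple of (|z|/|u|)^(3/4). The other factor absorbs the kernel and leaves an
integrable tail. -/
theorem abs_gain_sub_le (h : GoodProfile γ g) (hs : 1 < s) (hs3 : s ≤ 3) (hC : 0 ≤ C)
    (hd : HasDecay C s g) {z : ℝ} (hz : |z| ≤ 1) :
    |gainDensity γ g z - gainDensity γ g 0| ≤
      5576 * C ^ 2 * singularMass s * |z| ^ (3 / 4 : ℝ) := by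
  have iz := h.integrable_gain_integrand hs hC hd z
  have i0 := h.integrable_gain_integrand hs hC hd 0
  have iJ := integrable_abs_rpow_mul (a := 3 / 4) (by norm_num) (by norm_num) hs
  unfold gainDensity
  rw [← mul_sub, ← integral_sub iz i0, abs_mul, abs_two]
  have hb : ∀ᵐ u : ℝ, ‖g (z + u) * g (z - u) * |2 * u| ^ γ - g (0 + u) * g (0 - u) * |2 * u| ^ γ‖ ≤
      2788 * C ^ 2 * |z| ^ (3 / 4 : ℝ) * (|u| ^ (-(3 / 4 : ℝ)) * (1 + |u|) ^ (-s)) := by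
    have n1 : ∀ᵐ u : ℝ, u ≠ 0 := by rw [ae_iff]; simp
    filter_upwards [n1] with u hu
    have hu0 : 0 < |u| := abs_pos.2 hu
    rw [Real.norm_eq_abs, zero_add, zero_sub]
    have e : g (z + u) * g (z - u) * |2 * u| ^ γ - g u * g (-u) * |2 * u| ^ γ =
        ((g (z + u) - g u) * g (z - u) + g u * (g (z + -u) - g (-u))) * |2 * u| ^ γ := by
      rw [← sub_eq_add_neg]; ring
    have d1 := h.abs_increment_le hs hC hd hu z
    have d2 := h.abs_increment_le hs hC hd (neg_ne_zero.2 hu) z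
    rw [abs_neg] at d2
    have p : |2 * u| ^ γ ≤ 2 * (1 + |u|) := by
      have := rpow_le_one_add (abs_nonneg (2 * u)) h.pos.le h.lt_one.le
      rw [abs_mul, abs_two] at this ⊢
      linarith
    have w1 := weighted_shift_le (by linarith) hs3 hC h hd hz u
    have w2 := weighted_le hd u
    have m1 := h.nonneg (z - u)
    have m2 := h.nonneg u
    rw [e, abs_mul, abs_of_nonneg (by positivity : 0 ≤ |2 * u| ^ γ)]
    set T := (|z| / |u|) ^ (3 / 4 : ℝ) with hT
    have hT' : T = |z| ^ (3 / 4 : ℝ) * |u| ^ (-(3 / 4 : ℝ)) := by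
      rw [hT, Real.div_rpow (abs_nonneg _) (abs_nonneg _), Real.rpow_neg (abs_nonneg _),
        div_eq_mul_inv]
    have hT0 : 0 ≤ T := by positivity
    calc _ ≤ ((82 * C * T) * g (z - u) + g u * (82 * C * T)) * (2 * (1 + |u|)) := by
          gcongr
          refine (abs_add_le _ _).trans ?_
          rw [abs_mul, abs_mul, abs_of_nonneg m1, abs_of_nonneg m2]
          gcongr
      _ = 164 * C * T * ((1 + |u|) * g (z - u) + (1 + |u|) * g u) := by ring
      _ ≤ 164 * C * T * (16 * C * (1 + |u|) ^ (-s) + C * (1 + |u|) ^ (-s)) := by gcongr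
      _ = _ := by rw [hT']; ring
  have := norm_integral_le_of_norm_le (iJ.const_mul _) hb
  rw [Real.norm_eq_abs, integral_const_mul] at this
  change _ ≤ _ * singularMass s at this
  linarith

theorem abs_rate_sub_le (h : GoodProfile γ g) (hs : 1 < s) (hd : HasDecay C s g) {z : ℝ}
    (hz : |z| ≤ 1) :
    |collisionRate γ g z - collisionRate γ g 0| ≤
      2 * C * singularMass s * |z| ^ (3 / 4 : ℝ) := by
  have iJ := integrable_abs_rpow_mul (a := 3 / 4) (by norm_num) (by norm_num) hs
  unfold collisionRate
  rw [← integral_sub (h.integrable_rate z) (h.integrable_rate 0), h.integral_measure]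
  have hb : ∀ᵐ u : ℝ, ‖g u * (|z - u| ^ γ - |0 - u| ^ γ)‖ ≤
      2 * C * |z| ^ (3 / 4 : ℝ) * (|u| ^ (-(3 / 4 : ℝ)) * (1 + |u|) ^ (-s)) := by
    have n1 : ∀ᵐ u : ℝ, u ≠ 0 := by rw [ae_iff]; simp
    filter_upwards [n1] with u hu
    have m2 := h.nonneg u
    rw [Real.norm_eq_abs, zero_sub, abs_neg, abs_mul, abs_of_nonneg m2]
    have d := abs_rpow_sub_rpow_le h.pos.le h.lt_one.le hz hu
    have w2 := weighted_le hd u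
    rw [Real.div_rpow (abs_nonneg _) (abs_nonneg _), div_eq_mul_inv,
      ← Real.rpow_neg (abs_nonneg _)] at d
    calc _ ≤ g u * (2 * (1 + |u|) * (|z| ^ (3 / 4 : ℝ) * |u| ^ (-(3 / 4 : ℝ)))) := by gcongr
      _ = 2 * |z| ^ (3 / 4 : ℝ) * |u| ^ (-(3 / 4 : ℝ)) * ((1 + |u|) * g u) := by ring
      _ ≤ 2 * |z| ^ (3 / 4 : ℝ) * |u| ^ (-(3 / 4 : ℝ)) * (C * (1 + |u|) ^ (-s)) := by gcongr
      _ = _ := by ring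
  have := norm_integral_le_of_norm_le (iJ.const_mul _) hb
  rw [Real.norm_eq_abs, integral_const_mul] at this
  change _ ≤ _ * singularMass s at this
  refine this.trans_eq (by ring)

end GoodProfile

/-- The value at the origin of the continuous representative of a profile. -/
def centralValue (γ : ℝ) (g : ℝ → ℝ) : ℝ :=
  4 * gainDensity γ g 0 / (4 * collisionRate γ g 0 + 1)

/-- The constant in the Hölder estimate of a profile at the origin. -/
def holderConst (C s : ℝ) : ℝ := 1 + (22304 * C ^ 2 + 256 * C ^ 2) * singularMass s

theorem holderConst_pos {C s : ℝ} : 0 < holderConst C s := by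
  have := singularMass_nonneg s
  unfold holderConst
  positivity

namespace GoodProfile

variable {γ C s : ℝ} {g : ℝ → ℝ}

/-- The left side vanishes at z = 0 by the choice of `centralValue`, so only increments of gain and
rate remain. The constants are 4 · 5576 and 4 · 2 · 32, the last factor coming from `centralValue γ
g ≤ 32 * C`. -/
theorem abs_forcing_le (h : GoodProfile γ g) (hs : 1 < s) (hs3 : s ≤ 3) (hC : 0 ≤ C)
    (hd : HasDecay C s g) {z : ℝ} (hz : |z| ≤ 1) :
    |4 * gainDensity γ g z - (4 * collisionRate γ g z + 1) * centralValue γ g| ≤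
      holderConst C s * |z| ^ (3 / 4 : ℝ) := by
  have r0 := rate_nonneg γ g 0
  have c0 : 0 ≤ centralValue γ g :=
    div_nonneg (mul_nonneg (by norm_num) (h.gain_nonneg 0)) (by positivity)
  have hc : centralValue γ g * (4 * collisionRate γ g 0 + 1) = 4 * gainDensity γ g 0 :=
    div_mul_cancel₀ _ (by positivity)
  have c1 : centralValue γ g ≤ 32 * C := by
    have := h.gain_le hs hC hd 0
    simp only [abs_zero, add_zero, Real.one_rpow, mul_one] at this
    nlinarith
  have e : 4 * gainDensity γ g z - (4 * collisionRate γ g z + 1) * centralValue γ g =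
      4 * (gainDensity γ g z - gainDensity γ g 0) -
        4 * (collisionRate γ g z - collisionRate γ g 0) * centralValue γ g := by
    linear_combination -hc
  have d1 := h.abs_gain_sub_le hs hs3 hC hd hz
  have d2 := h.abs_rate_sub_le hs hd hz
  have J := singularMass_nonneg s
  have p : 0 ≤ |z| ^ (3 / 4 : ℝ) := by positivity
  rw [e]
  refine (abs_sub _ _).trans ?_
  rw [abs_mul, abs_mul, abs_mul, abs_of_nonneg c0, abs_of_pos (by norm_num : (0 : ℝ) < 4)]
  calc _ ≤ 4 * (5576 * C ^ 2 * singularMass s * |z| ^ (3 / 4 : ℝ)) +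
        4 * (2 * C * singularMass s * |z| ^ (3 / 4 : ℝ)) * (32 * C) := by gcongr
    _ ≤ _ := by unfold holderConst; linarith

/-- With ν the collision rate, y = x (g - c) satisfies y' = E - (4 ν/x) y, where E is the forcing of
`abs_forcing_le`, and |y| = O(|x|) because g is bounded. The damping has the good sign when moving
away from 0 on either side, so the comparison gives |y| = O(|x|^(7/4)). -/
theorem abs_sub_centralValue_le (h : GoodProfile γ g) (hs : 1 < s) (hs3 : s ≤ 3) (hC : 0 ≤ C)
    (hd : HasDecay C s g) {x : ℝ} (hx : x ≠ 0) (hx1 : |x| ≤ 1) :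
    |g x - centralValue γ g| ≤ holderConst C s * |x| ^ (3 / 4 : ℝ) := by
  set c := centralValue γ g with hc
  set E : ℝ → ℝ := fun x => 4 * gainDensity γ g x - (4 * collisionRate γ g x + 1) * c with hE
  set y : ℝ → ℝ := fun x => x * (g x - c) with hy
  have hyd : ∀ x, x ≠ 0 → HasDerivAt y (E x - 4 * collisionRate γ g x / x * y x) x := by
    intro x hx
    refine ((hasDerivAt_id x).mul ((h.hasDerivAt hs hC hd hx).sub_const c)).congr_deriv ?_
    simp only [hE, hy, id, profileDeriv]
    field_simp
    ring
  have hyB : ∀ x, |y x| ≤ (C + |c|) * |x| := fun x => by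
    rw [hy, abs_mul, mul_comm]
    gcongr
    refine (abs_sub _ _).trans ?_
    rw [abs_of_nonneg (h.nonneg x)]
    gcongr
    exact le_of_hasDecay (by linarith) hC hd x
  have hK := holderConst_pos (C := C) (s := s)
  have hx0 : 0 < |x| := abs_pos.2 hx
  have key : |y x| ≤ holderConst C s * |x| ^ (7 / 4 : ℝ) := by
    rcases lt_or_gt_of_ne hx with hneg | hpos
    · have := abs_le_of_damped (y := fun t => y (-t)) (E := fun t => -E (-t))
        (a := fun t => 4 * collisionRate γ g (-t) / t) (B := C + |c|) (x := -x) hK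
        (fun t ht => (hyB (-t)).trans_eq (by rw [abs_neg, abs_of_pos ht.1]))
        (fun t ht => ?_)
        (fun t ht => div_nonneg (mul_nonneg (by norm_num) (rate_nonneg _ _ _)) ht.1.le)
        (fun t ht => ?_) ⟨by linarith, by rwa [abs_of_neg hneg] at hx1⟩
      · simpa [abs_of_neg hneg] using this
      · have := (hyd (-t) (by linarith [ht.1])).comp t (hasDerivAt_neg t)
        refine this.congr_deriv ?_
        have := ht.1.ne'
        field_simp
        ring
      · have := h.abs_forcing_le hs hs3 hC hd (z := -t)
          (by rw [abs_neg, abs_of_pos ht.1]; exact ht.2)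
        rwa [abs_neg t, abs_of_pos ht.1, ← abs_neg] at this
    · have := abs_le_of_damped (y := y) (E := E)
        (a := fun t => 4 * collisionRate γ g t / t) (B := C + |c|) (x := x) hK
        (fun t ht => (hyB t).trans_eq (by rw [abs_of_pos ht.1]))
        (fun t ht => hyd t ht.1.ne')
        (fun t ht => div_nonneg (mul_nonneg (by norm_num) (rate_nonneg _ _ _)) ht.1.le)
        (fun t ht => ?_) ⟨hpos, by rwa [abs_of_pos hpos] at hx1⟩
      · rwa [abs_of_pos hpos]
      · have := h.abs_forcing_le hs hs3 hC hd (z := t) (by rw [abs_of_pos ht.1]; exact ht.2)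
        rwa [abs_of_pos ht.1] at this
  have e : |x| ^ (7 / 4 : ℝ) = |x| * |x| ^ (3 / 4 : ℝ) := by
    rw [← Real.rpow_one_add' hx0.le (by norm_num)]; norm_num
  rw [hy, abs_mul, e] at key
  refine le_of_mul_le_mul_left (key.trans_eq (by ring)) hx0

theorem tendsto_centralValue (h : GoodProfile γ g) (hs : 1 < s) (hs3 : s ≤ 3) (hC : 0 ≤ C)
    (hd : HasDecay C s g) :
    Filter.Tendsto g (nhdsWithin 0 {0}ᶜ) (nhds (centralValue γ g)) := by
  rw [tendsto_iff_dist_tendsto_zero]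
  have h1 : Filter.Tendsto (fun x : ℝ => holderConst C s * |x| ^ (3 / 4 : ℝ))
      (nhdsWithin 0 {0}ᶜ) (nhds 0) := by
    have : Continuous fun x : ℝ => holderConst C s * |x| ^ (3 / 4 : ℝ) :=
      continuous_const.mul (continuous_abs.rpow_const fun _ => Or.inr (by norm_num))
    have h2 := this.tendsto 0
    rw [abs_zero, Real.zero_rpow (by norm_num), mul_zero] at h2
    exact h2.mono_left nhdsWithin_le_nhds
  refine tendsto_of_tendsto_of_tendsto_of_le_of_le' tendsto_const_nhds h1
    (Filter.Eventually.of_forall fun _ => dist_nonneg) ?_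
  filter_upwards [self_mem_nhdsWithin, nhdsWithin_le_nhds (Metric.closedBall_mem_nhds 0 one_pos)]
    with x hx hx1
  rw [Real.dist_eq]
  exact h.abs_sub_centralValue_le hs hs3 hC hd hx (by simpa using hx1)

/-- Near 0 the numerator of g' is the forcing minus (4 ν + 1)(g - c), with ν the collision rate;
both are O(|x|^(3/4)), and 4 ν + 1 ≤ 13 there. For |x| ≥ 1 this is `abs_deriv_le` rewritten with the
same majorant. -/
theorem abs_deriv_le_weight (h : GoodProfile γ g) (hs : 1 < s) (hs3 : s ≤ 3) (hC : 0 ≤ C)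
    (hd : HasDecay C s g) {x : ℝ} (hx : x ≠ 0) :
    |profileDeriv γ g x| ≤ (82 * C + 224 * holderConst C s) *
      (|x| ^ (-(1 / 4 : ℝ)) * (1 + |x|) ^ (-(s + 3 / 4))) := by
  have hx0 : 0 < |x| := abs_pos.2 hx
  have p1 : 0 < 1 + |x| := by positivity
  have hK := holderConst_pos (C := C) (s := s)
  set H := holderConst C s with hH
  have e1 : (1 : ℝ) / |x| = |x| ^ (-(1 / 4 : ℝ)) * |x| ^ (-(3 / 4 : ℝ)) := by
    rw [← Real.rpow_add hx0, one_div, ← Real.rpow_neg_one]; norm_num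
  rcases le_total |x| 1 with hx1 | hx1
  · set c := centralValue γ g with hc
    have a1 := h.abs_sub_centralValue_le hs hs3 hC hd hx hx1
    have a2 := h.abs_forcing_le hs hs3 hC hd hx1
    have r0 := rate_nonneg γ g x
    have r1 := h.rate_le x
    have e : profileDeriv γ g x = ((4 * gainDensity γ g x - (4 * collisionRate γ g x + 1) * c) -
        (4 * collisionRate γ g x + 1) * (g x - c)) / x := by
      unfold profileDeriv; ring
    have b : |profileDeriv γ g x| ≤ 14 * H * |x| ^ (3 / 4 : ℝ) / |x| := by
      rw [e, abs_div]
      gcongr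
      refine (abs_sub _ _).trans ?_
      rw [abs_mul, abs_of_nonneg (by positivity : 0 ≤ 4 * collisionRate γ g x + 1)]
      calc _ ≤ H * |x| ^ (3 / 4 : ℝ) + 13 * (H * |x| ^ (3 / 4 : ℝ)) := by
            gcongr
            linarith
        _ = _ := by ring
    have w : (1 : ℝ) ≤ 16 * (1 + |x|) ^ (-(s + 3 / 4)) := by
      have : (1 + |x|) ^ (s + 3 / 4) ≤ 16 := by
        calc (1 + |x|) ^ (s + 3 / 4) ≤ 2 ^ (s + 3 / 4) := by gcongr; linarith
          _ ≤ 2 ^ (4 : ℝ) := Real.rpow_le_rpow_of_exponent_le (by norm_num) (by linarith)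
          _ = 16 := by norm_num
      rw [Real.rpow_neg p1.le, ← div_eq_mul_inv, le_div_iff₀ (by positivity)]
      linarith
    have e2 : |x| ^ (3 / 4 : ℝ) / |x| = |x| ^ (-(1 / 4 : ℝ)) := by
      rw [div_eq_mul_one_div, e1, mul_left_comm, ← Real.rpow_add hx0]; simp
    have q : 0 ≤ |x| ^ (-(1 / 4 : ℝ)) := by positivity
    calc _ ≤ 14 * H * |x| ^ (-(1 / 4 : ℝ)) * 1 := by rw [← e2, mul_one, ← mul_div_assoc]; exact b
      _ ≤ 14 * H * |x| ^ (-(1 / 4 : ℝ)) * (16 * (1 + |x|) ^ (-(s + 3 / 4))) := by gcongr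
      _ = 224 * H * (|x| ^ (-(1 / 4 : ℝ)) * (1 + |x|) ^ (-(s + 3 / 4))) := by ring
      _ ≤ _ := by
        gcongr
        linarith
  · have b := h.abs_deriv_le hs hC hd x
    have w : |x| ^ (-(3 / 4 : ℝ)) ≤ 2 * (1 + |x|) ^ (-(3 / 4 : ℝ)) := by
      calc |x| ^ (-(3 / 4 : ℝ)) ≤ ((1 + |x|) / 2) ^ (-(3 / 4 : ℝ)) :=
            Real.rpow_le_rpow_of_nonpos (by positivity) (by linarith) (by norm_num)
        _ = 2 ^ (3 / 4 : ℝ) * (1 + |x|) ^ (-(3 / 4 : ℝ)) := by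
          rw [Real.div_rpow (by positivity) (by norm_num), Real.rpow_neg (by norm_num : (0:ℝ) ≤ 2),
            div_inv_eq_mul, mul_comm]
        _ ≤ 2 ^ (1 : ℝ) * (1 + |x|) ^ (-(3 / 4 : ℝ)) := by
          gcongr
          · norm_num
          · norm_num
        _ = _ := by norm_num
    calc _ ≤ 41 * C * (1 + |x|) ^ (-s) * (1 / |x|) := b.trans_eq (by ring)
      _ ≤ 41 * C * (1 + |x|) ^ (-s) * (|x| ^ (-(1 / 4 : ℝ)) * (2 * (1 + |x|) ^ (-(3 / 4 : ℝ)))) := by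
        rw [e1]; gcongr
      _ = 82 * C * (|x| ^ (-(1 / 4 : ℝ)) * ((1 + |x|) ^ (-s) * (1 + |x|) ^ (-(3 / 4 : ℝ)))) := by
        ring
      _ = 82 * C * (|x| ^ (-(1 / 4 : ℝ)) * (1 + |x|) ^ (-(s + 3 / 4))) := by
        rw [← Real.rpow_add p1]; congr 3; ring
      _ ≤ _ := by
        gcongr
        linarith

end GoodProfile

/-! ### Integration by parts across the origin; Fourier bound and weak derivative -/

/-- Integral of a derivative over the line for a function with a removable singularity at `0`. -/
theorem integral_deriv_eq_zero_of_tendsto {E : Type*} [NormedAddCommGroup E] [NormedSpace ℝ E]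
    [CompleteSpace E] {F F' : ℝ → E} {c : E} (hd : ∀ x, x ≠ 0 → HasDerivAt F (F' x) x)
    (hF' : Integrable F') (h0 : Filter.Tendsto F (nhdsWithin 0 {0}ᶜ) (nhds c))
    (hi : Filter.Tendsto F (Filter.cocompact ℝ) (nhds 0)) : ∫ x, F' x = 0 := by
  set H : ℝ → E := Function.update F 0 c with hH
  have hHF : ∀ x, x ≠ 0 → H x = F x := fun x hx => Function.update_of_ne hx _ _
  have hc : ContinuousAt H 0 := continuousAt_update_same.2 h0
  have hHd : ∀ x, x ≠ 0 → HasDerivAt H (F' x) x := fun x hx =>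
    (hd x hx).congr_of_eventuallyEq (by
      filter_upwards [isOpen_compl_singleton.mem_nhds hx] with y hy using hHF y hy)
  have hHi : Filter.Tendsto H (Filter.cocompact ℝ) (nhds 0) := by
    refine hi.congr' ?_
    filter_upwards [(isCompact_singleton (x := (0 : ℝ))).compl_mem_cocompact] with y hy
    exact (hHF y hy).symm
  -- On the two half-lines the integrals are c and -c: the common limit at 0 cancels.
  rw [← setIntegral_univ, ← Set.Iic_union_Ioi (a := (0 : ℝ)),
    setIntegral_union (Set.Iic_disjoint_Ioi le_rfl) measurableSet_Ioi hF'.integrableOn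
      hF'.integrableOn,
    integral_Iic_of_hasDerivAt_of_tendsto hc.continuousWithinAt
      (fun x hx => hHd x (ne_of_lt hx)) hF'.integrableOn (hHi.mono_left atBot_le_cocompact),
    integral_Ioi_of_hasDerivAt_of_tendsto hc.continuousWithinAt
      (fun x hx => hHd x (ne_of_gt hx)) hF'.integrableOn (hHi.mono_left atTop_le_cocompact)]
  abel

/-- Integration by parts on the line for a function with a removable singularity at `0`. -/
theorem integral_smul_deriv_eq_neg {E : Type*} [NormedAddCommGroup E] [NormedSpace ℝ E]
    [CompleteSpace E] {f f' : ℝ → ℝ} {c : ℝ} (hd : ∀ x, x ≠ 0 → HasDerivAt f (f' x) x)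
    (hf : Integrable f) (hf' : Integrable f')
    (h0 : Filter.Tendsto f (nhdsWithin 0 {0}ᶜ) (nhds c))
    (hi : Filter.Tendsto f (Filter.cocompact ℝ) (nhds 0)) {ψ ψ' : ℝ → E} {B B' : ℝ}
    (hψ : ∀ x, HasDerivAt ψ (ψ' x) x) (hψ' : Continuous ψ') (hB : ∀ x, ‖ψ x‖ ≤ B)
    (hB' : ∀ x, ‖ψ' x‖ ≤ B') : ∫ x, f x • ψ' x = -∫ x, f' x • ψ x := by
  have hψc : Continuous ψ := continuous_iff_continuousAt.2 fun x => (hψ x).continuousAt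
  have i1 : Integrable fun x => f x • ψ' x :=
    hf.smul_bdd B' hψ'.aestronglyMeasurable (Filter.Eventually.of_forall hB')
  have i2 : Integrable fun x => f' x • ψ x :=
    hf'.smul_bdd B hψc.aestronglyMeasurable (Filter.Eventually.of_forall hB)
  have key := integral_deriv_eq_zero_of_tendsto (F := fun x => f x • ψ x)
    (F' := fun x => f x • ψ' x + f' x • ψ x) (c := c • ψ 0)
    (fun x hx => (hd x hx).smul (hψ x)) (i1.add i2)
    (h0.smul (hψc.continuousAt.tendsto.mono_left nhdsWithin_le_nhds)) ?_
  · rw [integral_add i1 i2] at key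
    exact eq_neg_of_add_eq_zero_left key
  · rw [tendsto_zero_iff_norm_tendsto_zero]
    have h1 : Filter.Tendsto (fun x => ‖f x‖ * B) (Filter.cocompact ℝ) (nhds 0) := by
      simpa using hi.norm.mul_const B
    refine squeeze_zero (fun _ => norm_nonneg _) (fun x => ?_) h1
    rw [norm_smul]
    gcongr
    exact hB x

/-- Integration by parts against the exponential yields the term with |ξ|; the trivial bound yields
the term with 1. -/
theorem norm_fourierHat_le {f f' : ℝ → ℝ} {c : ℝ} (hd : ∀ x, x ≠ 0 → HasDerivAt f (f' x) x)
    (hf : Integrable f) (hf' : Integrable f')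
    (h0 : Filter.Tendsto f (nhdsWithin 0 {0}ᶜ) (nhds c))
    (hi : Filter.Tendsto f (Filter.cocompact ℝ) (nhds 0)) (ξ : ℝ) :
    (1 + |ξ|) * ‖fourierHat f ξ‖ ≤ (∫ x, |f x|) + ∫ x, |f' x| := by
  set ψ : ℝ → ℂ := fun x => Complex.exp (-(Complex.I * (x : ℂ) * (ξ : ℂ))) with hψ
  have hn : ∀ x, ‖ψ x‖ = 1 := fun x => by
    have : -(Complex.I * (x : ℂ) * (ξ : ℂ)) = ((-(x * ξ) : ℝ) : ℂ) * Complex.I := by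
      push_cast; ring
    rw [hψ]
    simp only [this, Complex.norm_exp_ofReal_mul_I]
  have hψd : ∀ x : ℝ, HasDerivAt ψ (-(Complex.I * ξ) * ψ x) x := fun x => by
    have h1 : HasDerivAt (fun x : ℝ => -(Complex.I * (x : ℂ) * (ξ : ℂ))) (-(Complex.I * ξ)) x := by
      have := (((hasDerivAt_id x).ofReal_comp).const_mul Complex.I).mul_const (ξ : ℂ)
      simpa using this.fun_neg
    exact h1.cexp.congr_deriv (by rw [hψ]; ring)
  have hψc : Continuous ψ := by fun_prop
  have parts := integral_smul_deriv_eq_neg hd hf hf' h0 hi hψd (continuous_const.mul hψc)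
    (fun x => (hn x).le) (fun x => by rw [norm_mul, hn x])
  have e : fourierHat f ξ = ∫ x, f x • ψ x := by
    unfold fourierHat
    simp only [Complex.real_smul, hψ]
  have b1 : ‖fourierHat f ξ‖ ≤ ∫ x, |f x| := by
    rw [e]
    refine (norm_integral_le_integral_norm _).trans_eq ?_
    simp only [norm_smul, hn, mul_one, Real.norm_eq_abs]
  have b2 : |ξ| * ‖fourierHat f ξ‖ ≤ ∫ x, |f' x| := by
    have e2 : ∫ x, f x • (-(Complex.I * ξ) * ψ x) = -(Complex.I * ξ) * fourierHat f ξ := by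
      rw [e, ← integral_const_mul]
      congr 1
      funext x
      rw [mul_smul_comm]
    rw [e2] at parts
    have e3 := congrArg norm parts
    rw [norm_mul, norm_neg, norm_neg, norm_mul, Complex.norm_I, one_mul, Complex.norm_real,
      Real.norm_eq_abs] at e3
    rw [e3]
    refine (norm_integral_le_integral_norm _).trans_eq ?_
    simp only [norm_smul, hn, mul_one, Real.norm_eq_abs]
  linarith

theorem hasWeakDeriv_of_hasDerivAt {f f' : ℝ → ℝ} {c : ℝ}
    (hd : ∀ x, x ≠ 0 → HasDerivAt f (f' x) x) (hf : Integrable f) (hf' : Integrable f')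
    (h0 : Filter.Tendsto f (nhdsWithin 0 {0}ᶜ) (nhds c))
    (hi : Filter.Tendsto f (Filter.cocompact ℝ) (nhds 0)) : HasWeakDeriv f f' := by
  refine ⟨hf.locallyIntegrable, hf'.locallyIntegrable, fun φ hφ hs => ?_⟩
  have hφ' : Continuous (deriv φ) := hφ.continuous_deriv (by simp)
  obtain ⟨B, hB⟩ := hφ.continuous.bounded_above_of_compact_support hs
  obtain ⟨B', hB'⟩ := hφ'.bounded_above_of_compact_support hs.deriv
  exact integral_smul_deriv_eq_neg hd hf hf' h0 hi
    (fun x => (hφ.differentiable (by simp) x).hasDerivAt) hφ' hB hB'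

/-! ### Change of representative and majorants of the norms -/

theorem HasWeakDeriv.congr {f g f' : ℝ → ℝ} (h : HasWeakDeriv f f') (hfg : f =ᵐ[volume] g) :
    HasWeakDeriv g f' := by
  refine ⟨h.1.congr hfg, h.2.1, fun φ hφ hs => ?_⟩
  rw [← h.2.2 φ hφ hs]
  exact integral_congr_ae (by filter_upwards [hfg] with x hx; rw [hx])

theorem weightedLpNorm_congr {f g : ℝ → ℝ} (hfg : f =ᵐ[volume] g) (p : ℝ≥0∞) (k : ℝ) :
    weightedLpNorm p k f = weightedLpNorm p k g :=
  eLpNorm_congr_ae (by filter_upwards [hfg] with x hx; rw [hx])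

theorem fourierHat_congr {f g : ℝ → ℝ} (hfg : f =ᵐ[volume] g) (ξ : ℝ) :
    fourierHat f ξ = fourierHat g ξ :=
  integral_congr_ae (by filter_upwards [hfg] with x hx; rw [hx])

theorem HasDecay.tendsto_cocompact {C s : ℝ} {g : ℝ → ℝ} (hd : HasDecay C s g) (hs : 0 < 1 + s)
    (hg : ∀ x, 0 ≤ g x) : Filter.Tendsto g (Filter.cocompact ℝ) (nhds 0) := by
  have h1 : Filter.Tendsto (fun x : ℝ => 1 + |x|) (Filter.cocompact ℝ) Filter.atTop :=
    Filter.tendsto_atTop_add_const_left _ _ (tendsto_norm_cocompact_atTop (E := ℝ))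
  have h2 := ((tendsto_rpow_neg_atTop hs).comp h1).const_mul C
  rw [mul_zero] at h2
  exact squeeze_zero hg hd h2

theorem polyWeight_nonneg (k x : ℝ) : 0 ≤ polyWeight k x := Real.rpow_nonneg (by positivity) _

theorem memLp_two_inv_one_add_abs (C : ℝ) :
    MemLp (fun x : ℝ => C * (1 + |x|) ^ (-(1 : ℝ))) 2 volume := by
  refine MemLp.const_mul ((memLp_two_iff_integrable_sq (Measurable.aestronglyMeasurable
    (by fun_prop))).2 ?_) C
  refine (integrable_one_add_abs (s := 2) (by norm_num)).congr
    (Filter.Eventually.of_forall fun x => ?_)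
  change (1 + |x|) ^ (-(2 : ℝ)) = ((1 + |x|) ^ (-(1 : ℝ))) ^ 2
  rw [← Real.rpow_mul_natCast (by positivity)]
  norm_num

theorem memLp_two_singular (K : ℝ) :
    MemLp (fun x : ℝ => K * (|x| ^ (-(1 / 4 : ℝ)) * (1 + |x|) ^ (-(3 / 4 : ℝ)))) 2 volume := by
  refine MemLp.const_mul ((memLp_two_iff_integrable_sq (Measurable.aestronglyMeasurable
    (by fun_prop))).2 ?_) K
  refine (integrable_abs_rpow_mul (a := 1 / 2) (b := 3 / 2) (by norm_num) (by norm_num)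
    (by norm_num)).congr (Filter.Eventually.of_forall fun x => ?_)
  change |x| ^ (-(1 / 2 : ℝ)) * (1 + |x|) ^ (-(3 / 2 : ℝ)) =
    (|x| ^ (-(1 / 4 : ℝ)) * (1 + |x|) ^ (-(3 / 4 : ℝ))) ^ 2
  rw [mul_pow, ← Real.rpow_mul_natCast (by positivity), ← Real.rpow_mul_natCast (by positivity)]
  norm_num

/-- The majorant of the norms of a profile with decay constant `C` and derivative constant `K`. -/
def profileNormBound (C K s : ℝ) : ℝ≥0∞ :=
  (eLpNorm (fun x : ℝ => C * (1 + |x|) ^ (-(1 : ℝ))) 2 volume ^ 2 +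
    eLpNorm (fun x : ℝ => K * (|x| ^ (-(1 / 4 : ℝ)) * (1 + |x|) ^ (-(3 / 4 : ℝ)))) 2 volume ^ 2) ^
      (1 / 2 : ℝ) +
  (eLpNorm (fun x : ℝ => C * (1 + |x|) ^ (-(1 + s))) 1 volume +
    eLpNorm (fun x : ℝ => K * (|x| ^ (-(1 / 4 : ℝ)) * (1 + |x|) ^ (-(s + 3 / 4)))) 1 volume)

theorem profileNormBound_ne_top (C K : ℝ) {s : ℝ} (hs : 1 < s) : profileNormBound C K s ≠ ⊤ := by
  have m1 := (memLp_two_inv_one_add_abs C).eLpNorm_ne_top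
  have m2 := (memLp_two_singular K).eLpNorm_ne_top
  have m3 := (memLp_one_iff_integrable.2
    ((integrable_one_add_abs (s := 1 + s) (by linarith)).const_mul C)).eLpNorm_ne_top
  have m4 := (memLp_one_iff_integrable.2 ((integrable_abs_rpow_mul (a := 1 / 4) (b := s + 3 / 4)
    (by norm_num) (by norm_num) (by linarith)).const_mul K)).eLpNorm_ne_top
  exact ENNReal.add_ne_top.2 ⟨ENNReal.rpow_ne_top_of_nonneg (by norm_num)
    (ENNReal.add_ne_top.2 ⟨ENNReal.pow_ne_top m1, ENNReal.pow_ne_top m2⟩),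
    ENNReal.add_ne_top.2 ⟨m3, m4⟩⟩

/-- For k ≤ s the weight is absorbed by the decay, leaving (1 + |x|)^(-1) for g and |x|^(-1/4) (1 +
|x|)^(-3/4) for g'. Both are square integrable, and the majorant does not depend on k. -/
theorem norms_le_profileNormBound {C K s k : ℝ} {g g' : ℝ → ℝ} (hk : k ≤ s) (hC : 0 ≤ C)
    (hK : 0 ≤ K) (hg : ∀ x, |g x| ≤ C * (1 + |x|) ^ (-(1 + s)))
    (hg' : ∀ x, x ≠ 0 →
      |g' x| ≤ K * (|x| ^ (-(1 / 4 : ℝ)) * (1 + |x|) ^ (-(s + 3 / 4)))) :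
    weightedH1Norm k g g' + w11Norm g g' ≤ profileNormBound C K s := by
  have hne : ∀ᵐ x : ℝ, x ≠ 0 := by rw [ae_iff]; simp
  have hw : ∀ x b : ℝ, polyWeight k x * (1 + |x|) ^ (-(s + b)) ≤ (1 + |x|) ^ (-b) := fun x b => by
    unfold polyWeight
    rw [← Real.rpow_add (by positivity)]
    exact Real.rpow_le_rpow_of_exponent_le (by linarith [abs_nonneg x]) (by linarith)
  have b1 : weightedLpNorm 2 k g ≤ eLpNorm (fun x : ℝ => C * (1 + |x|) ^ (-(1 : ℝ))) 2 volume := by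
    refine eLpNorm_mono_real fun x => ?_
    rw [norm_mul, Real.norm_eq_abs, Real.norm_eq_abs, abs_of_nonneg (polyWeight_nonneg k x)]
    have p := polyWeight_nonneg k x
    calc _ ≤ polyWeight k x * (C * (1 + |x|) ^ (-(1 + s))) := by gcongr; exact hg x
      _ = C * (polyWeight k x * (1 + |x|) ^ (-(s + 1))) := by rw [add_comm s 1]; ring
      _ ≤ _ := by gcongr; exact hw x 1
  have b2 : weightedLpNorm 2 k g' ≤ eLpNorm
      (fun x : ℝ => K * (|x| ^ (-(1 / 4 : ℝ)) * (1 + |x|) ^ (-(3 / 4 : ℝ)))) 2 volume := by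
    refine eLpNorm_mono_ae_real ?_
    filter_upwards [hne] with x hx
    rw [norm_mul, Real.norm_eq_abs, Real.norm_eq_abs, abs_of_nonneg (polyWeight_nonneg k x)]
    have p := polyWeight_nonneg k x
    calc _ ≤ polyWeight k x * (K * (|x| ^ (-(1 / 4 : ℝ)) * (1 + |x|) ^ (-(s + 3 / 4)))) := by
          gcongr; exact hg' x hx
      _ = K * (|x| ^ (-(1 / 4 : ℝ)) * (polyWeight k x * (1 + |x|) ^ (-(s + 3 / 4)))) := by ring
      _ ≤ _ := by gcongr; exact hw x (3 / 4)
  have b3 : eLpNorm g 1 volume ≤ eLpNorm (fun x : ℝ => C * (1 + |x|) ^ (-(1 + s))) 1 volume :=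
    eLpNorm_mono_real hg
  have b4 : eLpNorm g' 1 volume ≤ eLpNorm
      (fun x : ℝ => K * (|x| ^ (-(1 / 4 : ℝ)) * (1 + |x|) ^ (-(s + 3 / 4)))) 1 volume :=
    eLpNorm_mono_ae_real (by filter_upwards [hne] with x hx using hg' x hx)
  unfold weightedH1Norm w11Norm profileNormBound
  gcongr

theorem GoodProfile.measurable_deriv {γ C s : ℝ} {g : ℝ → ℝ} (h : GoodProfile γ g) (hs : 1 < s)
    (hC : 0 ≤ C) (hd : HasDecay C s g) : Measurable (profileDeriv γ g) :=
  (((h.continuous_gain hs hC hd).measurable.const_mul 4).sub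
    (((h.continuous_rate.measurable.const_mul 4).add_const 1).mul h.measurable)).div measurable_id

end

/-! ### Conclusion -/

theorem theorem3p6 (δ : ℝ) (hδ : δ ∈ Set.Ioo (0 : ℝ) (1 / 2)) :
    ∃ γs ∈ Set.Ioo (0 : ℝ) 1, ∃ C : ℝ, 0 < C ∧
      ∀ γ ∈ Set.Ioo (0 : ℝ) γs, ∀ G : ℝ → ℝ, IsProfile γ G →
        (∃ G' : ℝ → ℝ, HasWeakDeriv G G' ∧
          ∀ k : ℝ, 0 ≤ k → k < 3 - 5 * γ / 2 - δ →
            weightedH1Norm k G G' + w11Norm G G' ≤ ENNReal.ofReal C) ∧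
        ∀ ξ : ℝ, ‖fourierHat G ξ‖ ≤ C / Real.sqrt (1 + ξ ^ 2) := by
  obtain ⟨hδ0, hδ1⟩ := hδ
  -- Any s in (2, 3) with s ≥ 3 - δ would do: for γ > 0 every admissible k is then below s.
  set s : ℝ := 3 - δ / 2 with hs
  have hs2 : 2 < s := by linarith
  have hs3 : s < 3 := by linarith
  obtain ⟨γ₁, hγ₁, D, hD, hdecay⟩ := exists_decay hs2 hs3
  set K := 82 * D + 224 * holderConst D s with hK
  have hK0 : 0 < K := by have := holderConst_pos (C := D) (s := s); positivity
  have htop := profileNormBound_ne_top D K (s := s) (by linarith)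
  set C := (profileNormBound D K s).toReal + 1 with hC
  have hC0 : 0 < C := by positivity
  refine ⟨min γ₁ (1 / 2), ⟨lt_min hγ₁ (by norm_num), (min_le_right _ _).trans_lt (by norm_num)⟩,
    C, hC0, fun γ hγ G hG => ?_⟩
  have hγ2 : γ < 1 / 2 := hγ.2.trans_le (min_le_right _ _)
  obtain ⟨g, hGg, hg⟩ := hG.exists_good hγ.1 (by linarith)
  have hd := hdecay γ (hγ.2.trans_le (min_le_left _ _)) g hg
  have hs1 : 1 < s := by linarith
  have hder : ∀ x, x ≠ 0 → HasDerivAt g (profileDeriv γ g x) x :=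
    fun x hx => hg.hasDerivAt hs1 hD.le hd hx
  have hder_le : ∀ x, x ≠ 0 → |profileDeriv γ g x| ≤
      K * (|x| ^ (-(1 / 4 : ℝ)) * (1 + |x|) ^ (-(s + 3 / 4))) :=
    fun x hx => hg.abs_deriv_le_weight hs1 hs3.le hD.le hd hx
  have hint := hg.profile.integrable
  have hint' : Integrable (profileDeriv γ g) := by
    have hne : ∀ᵐ x : ℝ, x ≠ 0 := by rw [ae_iff]; simp
    refine ((integrable_abs_rpow_mul (a := 1 / 4) (b := s + 3 / 4) (by norm_num) (by norm_num)
      (by linarith)).const_mul K).mono' (hg.measurable_deriv hs1 hD.le hd).aestronglyMeasurable ?_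
    filter_upwards [hne] with x hx using hder_le x hx
  have h0 := hg.tendsto_centralValue hs1 hs3.le hD.le hd
  have hi := hd.tendsto_cocompact (by linarith) hg.nonneg
  have hbound : ∀ k : ℝ, k ≤ s → weightedH1Norm k g (profileDeriv γ g) +
      w11Norm g (profileDeriv γ g) ≤ ENNReal.ofReal C := fun k hk => by
    refine (norms_le_profileNormBound hk hD.le hK0.le
      (fun x => (abs_of_nonneg (hg.nonneg x)).trans_le (hd x)) hder_le).trans ?_
    rw [← ENNReal.ofReal_toReal htop]
    exact ENNReal.ofReal_le_ofReal (by linarith)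
  refine ⟨⟨profileDeriv γ g, (hasWeakDeriv_of_hasDerivAt hder hint hint' h0 hi).congr hGg.symm,
    fun k _ hk => ?_⟩, fun ξ => ?_⟩
  · unfold weightedH1Norm w11Norm
    rw [weightedLpNorm_congr hGg, eLpNorm_congr_ae hGg]
    exact hbound k (by linarith [hγ.1])
  · have hF := norm_fourierHat_le hder hint hint' h0 hi ξ
    have hN : (∫ x, |g x|) + ∫ x, |profileDeriv γ g x| ≤ C := by
      -- The case k = 0 is used only to extract the `w11Norm` part, so the same constant serves for
      -- the Fourier bound.
      have hle := le_add_self.trans (hbound 0 (by linarith))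
      unfold w11Norm at hle
      rw [eLpNorm_one_eq_lintegral_enorm, eLpNorm_one_eq_lintegral_enorm,
        ← ofReal_integral_norm_eq_lintegral_enorm hint,
        ← ofReal_integral_norm_eq_lintegral_enorm hint',
        ← ENNReal.ofReal_add (integral_nonneg fun _ => norm_nonneg _)
          (integral_nonneg fun _ => norm_nonneg _)] at hle
      exact (ENNReal.ofReal_le_ofReal_iff hC0.le).1 hle
    have hsq : Real.sqrt (1 + ξ ^ 2) ≤ 1 + |ξ| := by
      rw [Real.sqrt_le_left (by positivity)]
      nlinarith [sq_abs ξ, abs_nonneg ξ]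
    rw [fourierHat_congr hGg, le_div_iff₀ (by positivity), mul_comm]
    calc _ ≤ (1 + |ξ|) * ‖fourierHat g ξ‖ := by gcongr
      _ ≤ C := hF.trans hN
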